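/- Let $a,b>0$ and $\kappa,\alpha\in(0,1)$ be constants, let $K=K_n$ be integers with $K_n/n\to\kappa$, and put $p=a/n$, $q=b/n$. Let $S$ be a uniformly random $K$-subset of $V=\{1,\dots,n\}$ and let $\sigma_i=\mathbf 1(i\in S)$. Given $S$, let $G$ be the random graph on $V$ whose edges are independent, an edge $\{i,j\}$ being present with probability $p$ if $i,j\in S$ and with probability $q$ otherwise. Independently of the edges, each vertex of $S$ is a cue with probability $\alpha$, independently, and no other vertex is a cue; let $C$ be the set of cues and $c_i=\mathbf 1(i\in C)$. Put $\upsilon_n=\log\frac{n-K}{K(1-\alpha)}$. The belief propagation (BP) messages are $R^0_{i\to u}=0$ and $$R^{t+1}_{i\to u}=-K(p-q)+\sum_{l\sim i,\ l\in C,\ l\ne u}\log\frac pq+\sum_{l\sim i,\ l\notin C,\ l\ne u}\log\frac{e^{R^t_{l\to i}-\upsilon_n}\,(p/q)+1}{e^{R^t_{l\to i}-\upsilon_n}+1},$$ and their posterior form is $\widetilde R^t_{i\to u}=R^t_{i\to u}-\upsilon_n$. Let also $$\widehat R^t_{i\to u}=\log\frac{\mathbb P(\sigma_i=1\mid G_i^t\setminus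 u,\ C_i^t\setminus u,\ c_i=0)}{\mathbb P(\sigma_i=0\mid G_i^t\setminus u,\ C_i^t\setminus u,\ c_i=0)}$$ be the exact posterior log-likelihood ratio, where $G_i^t\setminus u$ is the subgraph of $G$ induced on the vertices within distance $t$ of $i$ after removal of the edges at $u$, and $C_i^t\setminus u$ is the set of cues in it. Then there are random variables $\xi_0^t,\xi_1^t$ ($t\ge 0$) such that, for every fixed $t$ and $x\in\{0,1\}$, as $n\to\infty$, both $\widetilde R^t_{i\to u}$ and $\widehat R^t_{i\to u}$, conditioned on $\sigma_i=x$, on $i\sim u$ and on $c_i=c_u=0$, converge in distribution to $\xi_x^t$ (for each bounded continuous test function, uniformly over the pairs $i\neq u$). Their laws satisfy $\xi_0^0=\xi_1^0=\log\frac{\kappa(1-\alpha)}{1-\kappa}$ and, for every $t\ge 0$, $$\xi_0^{t+1}\overset{D}{=}h+\sum_{i=1}^{L_{0c}}\log\rho+\sum_{i=1}^{L_{00}}f(\xi^t_{0,i})+\sum_{i=1}^{L_{01}}f(\xi^t_{1,i}),$$ $$\xi_1^{t+1}\overset{D}{=}h+\sum_{i=1}^{L_{1c}}\log\rho+\sum_{i=1}^{L_{10}}f(\xi^t_{0,i})+\sum_{i=1}^{L_{11}}f(\xi^t_{1,i}),$$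 where $\rho=a/b$, $h=-\kappa(a-b)-\log\frac{1-\kappa}{\kappa(1-\alpha)}$, $f(x)=\log\frac{e^x\rho+1}{e^x+1}$. In each equation all the variables on the right are independent, $\xi^t_{0,i}$ and $\xi^t_{1,i}$ are distributed as $\xi^t_0$ and $\xi^t_1$, and $$L_{0c}\sim\mathrm{Poi}(\kappa b\alpha),\quad L_{00}\sim\mathrm{Poi}((1-\kappa)b),\quad L_{01}\sim\mathrm{Poi}(\kappa b(1-\alpha)),$$ $$L_{1c}\sim\mathrm{Poi}(\kappa a\alpha),\quad L_{10}\sim\mathrm{Poi}((1-\kappa)b),\quad L_{11}\sim\mathrm{Poi}(\kappa a(1-\alpha)).$$ -/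

import Mathlib

open MeasureTheory ProbabilityTheory Filter
open scoped BigOperators NNReal ENNReal Topology BoundedContinuousFunction

namespace HiddenCommunity

/-- A realization of the model on the vertex set `Fin n`: the hidden community `S`,
the observed graph `G`, and the set of cues `C`. -/
@[ext] structure Config (n : ℕ) where
  S : Finset (Fin n)
  G : SimpleGraph (Fin n)
  C : Finset (Fin n)

instance (n : ℕ) : MeasurableSpace (Config n) := ⊤

/-- The community label `σ_i`. -/
def Config.label {n : ℕ} (ω : Config n) (i : Fin n) : Fin 2 :=
  if i ∈ ω.S then 1 else 0

open Classical in
/-- The probability of a realization: `S` is uniform among the sets of size `K`; given `S`, the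
edges are independent, an edge being present with probability `p` if both of its ends lie in `S`
and with probability `q` otherwise; and, independently, each vertex of `S` is a cue with
probability `α`, whereas no vertex outside `S` is a cue. -/
noncomputable def weight {n : ℕ} (K : ℕ) (p q α : ℝ) (ω : Config n) : ℝ :=
  (if ω.S.card = K then ((n.choose K : ℕ) : ℝ)⁻¹ else 0) *
  (∏ e ∈ (Finset.univ : Finset (Fin n × Fin n)).filter (fun e => e.1 < e.2),
    (let r := if e.1 ∈ ω.S ∧ e.2 ∈ ω.S then p else q
     if ω.G.Adj e.1 e.2 then r else 1 - r)) *
  (∏ i : Fin n,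
    (let r := if i ∈ ω.S then α else 0
     if i ∈ ω.C then r else 1 - r))

/-- The law of `G(K, n, p, q)` with perfect side-information of parameter `α`. It is a probability
measure as soon as `K ≤ n` and `p, q, α ∈ [0, 1]`. -/
noncomputable def law (n K : ℕ) (p q α : ℝ) : Measure (Config n) :=
  Measure.sum fun ω : Config n => ENNReal.ofReal (weight K p q α ω) • Measure.dirac ω

/-- The prior log-likelihood ratio `υ = log ((n - K) / (K (1 - α)))` of an uncued vertex. -/
noncomputable def upsilon (n K : ℕ) (α : ℝ) : ℝ :=
  Real.log (((n : ℝ) - K) / (K * (1 - α)))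

open Classical in
/-- The belief propagation message `R^t_{i → u}`. -/
noncomputable def bpMessage {n : ℕ} (K : ℕ) (p q α : ℝ) (ω : Config n) :
    ℕ → Fin n → Fin n → ℝ
  | 0, _, _ => 0
  | t + 1, i, u =>
      -(K : ℝ) * (p - q)
      + ∑ _l ∈ Finset.univ.filter (fun l => ω.G.Adj i l ∧ l ∈ ω.C ∧ l ≠ u), Real.log (p / q)
      + ∑ l ∈ Finset.univ.filter (fun l => ω.G.Adj i l ∧ l ∉ ω.C ∧ l ≠ u),
          Real.log
            ((Real.exp (bpMessage K p q α ω t l i - upsilon n K α) * (p / q) + 1) /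
              (Real.exp (bpMessage K p q α ω t l i - upsilon n K α) + 1))

/-- The posterior form `R^t_{i → u} - υ` of the belief propagation message. -/
noncomputable def bpPosteriorMessage {n : ℕ} (K : ℕ) (p q α : ℝ) (t : ℕ) (ω : Config n)
    (i u : Fin n) : ℝ :=
  bpMessage K p q α ω t i u - upsilon n K α

/-- The vertices at graph distance at most `t` from `i` once the edges at `u` are removed. -/
noncomputable def Config.ball {n : ℕ} (ω : Config n) (t : ℕ) (i u : Fin n) : Set (Fin n) :=
  {j | (ω.G.deleteIncidenceSet u).edist i j ≤ t}

/-- The `t`-hop neighbourhood of `i` without `u`, and its cues: the set of its vertices, the edges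
of the graph between them, and the cues among them. -/
noncomputable def Config.view {n : ℕ} (ω : Config n) (t : ℕ) (i u : Fin n) :
    Set (Fin n) × Set (Fin n × Fin n) × Set (Fin n) :=
  (ω.ball t i u,
   {e | e.1 ∈ ω.ball t i u ∧ e.2 ∈ ω.ball t i u ∧ ω.G.Adj e.1 e.2},
   {j | j ∈ ω.ball t i u ∧ j ∈ ω.C})

/-- The exact posterior log-likelihood ratio
`log (P(σ_i = 1 | view, c_i = 0) / P(σ_i = 0 | view, c_i = 0))`, where the view is the observed
`t`-hop neighbourhood of `i` without `u`, together with its cues. -/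
noncomputable def exactPosteriorMessage {n : ℕ} (K : ℕ) (p q α : ℝ) (t : ℕ) (ω : Config n)
    (i u : Fin n) : ℝ :=
  Real.log
    (((law n K p q α)[|{ω' | ω'.view t i u = ω.view t i u ∧ i ∉ ω'.C}]).real
        {ω' | ω'.label i = 1} /
     ((law n K p q α)[|{ω' | ω'.view t i u = ω.view t i u ∧ i ∉ ω'.C}]).real
        {ω' | ω'.label i = 0})

/-- The event that `σ_i = x` and that a message is sent from `i` to `u`, that is, `i` and `u` are
adjacent and both are uncued. -/
def messageEvent {n : ℕ} (x : Fin 2) (i u : Fin n) : Set (Config n) :=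
  {ω | ω.label i = x ∧ i ∉ ω.C ∧ u ∉ ω.C ∧ ω.G.Adj i u}

/-- As `n → ∞`, the law of the message `X n · i u`, given `σ_i = x` and given that `i → u` is a
directed edge between uncued vertices, converges weakly to `μ` (uniformly over the pairs of
distinct vertices `i, u`). -/
def MessagesConvergeInLaw (P : ∀ n : ℕ, Measure (Config n)) (x : Fin 2)
    (X : ∀ n : ℕ, Config n → Fin n → Fin n → ℝ) (μ : ProbabilityMeasure ℝ) : Prop :=
  ∀ g : ℝ →ᵇ ℝ, ∀ ε : ℝ, 0 < ε → ∀ᶠ n : ℕ in atTop, ∀ i u : Fin n, i ≠ u →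
    |(∫ ω, g (X n ω i u) ∂((P n)[|messageEvent x i u])) - ∫ y, g y ∂(μ : Measure ℝ)| < ε

/-- The function `f(x) = log ((e^x ρ + 1) / (e^x + 1))`. -/
noncomputable def f (ρ x : ℝ) : ℝ :=
  Real.log ((Real.exp x * ρ + 1) / (Real.exp x + 1))

/-- The law of `h + ∑_{i ≤ Lc} log ρ + ∑_{i ≤ L0} f(ξ_{0,i}) + ∑_{i ≤ L1} f(ξ_{1,i})`, where
`Lc`, `L0`, `L1` are Poisson with means `rc`, `r0`, `r1`, the `ξ_{0,i}` have law `μ₀`, the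
`ξ_{1,i}` have law `μ₁`, and all these variables are independent. -/
noncomputable def poissonSumLaw (h ρ : ℝ) (rc r0 r1 : ℝ≥0) (μ₀ μ₁ : ProbabilityMeasure ℝ) :
    Measure ℝ :=
  ((poissonMeasure rc).prod ((poissonMeasure r0).prod ((poissonMeasure r1).prod
    ((Measure.infinitePi fun _ : ℕ => (μ₀ : Measure ℝ)).prod
      (Measure.infinitePi fun _ : ℕ => (μ₁ : Measure ℝ)))))).map
    fun (Lc, L0, L1, ξ₀, ξ₁) =>
      h + ∑ _i ∈ Finset.range Lc, Real.log ρ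
        + ∑ i ∈ Finset.range L0, f ρ (ξ₀ i) + ∑ i ∈ Finset.range L1, f ρ (ξ₁ i)

end HiddenCommunity

/-! Locally the graph looks like a two-type branching process, and on trees belief propagation is
exact. Given the community `S`, the edges and cues are independent coordinates
(`integral_law_eq_sum_E`), so the estimates are proved for a fixed `S`, uniformly in `S`, and
averaged at the end. What is visible around a vertex is recorded as an unlabelled tree with cue
marks, `Config.hist`. In the limiting law of this tree, `Params.limitLaw`, the children of a vertex
are the points of a Poisson process whose intensity mixes over the hidden label and the cue status
of the child.

Convergence of histories (`Params.histConverges`) needs no coupling. A Poisson law on multisets is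
determined by its mass at the empty multiset and by the Mecke formula `(count e + 1) * P(e ::ₘ τ) =
rate e * P(τ)`. The graph satisfies the same identity up to a vanishing error
(`Params.Fits.mecke_approx`): marking a child is a sum over vertices `k`, the edge to `k` is
independent of the branch behind it, and the empirical frequency of each type of branch
concentrates. Concentration is a second moment bound, resting on the near independence of two
histories. Thus histories of depth `t` control the empirical measure at depth `t`, which controls
histories of depth `t + 1`.

Each message is a function of the history outside a rare event. The belief propagation message is
`histMessage` unless a short walk closes up. For the exact posterior, tree-like neighbourhoods with
the same history differ by a permutation of the vertices that fixes `i` and `u` and preserves the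
law. Hence the posterior odds depend only on the history, as a ratio of joint probabilities. The
limit of this ratio, found by dividing the Mecke formulas of the two labels, obeys the belief
propagation recursion (`Params.log_likelihood_eq_message`).

Conditioning on `i ∼ u`, an event of probability of order `1/n`, costs nothing: the histories and
bad events ignore the edge `{i, u}`, so its probability factors out
(`Params.eventually_abs_E_message_sub_le`). The recursion in law follows from characteristic
functions (`Params.messageLaw_succ`), since splitting the children by label and cue status produces
the three Poisson sums. -/

namespace HiddenCommunity

/-! ### Expectations over independent Bernoulli coordinates -/

section BernoulliExp

variable {ι : Type*} [Fintype ι] [DecidableEq ι]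

/-- The expectation of `Y` when the coordinates are independent Bernoulli variables with
parameters `r`. -/
noncomputable def bernoulliExp (r : ι → ℝ) : ((ι → Bool) → ℝ) →ₗ[ℝ] ℝ where
  toFun Y := ∑ x : ι → Bool, (∏ j, if x j then r j else 1 - r j) * Y x
  map_add' Y Z := by simp [mul_add, Finset.sum_add_distrib]
  map_smul' c Y := by
    simp only [Pi.smul_apply, smul_eq_mul, RingHom.id_apply, Finset.mul_sum]
    exact Finset.sum_congr rfl fun x _ => by ring

theorem bernoulliExp_apply (r : ι → ℝ) (Y : (ι → Bool) → ℝ) :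
    bernoulliExp r Y = ∑ x : ι → Bool, (∏ j, if x j then r j else 1 - r j) * Y x := rfl

theorem bernoulliExp_one (r : ι → ℝ) : bernoulliExp r (fun _ => 1) = 1 := by
  have h := Finset.prod_univ_sum (fun _ : ι => (Finset.univ : Finset Bool))
    (fun j b => if b then r j else 1 - r j)
  simp only [Fintype.piFinset_univ] at h
  simp [bernoulliExp_apply, ← h]

theorem bernoulliExp_mono {r : ι → ℝ} (h0 : ∀ j, 0 ≤ r j) (h1 : ∀ j, r j ≤ 1)
    {Y Z : (ι → Bool) → ℝ} (h : ∀ x, Y x ≤ Z x) : bernoulliExp r Y ≤ bernoulliExp r Z := by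
  refine Finset.sum_le_sum fun x _ => mul_le_mul_of_nonneg_left (h x) (Finset.prod_nonneg ?_)
  intro j _
  split_ifs
  · exact h0 j
  · linarith [h1 j]

/-- A coordinate is independent of every variable that does not depend on it. -/
theorem bernoulliExp_coord_mul (r : ι → ℝ) (j : ι) (Y : (ι → Bool) → ℝ)
    (hY : ∀ x, Y (Function.update x j true) = Y (Function.update x j false)) :
    bernoulliExp r (fun x => (if x j then 1 else 0) * Y x) = r j * bernoulliExp r Y := by
  have hY' : ∀ x b, Y (Function.update x j b) = Y x := by
    intro x b
    have h1 : Y (Function.update x j (x j)) = Y x := by rw [Function.update_eq_self]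
    have h2 := hY x
    cases b <;> cases hx : x j <;> simp_all
  -- Summing over coordinate `j` first pairs each assignment with its flip. On such a pair `Y` is
  -- constant and the weights differ only in the factor at `j`.
  have key : ∀ F : (ι → Bool) → ℝ, ∑ x, F x
      = ∑ y : {i // i ≠ j} → Bool, (F ((Equiv.funSplitAt j Bool).symm (true, y))
        + F ((Equiv.funSplitAt j Bool).symm (false, y))) := by
    intro F
    rw [← (Equiv.funSplitAt j Bool).symm.sum_comp, Fintype.sum_prod_type]
    simp [Finset.sum_add_distrib]
  rw [bernoulliExp_apply, bernoulliExp_apply, key, key, Finset.mul_sum]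
  refine Finset.sum_congr rfl fun y _ => ?_
  set x := (Equiv.funSplitAt j Bool).symm (true, y) with hx
  have hxf : (Equiv.funSplitAt j Bool).symm (false, y) = Function.update x j false := by
    ext i
    by_cases hi : i = j
    · subst hi; simp [Equiv.funSplitAt, Equiv.piSplitAt]
    · simp [hx, Equiv.funSplitAt, Equiv.piSplitAt, hi]
  have hxj : x j = true := by simp [hx, Equiv.funSplitAt, Equiv.piSplitAt]
  rw [hxf, hY' x false]
  have hp : ∀ b, ∏ i, (if Function.update x j b i then r i else 1 - r i)
      = (if b then r j else 1 - r j) * ∏ i ∈ Finset.univ.erase j,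
        (if x i then r i else 1 - r i) := by
    intro b
    rw [← Finset.mul_prod_erase _ _ (Finset.mem_univ j)]
    congr 1
    · simp
    · refine Finset.prod_congr rfl fun i hi => ?_
      rw [Function.update_of_ne (Finset.ne_of_mem_erase hi)]
  have hpt : ∏ i, (if x i then r i else 1 - r i)
      = r j * ∏ i ∈ Finset.univ.erase j, (if x i then r i else 1 - r i) := by
    have := hp true
    rwa [← hxj, Function.update_eq_self, hxj, if_pos rfl] at this
  rw [hpt, hp false]
  simp [hxj]
  ring

end BernoulliExp

/-! ### The model with a fixed community -/

/-- The coordinates of a configuration with a given community: the pairs of vertices and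
the vertices. -/
abbrev Coord (n : ℕ) := {e : Fin n × Fin n // e.1 < e.2} ⊕ Fin n

/-- The configuration with community `S` and with the edges and cues marked by `x`. -/
def config {n : ℕ} (S : Finset (Fin n)) (x : Coord n → Bool) : Config n where
  S := S
  G :=
    { Adj := fun i j => (∃ h : i < j, x (Sum.inl ⟨(i, j), h⟩) = true) ∨
        (∃ h : j < i, x (Sum.inl ⟨(j, i), h⟩) = true)
      symm := ⟨fun _ _ h => h.symm⟩
      loopless := ⟨fun _ h => by rcases h with ⟨h, _⟩ | ⟨h, _⟩ <;> exact lt_irrefl _ h⟩ }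
  C := Finset.univ.filter fun i => x (Sum.inr i) = true

theorem config_adj_of_lt {n : ℕ} {S : Finset (Fin n)} {x : Coord n → Bool} {i j : Fin n}
    (h : i < j) : (config S x).G.Adj i j ↔ x (Sum.inl ⟨(i, j), h⟩) = true := by
  simp [config, h, not_lt_of_gt h]

theorem mem_config_C {n : ℕ} {S : Finset (Fin n)} {x : Coord n → Bool} {i : Fin n} :
    i ∈ (config S x).C ↔ x (Sum.inr i) = true := by
  simp [config]

open Classical in
/-- The configurations with community `S` are parametrized by the marks of the coordinates. -/
noncomputable def configEquiv (n : ℕ) :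
    Finset (Fin n) × (Coord n → Bool) ≃ Config n where
  toFun y := config y.1 y.2
  invFun ω := (ω.S, Sum.elim (fun e => decide (ω.G.Adj e.1.1 e.1.2)) (fun i => decide (i ∈ ω.C)))
  left_inv := by
    rintro ⟨S, x⟩
    refine Prod.ext rfl ?_
    funext c
    rcases c with ⟨⟨i, j⟩, h⟩ | i
    · simp only [Sum.elim_inl]
      rw [Bool.eq_iff_iff, decide_eq_true_iff, config_adj_of_lt h]
    · simp only [Sum.elim_inr]
      rw [Bool.eq_iff_iff, decide_eq_true_iff, mem_config_C]
  right_inv := by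
    rintro ⟨S, G, C⟩
    refine Config.ext rfl ?_ ?_
    · ext i j
      simp only [config, Sum.elim_inl, decide_eq_true_eq, exists_prop]
      constructor
      · rintro (⟨_, h⟩ | ⟨_, h⟩)
        exacts [h, h.symm]
      · intro h
        rcases lt_or_gt_of_ne h.ne with h' | h'
        exacts [Or.inl ⟨h', h⟩, Or.inr ⟨h', h.symm⟩]
    · ext i
      simp [config]

noncomputable instance (n : ℕ) : Fintype (Config n) := Fintype.ofEquiv _ (configEquiv n)

instance (n : ℕ) : DiscreteMeasurableSpace (Config n) := ⟨fun _ => trivial⟩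

/-- The data of the model given the community `S`. -/
structure Model (n : ℕ) where
  S : Finset (Fin n)
  p : ℝ
  q : ℝ
  α : ℝ
  p_nonneg : 0 ≤ p
  p_le_one : p ≤ 1
  q_nonneg : 0 ≤ q
  q_le_one : q ≤ 1
  α_nonneg : 0 ≤ α
  α_le_one : α ≤ 1

namespace Model

variable {n : ℕ} (M : Model n)

/-- The probability that `i` and `j` are adjacent. -/
noncomputable def edge (i j : Fin n) : ℝ := if i ∈ M.S ∧ j ∈ M.S then M.p else M.q

/-- The probability that `i` is a cue. -/
noncomputable def cue (i : Fin n) : ℝ := if i ∈ M.S then M.α else 0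

theorem edge_comm (i j : Fin n) : M.edge i j = M.edge j i := by simp [edge, and_comm]

theorem edge_nonneg (i j : Fin n) : 0 ≤ M.edge i j := by
  unfold edge; split_ifs; exacts [M.p_nonneg, M.q_nonneg]

theorem edge_le_one (i j : Fin n) : M.edge i j ≤ 1 := by
  unfold edge; split_ifs; exacts [M.p_le_one, M.q_le_one]

theorem cue_nonneg (i : Fin n) : 0 ≤ M.cue i := by
  unfold cue; split_ifs; exacts [M.α_nonneg, le_rfl]

theorem cue_le_one (i : Fin n) : M.cue i ≤ 1 := by
  unfold cue; split_ifs; exacts [M.α_le_one, zero_le_one]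

/-- The success probabilities of the coordinates. -/
noncomputable def prob : Coord n → ℝ :=
  Sum.elim (fun e => M.edge e.1.1 e.1.2) M.cue

theorem prob_nonneg (j : Coord n) : 0 ≤ M.prob j := by
  rcases j with e | i
  exacts [M.edge_nonneg _ _, M.cue_nonneg _]

theorem prob_le_one (j : Coord n) : M.prob j ≤ 1 := by
  rcases j with e | i
  exacts [M.edge_le_one _ _, M.cue_le_one _]

/-- The expectation given the community. -/
noncomputable def E : (Config n → ℝ) →ₗ[ℝ] ℝ :=
  (bernoulliExp M.prob).comp (LinearMap.funLeft ℝ ℝ (config M.S))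

theorem E_apply (Y : Config n → ℝ) :
    M.E Y = bernoulliExp M.prob (fun x => Y (config M.S x)) := rfl

theorem E_one : M.E (fun _ => 1) = 1 := bernoulliExp_one _

theorem E_const (c : ℝ) : M.E (fun _ => c) = c := by
  have := M.E.map_smul c (fun _ => 1)
  rw [E_one] at this
  simpa [Pi.smul_def] using this

theorem E_mono_of_S {Y Z : Config n → ℝ} (h : ∀ ω, ω.S = M.S → Y ω ≤ Z ω) : M.E Y ≤ M.E Z :=
  bernoulliExp_mono M.prob_nonneg M.prob_le_one fun _ => h _ rfl

theorem E_mono {Y Z : Config n → ℝ} (h : ∀ ω, Y ω ≤ Z ω) : M.E Y ≤ M.E Z :=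
  M.E_mono_of_S fun ω _ => h ω

theorem E_congr_of_S {Y Z : Config n → ℝ} (h : ∀ ω, ω.S = M.S → Y ω = Z ω) : M.E Y = M.E Z :=
  le_antisymm (M.E_mono_of_S fun ω hω => (h ω hω).le) (M.E_mono_of_S fun ω hω => (h ω hω).ge)

theorem E_nonneg {Y : Config n → ℝ} (h : ∀ ω, 0 ≤ Y ω) : 0 ≤ M.E Y := by
  have := M.E_mono h
  rwa [M.E_const] at this

theorem E_le_of_le {Y : Config n → ℝ} {c : ℝ} (h : ∀ ω, Y ω ≤ c) : M.E Y ≤ c := by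
  have := M.E_mono h
  rwa [M.E_const] at this

theorem E_add (Y Z : Config n → ℝ) : M.E (fun ω => Y ω + Z ω) = M.E Y + M.E Z := M.E.map_add Y Z

theorem E_sub (Y Z : Config n → ℝ) : M.E (fun ω => Y ω - Z ω) = M.E Y - M.E Z := M.E.map_sub Y Z

theorem E_mul_left (c : ℝ) (Y : Config n → ℝ) : M.E (fun ω => c * Y ω) = c * M.E Y :=
  M.E.map_smul c Y

theorem E_sum {κ : Type*} (s : Finset κ) (Y : κ → Config n → ℝ) :
    M.E (fun ω => ∑ k ∈ s, Y k ω) = ∑ k ∈ s, M.E (Y k) := by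
  rw [← map_sum]
  congr 1
  ext ω
  simp

theorem abs_E_le (Y : Config n → ℝ) : |M.E Y| ≤ M.E (fun ω => |Y ω|) := by
  rw [abs_le]
  constructor
  · have := M.E_mono (fun ω => neg_abs_le (Y ω))
    have h2 := M.E_mul_left (-1) (fun ω => |Y ω|)
    simp only [neg_mul, one_mul] at h2
    rwa [h2] at this
  · exact M.E_mono fun ω => le_abs_self _

theorem abs_E_sub_le (Y Z : Config n → ℝ) : |M.E Y - M.E Z| ≤ M.E (fun ω => |Y ω - Z ω|) := by
  rw [← E_sub]
  exact M.abs_E_le _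

/-- The Cauchy-Schwarz inequality. -/
theorem E_abs_sq_le (Y : Config n → ℝ) : (M.E fun ω => |Y ω|) ^ 2 ≤ M.E fun ω => Y ω ^ 2 := by
  set m := M.E fun ω => |Y ω|
  have h : 0 ≤ M.E fun ω => (|Y ω| - m) ^ 2 := M.E_nonneg fun ω => sq_nonneg _
  have h2 : (M.E fun ω => (|Y ω| - m) ^ 2)
      = (M.E fun ω => Y ω ^ 2) - 2 * m * (M.E fun ω => |Y ω|) + m ^ 2 := by
    rw [← E_mul_left, ← E_sub]
    conv_rhs => rw [← M.E_const (m ^ 2), ← E_add]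
    congr 1
    ext ω
    rw [sub_sq, sq_abs]
    ring
  rw [h2] at h
  change 0 ≤ _ - 2 * m * m + m ^ 2 at h
  nlinarith

open Classical in
/-- The probability given the community. -/
noncomputable def Pr (A : Set (Config n)) : ℝ := M.E (A.indicator fun _ => 1)

theorem Pr_nonneg (A : Set (Config n)) : 0 ≤ M.Pr A :=
  M.E_nonneg fun ω => Set.indicator_nonneg (fun _ _ => zero_le_one) ω

theorem Pr_mono_of_S {A B : Set (Config n)} (h : ∀ ω, ω.S = M.S → ω ∈ A → ω ∈ B) :
    M.Pr A ≤ M.Pr B := by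
  refine M.E_mono_of_S fun ω hω => ?_
  by_cases hA : ω ∈ A
  · simp [hA, h ω hω hA]
  · simp [hA, Set.indicator_nonneg]

theorem Pr_mono {A B : Set (Config n)} (h : A ⊆ B) : M.Pr A ≤ M.Pr B :=
  M.Pr_mono_of_S fun _ _ hA => h hA

theorem Pr_le_one (A : Set (Config n)) : M.Pr A ≤ 1 :=
  M.E_le_of_le fun ω => Set.indicator_le_self' (fun _ _ => zero_le_one) ω

theorem Pr_union_le (A B : Set (Config n)) : M.Pr (A ∪ B) ≤ M.Pr A + M.Pr B := by
  rw [Pr, Pr, Pr, ← E_add]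
  refine M.E_mono fun ω => ?_
  by_cases hA : ω ∈ A <;> by_cases hB : ω ∈ B <;> simp [hA, hB]

theorem Pr_exists_le {κ : Type*} (s : Finset κ) (A : κ → Set (Config n)) :
    M.Pr {ω | ∃ k ∈ s, ω ∈ A k} ≤ ∑ k ∈ s, M.Pr (A k) := by
  simp only [Pr]
  rw [← E_sum]
  refine M.E_mono fun ω => ?_
  have hn : ∀ k ∈ s, (0 : ℝ) ≤ (A k).indicator (fun _ => 1) ω :=
    fun k _ => Set.indicator_nonneg (fun _ _ => zero_le_one) ω
  by_cases h : ω ∈ {ω | ∃ k ∈ s, ω ∈ A k}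
  · obtain ⟨k, hk, hA⟩ := h
    refine le_trans ?_ (Finset.single_le_sum hn hk)
    rw [Set.indicator_of_mem (show ω ∈ {ω | ∃ k ∈ s, ω ∈ A k} from ⟨k, hk, hA⟩),
      Set.indicator_of_mem hA]
  · rw [Set.indicator_of_notMem h]
    exact Finset.sum_nonneg hn

end Model

/-! ### Variables that ignore one edge or one cue -/

/-- `Y` does not depend on the presence of the edge `{i, j}`. -/
def EdgeFree {n : ℕ} {β : Type*} (i j : Fin n) (Y : Config n → β) : Prop :=
  ∀ ω ω' : Config n, ω.S = ω'.S → ω.C = ω'.C →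
    (∀ x y, ¬(x = i ∧ y = j) → ¬(x = j ∧ y = i) → (ω.G.Adj x y ↔ ω'.G.Adj x y)) → Y ω = Y ω'

/-- `Y` does not depend on whether `i` is a cue. -/
def CueFree {n : ℕ} {β : Type*} (i : Fin n) (Y : Config n → β) : Prop :=
  ∀ ω ω' : Config n, ω.S = ω'.S → ω.G = ω'.G →
    (∀ x, x ≠ i → (x ∈ ω.C ↔ x ∈ ω'.C)) → Y ω = Y ω'

theorem EdgeFree.symm {n : ℕ} {β : Type*} {i j : Fin n} {Y : Config n → β} (h : EdgeFree i j Y) :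
    EdgeFree j i Y := fun ω ω' hS hC hG => h ω ω' hS hC fun x y h1 h2 => hG x y h2 h1

theorem EdgeFree.comp {n : ℕ} {β γ : Type*} {i j : Fin n} {Y : Config n → β} (h : EdgeFree i j Y)
    (F : β → γ) : EdgeFree i j fun ω => F (Y ω) :=
  fun ω ω' hS hC hG => congrArg F (h ω ω' hS hC hG)

theorem EdgeFree.comp₂ {n : ℕ} {β γ δ : Type*} {i j : Fin n} {Y : Config n → β}
    {Z : Config n → γ} (h : EdgeFree i j Y) (h' : EdgeFree i j Z)
    (F : β → γ → δ) : EdgeFree i j fun ω => F (Y ω) (Z ω) :=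
  fun ω ω' hS hC hG => congrArg₂ F (h ω ω' hS hC hG) (h' ω ω' hS hC hG)

theorem edgeFree_C {n : ℕ} {β : Type*} (i j : Fin n) (F : Finset (Fin n) → β) :
    EdgeFree i j fun ω => F ω.C := fun _ _ _ hC _ => congrArg F hC

namespace Model

variable {n : ℕ} (M : Model n)

open Classical in
/-- Distinct edges are independent. -/
theorem E_adj_mul {i j : Fin n} (hij : i ≠ j) {Y : Config n → ℝ} (hY : EdgeFree i j Y) :
    M.E (fun ω => (if ω.G.Adj i j then 1 else 0) * Y ω) = M.edge i j * M.E Y := by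
  wlog h : i < j generalizing i j
  · have h' : j < i := lt_of_le_of_ne (not_lt.1 h) hij.symm
    have := this hij.symm hY.symm h'
    simpa only [SimpleGraph.adj_comm, M.edge_comm] using this
  have := bernoulliExp_coord_mul M.prob (Sum.inl ⟨(i, j), h⟩) (fun x => Y (config M.S x)) ?_
  · rw [E_apply, E_apply]
    simpa only [config_adj_of_lt h, prob, Sum.elim_inl] using this
  · intro x
    refine hY _ _ rfl ?_ ?_
    · ext k
      simp [mem_config_C]
    · intro u v h1 h2
      have aux : ∀ (u v : Fin n) (huv : u < v), ¬(u = i ∧ v = j) → ∀ b,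
          (Function.update x (Sum.inl ⟨(i, j), h⟩) b (Sum.inl ⟨(u, v), huv⟩)
            = x (Sum.inl ⟨(u, v), huv⟩)) := by
        intro u v huv hne b
        refine Function.update_of_ne ?_ _ _
        intro he
        simp only [Sum.inl.injEq, Subtype.mk.injEq, Prod.mk.injEq] at he
        exact hne he
      rcases lt_trichotomy u v with huv | huv | huv
      · rw [config_adj_of_lt huv, config_adj_of_lt huv, aux _ _ _ h1, aux _ _ _ h1]
      · subst huv; simp
      · rw [SimpleGraph.adj_comm, config_adj_of_lt huv, SimpleGraph.adj_comm,
          config_adj_of_lt huv, aux _ _ _ (fun hh => h2 ⟨hh.2, hh.1⟩),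
          aux _ _ _ (fun hh => h2 ⟨hh.2, hh.1⟩)]

open Classical in
/-- A cue is independent of the rest. -/
theorem E_cue_mul (i : Fin n) {Y : Config n → ℝ} (hY : CueFree i Y) :
    M.E (fun ω => (if i ∈ ω.C then 1 else 0) * Y ω) = M.cue i * M.E Y := by
  have := bernoulliExp_coord_mul M.prob (Sum.inr i) (fun x => Y (config M.S x)) ?_
  · rw [E_apply, E_apply]
    simpa only [mem_config_C, prob, Sum.elim_inr] using this
  · intro x
    refine hY _ _ rfl ?_ ?_
    · ext u v
      simp [config]
    · intro k hk
      rw [mem_config_C, mem_config_C, Function.update_of_ne (by simpa using hk),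
        Function.update_of_ne (by simpa using hk)]

end Model

/-! ### The law as a mixture over the community -/

theorem weight_nonneg {n : ℕ} (K : ℕ) {p q α : ℝ} (hp : 0 ≤ p) (hp' : p ≤ 1) (hq : 0 ≤ q)
    (hq' : q ≤ 1) (hα : 0 ≤ α) (hα' : α ≤ 1) (ω : Config n) : 0 ≤ weight K p q α ω := by
  unfold weight
  refine mul_nonneg (mul_nonneg ?_ (Finset.prod_nonneg fun e _ => ?_))
    (Finset.prod_nonneg fun e _ => ?_)
  · positivity
  · simp only; split_ifs <;> linarith
  · simp only; split_ifs <;> linarith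

/-- Integrals against the law are finite sums. -/
theorem integral_law {n : ℕ} (K : ℕ) {p q α : ℝ} (hp : 0 ≤ p) (hp' : p ≤ 1) (hq : 0 ≤ q)
    (hq' : q ≤ 1) (hα : 0 ≤ α) (hα' : α ≤ 1) (Y : Config n → ℝ) :
    ∫ ω, Y ω ∂(law n K p q α) = ∑ ω, weight K p q α ω * Y ω := by
  rw [law, Measure.sum_fintype, integral_finsetSum_measure]
  · refine Finset.sum_congr rfl fun ω _ => ?_
    rw [integral_smul_measure, integral_dirac,
      ENNReal.toReal_ofReal (weight_nonneg K hp hp' hq hq' hα hα' ω), smul_eq_mul]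
  · intro ω _
    exact (integrable_dirac (by simp)).smul_measure ENNReal.ofReal_ne_top

instance (n K : ℕ) (p q α : ℝ) : IsFiniteMeasure (law n K p q α) := by
  rw [law, Measure.sum_fintype]
  refine ⟨?_⟩
  simp [Measure.finsetSum_apply]

/-- Once the community is fixed, the edge and cue factors of `weight` are exactly the Bernoulli
product weight over `Coord n`. Every estimate under the law thereby becomes an average of estimates
for a fixed community. -/
theorem integral_law_eq_sum_E {n : ℕ} (K : ℕ) {p q α : ℝ} (hp : 0 ≤ p) (hp' : p ≤ 1) (hq : 0 ≤ q)
    (hq' : q ≤ 1) (hα : 0 ≤ α) (hα' : α ≤ 1) (Y : Config n → ℝ) :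
    ∫ ω, Y ω ∂(law n K p q α) = ((n.choose K : ℕ) : ℝ)⁻¹ *
      ∑ S ∈ Finset.univ.powersetCard K,
        (Model.mk S p q α hp hp' hq hq' hα hα').E Y := by
  classical
  rw [integral_law K hp hp' hq hq' hα hα', ← (configEquiv n).sum_comp, Fintype.sum_prod_type,
    Finset.mul_sum, Finset.powersetCard_eq_filter, Finset.sum_filter, Finset.powerset_univ]
  refine Finset.sum_congr rfl fun S _ => ?_
  simp only [Model.E_apply, bernoulliExp_apply]
  split_ifs with hS
  · rw [Finset.mul_sum]
    refine Finset.sum_congr rfl fun x _ => ?_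
    change weight K p q α (config S x) * Y (config S x) = _
    rw [← mul_assoc]
    congr 1
    rw [weight, if_pos (show (config S x).S.card = K from hS), mul_assoc, Fintype.prod_sum_type]
    congr 2
    · rw [Finset.prod_subtype _ (p := fun e : Fin n × Fin n => e.1 < e.2) (by simp)]
      refine Finset.prod_congr rfl fun e _ => ?_
      simp only [config_adj_of_lt e.2, Model.prob, Model.edge, Sum.elim_inl]
      rfl
    · refine Finset.prod_congr rfl fun i _ => ?_
      simp only [mem_config_C, Model.prob, Model.cue, Sum.elim_inr]
      congr
  · refine Finset.sum_eq_zero fun x _ => ?_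
    change weight K p q α (config S x) * Y (config S x) = _
    rw [weight, if_neg (show (config S x).S.card ≠ K from hS)]
    simp

/-! ### Histories, balls and tree-like neighbourhoods -/

/-- Unlabelled rooted trees of depth `t` with cue marks on the vertices other than the root. -/
def Hist : ℕ → Type
  | 0 => Unit
  | t + 1 => Multiset (Bool × Hist t)

instance Hist.countable : ∀ t, Countable (Hist t)
  | 0 => inferInstanceAs (Countable Unit)
  | t + 1 =>
    have := Hist.countable t
    inferInstanceAs (Countable (Multiset (Bool × Hist t)))

instance (t : ℕ) : MeasurableSpace (Hist t) := ⊤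

instance (t : ℕ) : DiscreteMeasurableSpace (Hist t) := ⟨fun _ => trivial⟩

noncomputable instance (t : ℕ) : DecidableEq (Hist t) := Classical.decEq _

namespace Config

variable {n : ℕ}

open Classical in
/-- The neighbours of `l` outside `D`. -/
noncomputable def nbrs (ω : Config n) (D : Finset (Fin n)) (l : Fin n) : Finset (Fin n) :=
  Finset.univ.filter fun k => ω.G.Adj l k ∧ k ∉ D

theorem mem_nbrs {ω : Config n} {D : Finset (Fin n)} {l k : Fin n} :
    k ∈ ω.nbrs D l ↔ ω.G.Adj l k ∧ k ∉ D := by simp [nbrs]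

/-- The tree of self-avoiding paths of length at most `t` from `l` that avoid `D`. -/
noncomputable def hist (ω : Config n) : (t : ℕ) → Finset (Fin n) → Fin n → Hist t
  | 0, _, _ => ()
  | t + 1, D, l =>
    (ω.nbrs D l).val.map fun k => (decide (k ∈ ω.C), hist ω t (insert l D) k)

/-- The vertices that are reached from `l` by a self-avoiding path of length at most `t`
that avoids `D`. -/
def reach (ω : Config n) : ℕ → Finset (Fin n) → Fin n → Set (Fin n)
  | 0, _, l => {l}
  | t + 1, D, l => {v | v = l ∨ ∃ k, ω.G.Adj l k ∧ k ∉ D ∧ v ∈ reach ω t (insert l D) k}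

/-- The part of the graph within distance `t` of `l` that avoids `D` is a tree. -/
def TreeLike (ω : Config n) : ℕ → Finset (Fin n) → Fin n → Prop
  | 0, _, _ => True
  | t + 1, D, l =>
    (∀ k k', ω.G.Adj l k → k ∉ D → ω.G.Adj l k' → k' ∉ D → k ≠ k' →
      ∀ x ∈ ω.reach t (insert l D) k, ∀ y ∈ ω.reach t (insert l D) k',
        x ≠ y ∧ ¬ω.G.Adj x y) ∧
    ∀ k, ω.G.Adj l k → k ∉ D → TreeLike ω t (insert l D) k

/-- A non-backtracking walk of length at most `t` that starts at `l`, not through `u`, meets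
itself or `D`. -/
def Closes (ω : Config n) : ℕ → Finset (Fin n) → Fin n → Fin n → Prop
  | 0, _, _, _ => False
  | t + 1, D, u, l =>
    (∃ d ∈ D, d ≠ u ∧ ω.G.Adj l d) ∨
      ∃ k, ω.G.Adj l k ∧ k ∉ D ∧ Closes ω t (insert l D) l k

theorem mem_reach_succ {ω : Config n} {t : ℕ} {D : Finset (Fin n)} {l v : Fin n} :
    v ∈ ω.reach (t + 1) D l ↔
      v = l ∨ ∃ k, ω.G.Adj l k ∧ k ∉ D ∧ v ∈ ω.reach t (insert l D) k := Iff.rfl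

theorem self_mem_reach (ω : Config n) (t : ℕ) (D : Finset (Fin n)) (l : Fin n) :
    l ∈ ω.reach t D l := by
  cases t
  exacts [rfl, Or.inl rfl]

theorem notMem_of_mem_reach {ω : Config n} {t : ℕ} {D : Finset (Fin n)} {l v : Fin n} (hl : l ∉ D)
    (hv : v ∈ ω.reach t D l) : v ∉ D := by
  induction t generalizing D l with
  | zero => rw [Set.mem_singleton_iff.1 hv]; exact hl
  | succ t ih =>
    rcases hv with rfl | ⟨k, hk, hkD, hv⟩
    · exact hl
    · have := ih (by simp [hkD, hk.ne']) hv
      exact fun h => this (Finset.mem_insert_of_mem h)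

theorem reach_antitone {ω : Config n} {t : ℕ} {D D' : Finset (Fin n)} (h : D ⊆ D') (l : Fin n) :
    ω.reach t D' l ⊆ ω.reach t D l := by
  induction t generalizing D D' l with
  | zero => exact subset_rfl
  | succ t ih =>
    rintro v (rfl | ⟨k, hk, hkD, hv⟩)
    · exact Or.inl rfl
    · exact Or.inr ⟨k, hk, fun hD => hkD (h hD), ih (Finset.insert_subset_insert l h) k hv⟩

/-- If the new vertex is the origin `l`, it is already reached; otherwise the step can be appended
to the tail of the path. Walks are thus shortened to self-avoiding paths without cutting out loops.
-/
theorem reach_succ_of_adj {ω : Config n} {t : ℕ} {D : Finset (Fin n)} {l v z : Fin n}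
    (hv : v ∈ ω.reach t D l) (hz : ω.G.Adj v z) (hzD : z ∉ D) : z ∈ ω.reach (t + 1) D l := by
  induction t generalizing D l with
  | zero =>
    obtain rfl := Set.mem_singleton_iff.1 hv
    exact Or.inr ⟨z, hz, hzD, rfl⟩
  | succ t ih =>
    rcases hv with rfl | ⟨k, hk, hkD, hv⟩
    · exact Or.inr ⟨z, hz, hzD, self_mem_reach _ _ _ _⟩
    · by_cases hzl : z = l
      · exact Or.inl hzl
      · exact Or.inr ⟨k, hk, hkD, ih hv (by simp [hzl, hzD])⟩

theorem reach_mono_succ {ω : Config n} {t : ℕ} {D : Finset (Fin n)} {l : Fin n} :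
    ω.reach t D l ⊆ ω.reach (t + 1) D l := by
  induction t generalizing D l with
  | zero => rintro v rfl; exact Or.inl rfl
  | succ t ih =>
    rintro v (rfl | ⟨k, hk, hkD, hv⟩)
    · exact Or.inl rfl
    · exact Or.inr ⟨k, hk, hkD, ih hv⟩

theorem reach_mono {ω : Config n} {s t : ℕ} (hst : s ≤ t) {D : Finset (Fin n)} {l : Fin n} :
    ω.reach s D l ⊆ ω.reach t D l := by
  induction hst with
  | refl => exact subset_rfl
  | step _ ih => exact ih.trans reach_mono_succ

theorem reach_trans {ω : Config n} {s t : ℕ} {D : Finset (Fin n)} {l v z : Fin n}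
    (hv : v ∈ ω.reach s D l) (hz : z ∈ ω.reach t D v) : z ∈ ω.reach (s + t) D l := by
  induction t generalizing s v with
  | zero => obtain rfl := Set.mem_singleton_iff.1 hz; exact hv
  | succ t ih =>
    rcases hz with rfl | ⟨k, hk, hkD, hz⟩
    · exact reach_mono (Nat.le_add_right _ _) hv
    · have := ih (reach_succ_of_adj hv hk hkD) (reach_antitone (Finset.subset_insert _ _) _ hz)
      rwa [Nat.add_right_comm] at this

/-- The path is reversed step by step. The reversed tail avoids more than `D`, so `reach_antitone`
applies and `l` can be appended. -/
theorem reach_symm {ω : Config n} {t : ℕ} {D : Finset (Fin n)} {l v : Fin n} (hl : l ∉ D)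
    (hv : v ∈ ω.reach t D l) : l ∈ ω.reach t D v := by
  induction t generalizing D l with
  | zero => exact (Set.mem_singleton_iff.1 hv).symm
  | succ t ih =>
    rcases hv with rfl | ⟨k, hk, hkD, hv⟩
    · exact Or.inl rfl
    · exact reach_succ_of_adj
        (reach_antitone (Finset.subset_insert _ _) _ (ih (by simp [hkD, hk.ne']) hv)) hk.symm hl

/-- The `t`-hop neighbourhood is given by self-avoiding paths. -/
theorem ball_eq_reach {ω : Config n} {t : ℕ} {i u : Fin n} (hiu : i ≠ u) :
    ω.ball t i u = ω.reach t {u} i := by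
  ext v
  simp only [ball, Set.mem_ofPred_eq]
  constructor
  · intro h
    obtain ⟨w, hw⟩ := SimpleGraph.exists_walk_of_edist_ne_top
      (ne_top_of_le_ne_top (ENat.natCast_ne_top t) h)
    rw [← hw, Nat.cast_le] at h
    clear hw
    refine reach_mono h ?_
    clear h
    have hi : i ∉ ({u} : Finset (Fin n)) := by simpa using hiu
    induction w with
    | nil => exact rfl
    | cons hadj w ih =>
      rw [SimpleGraph.deleteIncidenceSet_adj] at hadj
      rw [SimpleGraph.Walk.length_cons, add_comm]
      exact reach_trans (reach_succ_of_adj (t := 0) rfl hadj.1 (by simpa using hadj.2.2))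
        (ih hadj.2.2 (by simpa using hadj.2.2))
  · intro h
    -- The removed set must be arbitrary apart from containing `u`, because each step of a path adds
    -- a vertex to it.
    have key : ∀ (t : ℕ) (D : Finset (Fin n)) (l : Fin n), u ∈ D → l ∉ D → v ∈ ω.reach t D l →
        (ω.G.deleteIncidenceSet u).edist l v ≤ t := by
      intro t
      induction t with
      | zero =>
        rintro D l - - hv
        obtain rfl := Set.mem_singleton_iff.1 hv
        simp
      | succ t ih =>
        rintro D l hu hl (rfl | ⟨k, hk, hkD, hv⟩)
        · simp
        · have h1 := ih (insert l D) k (Finset.mem_insert_of_mem hu) (by simp [hkD, hk.ne']) hv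
          have h2 : (ω.G.deleteIncidenceSet u).Adj l k := by
            rw [SimpleGraph.deleteIncidenceSet_adj]
            exact ⟨hk, fun h => hl (h ▸ hu), fun h => hkD (h ▸ hu)⟩
          calc (ω.G.deleteIncidenceSet u).edist l v
              ≤ (ω.G.deleteIncidenceSet u).edist l k + (ω.G.deleteIncidenceSet u).edist k v :=
                SimpleGraph.edist_triangle
            _ ≤ 1 + t := add_le_add (SimpleGraph.edist_eq_one_iff_adj.2 h2).le h1
            _ = ((t + 1 : ℕ) : ℕ∞) := by push_cast; ring
    exact key t {u} i (by simp) (by simpa using hiu) h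

/-- A history does not change when a vertex out of reach is removed. -/
theorem hist_insert {ω : Config n} {t : ℕ} {D : Finset (Fin n)} {l v : Fin n}
    (hv : v ∉ ω.reach t D l) : ω.hist t (insert v D) l = ω.hist t D l := by
  induction t generalizing D l with
  | zero => rfl
  | succ t ih =>
    rw [mem_reach_succ, not_or] at hv
    have hn : ω.nbrs (insert v D) l = ω.nbrs D l := by
      ext k
      rw [mem_nbrs, mem_nbrs, Finset.mem_insert, not_or]
      refine ⟨fun h => ⟨h.1, h.2.2⟩, fun h => ⟨h.1, ?_, h.2⟩⟩
      rintro rfl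
      exact hv.2 ⟨k, h.1, h.2, self_mem_reach _ _ _ _⟩
    rw [hist, hist, hn]
    refine Multiset.map_congr rfl fun k hk => ?_
    rw [Finset.mem_val, mem_nbrs] at hk
    rw [Finset.insert_comm, ih fun h => hv.2 ⟨k, hk.1, hk.2, h⟩]

/-- Histories, balls and tree-likeness are transported by partial isomorphisms. -/
theorem transport {ω ω' : Config n} (g : Equiv.Perm (Fin n)) {B : Set (Fin n)}
    (hadj : ∀ x ∈ B, ∀ y ∈ B, ω.G.Adj x y ↔ ω'.G.Adj (g x) (g y))
    (hcue : ∀ x ∈ B, x ∈ ω.C ↔ g x ∈ ω'.C) (t : ℕ) (D : Finset (Fin n)) (l : Fin n)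
    (h : ω.reach t D l ⊆ B)
    (h' : ∀ y ∈ ω'.reach t (D.map g.toEmbedding) (g l), g.symm y ∈ B) :
    ω.hist t D l = ω'.hist t (D.map g.toEmbedding) (g l) ∧
      (∀ x, x ∈ ω.reach t D l ↔ g x ∈ ω'.reach t (D.map g.toEmbedding) (g l)) ∧
      (ω.TreeLike t D l ↔ ω'.TreeLike t (D.map g.toEmbedding) (g l)) := by
  induction t generalizing D l with
  | zero => exact ⟨rfl, fun x => by simp [reach], Iff.rfl⟩
  | succ t ih =>
    have hl : l ∈ B := h (Or.inl rfl)
    have hmem : ∀ k, g k ∈ D.map g.toEmbedding ↔ k ∈ D := by simp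
    have hins : insert (g l) (D.map g.toEmbedding) = (insert l D).map g.toEmbedding := by
      simp [Finset.map_insert]
    have hB : ∀ k, ω.G.Adj l k → k ∉ D → k ∈ B := fun k hk hkD =>
      h (Or.inr ⟨k, hk, hkD, self_mem_reach _ _ _ _⟩)
    have hB' : ∀ k, ω'.G.Adj (g l) (g k) → k ∉ D → k ∈ B := fun k hk hkD => by
      have := h' (g k) (Or.inr ⟨g k, hk, by rwa [hmem], self_mem_reach _ _ _ _⟩)
      rwa [Equiv.symm_apply_apply] at this
    have hch : ∀ k, (ω.G.Adj l k ∧ k ∉ D) ↔ (ω'.G.Adj (g l) (g k) ∧ g k ∉ D.map g.toEmbedding) := by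
      intro k
      rw [hmem]
      constructor
      · rintro ⟨hk, hkD⟩
        exact ⟨(hadj l hl k (hB k hk hkD)).1 hk, hkD⟩
      · rintro ⟨hk, hkD⟩
        exact ⟨(hadj l hl k (hB' k hk hkD)).2 hk, hkD⟩
    have hih : ∀ k, ω.G.Adj l k → k ∉ D → _ := fun k hk hkD =>
      ih (insert l D) k (fun x hx => h (Or.inr ⟨k, hk, hkD, hx⟩)) (fun y hy => h' y (by
        have := (hch k).1 ⟨hk, hkD⟩
        rw [← hins] at hy
        exact Or.inr ⟨g k, this.1, this.2, hy⟩))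
    have hreach : ∀ x, x ∈ ω.reach (t + 1) D l ↔
        g x ∈ ω'.reach (t + 1) (D.map g.toEmbedding) (g l) := by
      intro x
      rw [mem_reach_succ, mem_reach_succ, g.injective.eq_iff, hins]
      refine or_congr Iff.rfl ⟨?_, ?_⟩
      · rintro ⟨k, hk, hkD, hx⟩
        exact ⟨g k, ((hch k).1 ⟨hk, hkD⟩).1, ((hch k).1 ⟨hk, hkD⟩).2,
          ((hih k hk hkD).2.1 x).1 hx⟩
      · rintro ⟨k, hk, hkD, hx⟩
        obtain ⟨k, rfl⟩ := g.surjective k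
        obtain ⟨hk, hkD⟩ := (hch k).2 ⟨hk, hkD⟩
        exact ⟨k, hk, hkD, ((hih k hk hkD).2.1 x).2 hx⟩
    refine ⟨?_, hreach, ?_⟩
    · have hn : ω'.nbrs (D.map g.toEmbedding) (g l) = (ω.nbrs D l).map g.toEmbedding := by
        ext k
        obtain ⟨k, rfl⟩ := g.surjective k
        rw [mem_nbrs, ← hch k]
        simp [mem_nbrs]
      rw [hist, hist, hn, Finset.map_val, Multiset.map_map]
      refine Multiset.map_congr rfl fun k hk => ?_
      rw [Finset.mem_val, mem_nbrs] at hk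
      simp only [Function.comp_apply, Equiv.coe_toEmbedding]
      rw [hins, (hih k hk.1 hk.2).1]
      simp only [hcue k (hB k hk.1 hk.2)]
    · rw [TreeLike, TreeLike, hins]
      refine and_congr ⟨?_, ?_⟩ ⟨?_, ?_⟩
      · intro H k k' hk hkD hk' hkD' hne x hx y hy
        obtain ⟨k, rfl⟩ := g.surjective k
        obtain ⟨k', rfl⟩ := g.surjective k'
        obtain ⟨x, rfl⟩ := g.surjective x
        obtain ⟨y, rfl⟩ := g.surjective y
        obtain ⟨hk, hkD⟩ := (hch k).2 ⟨hk, hkD⟩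
        obtain ⟨hk', hkD'⟩ := (hch k').2 ⟨hk', hkD'⟩
        have hx := ((hih k hk hkD).2.1 x).2 hx
        have hy := ((hih k' hk' hkD').2.1 y).2 hy
        have := H k k' hk hkD hk' hkD' (fun e => hne (by rw [e])) x hx y hy
        rw [g.injective.ne_iff, ← hadj x (h (Or.inr ⟨k, hk, hkD, hx⟩)) y
          (h (Or.inr ⟨k', hk', hkD', hy⟩))]
        exact this
      · intro H k k' hk hkD hk' hkD' hne x hx y hy
        have := H (g k) (g k') ((hch k).1 ⟨hk, hkD⟩).1 ((hch k).1 ⟨hk, hkD⟩).2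
          ((hch k').1 ⟨hk', hkD'⟩).1 ((hch k').1 ⟨hk', hkD'⟩).2 (g.injective.ne hne)
          (g x) (((hih k hk hkD).2.1 x).1 hx) (g y) (((hih k' hk' hkD').2.1 y).1 hy)
        rwa [g.injective.ne_iff, ← hadj x (h (Or.inr ⟨k, hk, hkD, hx⟩)) y
          (h (Or.inr ⟨k', hk', hkD', hy⟩))] at this
      · intro H k hk hkD
        obtain ⟨k, rfl⟩ := g.surjective k
        obtain ⟨hk, hkD⟩ := (hch k).2 ⟨hk, hkD⟩
        exact (hih k hk hkD).2.2.1 (H k hk hkD)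
      · intro H k hk hkD
        have := (hch k).1 ⟨hk, hkD⟩
        exact (hih k hk hkD).2.2.2 (H (g k) this.1 this.2)

/-- Histories and balls only depend on what lies outside `D`. -/
theorem hist_congr {ω ω' : Config n} {t : ℕ} {D : Finset (Fin n)} {l : Fin n} (hl : l ∉ D)
    (hadj : ∀ x y, x ∉ D → y ∉ D → (ω.G.Adj x y ↔ ω'.G.Adj x y))
    (hcue : ∀ x, x ∉ D → x ≠ l → (x ∈ ω.C ↔ x ∈ ω'.C)) :
    ω.hist t D l = ω'.hist t D l := by
  induction t generalizing D l with
  | zero => rfl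
  | succ t ih =>
    have hn : ω.nbrs D l = ω'.nbrs D l := by
      ext k
      rw [mem_nbrs, mem_nbrs]
      exact and_congr_left fun hk => hadj l k hl hk
    rw [hist, hist, hn]
    refine Multiset.map_congr rfl fun k hk => ?_
    rw [Finset.mem_val, mem_nbrs] at hk
    rw [ih (D := insert l D) (l := k) (by simp [hk.2, hk.1.ne'])]
    · simp only [hcue k hk.2 hk.1.ne']
    · intro x y hx hy
      rw [Finset.mem_insert, not_or] at hx hy
      exact hadj x y hx.2 hy.2
    · intro x hx _
      rw [Finset.mem_insert, not_or] at hx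
      exact hcue x hx.2 hx.1

theorem reach_congr {ω ω' : Config n} {t : ℕ} {D : Finset (Fin n)} {l : Fin n} (hl : l ∉ D)
    (hadj : ∀ x y, x ∉ D → y ∉ D → (ω.G.Adj x y ↔ ω'.G.Adj x y)) :
    ω.reach t D l = ω'.reach t D l := by
  induction t generalizing D l with
  | zero => rfl
  | succ t ih =>
    ext v
    rw [mem_reach_succ, mem_reach_succ]
    refine or_congr Iff.rfl (exists_congr fun k => ?_)
    by_cases hkD : k ∈ D
    · simp [hkD]
    · rw [hadj l k hl hkD]
      refine and_congr_right fun hk => and_congr_right fun _ => ?_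
      rw [ih (D := insert l D) (l := k) (by simp [hkD, hk.ne'])]
      intro x y hx hy
      rw [Finset.mem_insert, not_or] at hx hy
      exact hadj x y hx.2 hy.2

theorem treeLike_congr {ω ω' : Config n} {t : ℕ} {D : Finset (Fin n)} {l : Fin n} (hl : l ∉ D)
    (hadj : ∀ x y, x ∉ D → y ∉ D → (ω.G.Adj x y ↔ ω'.G.Adj x y)) :
    ω.TreeLike t D l ↔ ω'.TreeLike t D l := by
  induction t generalizing D l with
  | zero => exact Iff.rfl
  | succ t ih =>
    have hadj' : ∀ x y, x ∉ insert l D → y ∉ insert l D → (ω.G.Adj x y ↔ ω'.G.Adj x y) := by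
      intro x y hx hy
      rw [Finset.mem_insert, not_or] at hx hy
      exact hadj x y hx.2 hy.2
    have hch : ∀ k, k ∉ D → (ω.G.Adj l k ↔ ω'.G.Adj l k) := fun k hk => hadj l k hl hk
    have hni : ∀ k, k ∉ D → ω'.G.Adj l k → k ∉ insert l D := fun k hk h => by simp [hk, h.ne']
    have hr : ∀ k, k ∉ D → ω'.G.Adj l k →
        ω.reach t (insert l D) k = ω'.reach t (insert l D) k :=
      fun k hk h => reach_congr (hni k hk h) hadj'
    rw [TreeLike, TreeLike]
    refine and_congr ?_ ?_
    · refine forall_congr' fun k => forall_congr' fun k' => ?_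
      by_cases hkD : k ∈ D
      · simp [hkD]
      by_cases hkD' : k' ∈ D
      · simp [hkD']
      rw [hch k hkD, hch k' hkD']
      refine imp_congr_right fun hk => imp_congr_right fun _ => imp_congr_right fun hk' =>
        imp_congr_right fun _ => imp_congr_right fun _ => ?_
      rw [hr k hkD hk, hr k' hkD' hk']
      refine forall₂_congr fun x hx => forall₂_congr fun y hy => ?_
      rw [hadj' x y (notMem_of_mem_reach (hni k hkD hk) hx)
        (notMem_of_mem_reach (hni k' hkD' hk') hy)]
    · refine forall_congr' fun k => ?_
      by_cases hkD : k ∈ D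
      · simp [hkD]
      rw [hch k hkD]
      refine imp_congr_right fun hk => imp_congr_right fun _ => ?_
      exact ih (hni k hkD hk) hadj'

/-- The walk leaves `l` only in its first step, where a return to `u` does not count, so the edge
`{l, u}` is never inspected. This makes closing up independent of the very edge on which a message
is conditioned. -/
theorem closes_congr {ω ω' : Config n} {t : ℕ} {D : Finset (Fin n)} {u l : Fin n} (hl : l ∉ D)
    (hu : u ∈ D)
    (hadj : ∀ x y, x ∉ D → ¬(x = l ∧ y = u) → (ω.G.Adj x y ↔ ω'.G.Adj x y)) :
    ω.Closes t D u l ↔ ω'.Closes t D u l := by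
  induction t generalizing D u l with
  | zero => exact Iff.rfl
  | succ t ih =>
    rw [Closes, Closes]
    refine or_congr ?_ (exists_congr fun k => ?_)
    · refine exists_congr fun d => and_congr_right fun hd => and_congr_right fun hdu => ?_
      exact hadj l d hl (fun h => hdu h.2)
    · by_cases hkD : k ∈ D
      · simp [hkD]
      rw [hadj l k hl (fun h => hkD (h.2 ▸ hu))]
      refine and_congr_right fun hk => and_congr_right fun _ => ?_
      refine ih (by simp [hkD, hk.ne']) (by simp) ?_
      intro x y hx hxy
      rw [Finset.mem_insert, not_or] at hx
      exact hadj x y hx.2 (fun h => hx.1 h.1)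

end Config

/-! ### Messages as functions of histories -/

/-- The message computed from a history, with initial value `h₀` and external field `h`. -/
noncomputable def histMessage (ρ h₀ h : ℝ) : (t : ℕ) → Hist t → ℝ
  | 0, _ => h₀
  | t + 1, τ => h + (Multiset.map (fun a : Bool × Hist t =>
      if a.1 then Real.log ρ else f ρ (histMessage ρ h₀ h t a.2)) τ).sum

theorem continuous_f {ρ : ℝ} (hρ : 0 < ρ) : Continuous (f ρ) := by
  unfold f
  refine Continuous.log (by fun_prop (disch := intros; positivity)) fun x => ?_
  positivity

theorem tendsto_multiset_sum_map {ι β : Type*} {l : Filter ι} (τ : Multiset β) {F : ι → β → ℝ}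
    {G : β → ℝ} (h : ∀ a ∈ τ, Tendsto (fun n => F n a) l (𝓝 (G a))) :
    Tendsto (fun n => (τ.map (F n)).sum) l (𝓝 (τ.map G).sum) := by
  induction τ using Multiset.induction with
  | empty => simpa using tendsto_const_nhds
  | cons a τ ih =>
    simp only [Multiset.map_cons, Multiset.sum_cons]
    exact (h a (by simp)).add (ih fun b hb => h b (by simp [hb]))

/-- A fixed history is a finite tree, so continuity of `f` suffices. It is applied to the initial
value and field at size `n`, which tend to their limits. -/
theorem tendsto_histMessage {ρ : ℝ} (hρ : 0 < ρ) {u v : ℕ → ℝ} {h₀ h : ℝ}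
    (hu : Tendsto u atTop (𝓝 h₀)) (hv : Tendsto v atTop (𝓝 h)) (t : ℕ) (τ : Hist t) :
    Tendsto (fun n => histMessage ρ (u n) (v n) t τ) atTop (𝓝 (histMessage ρ h₀ h t τ)) := by
  induction t with
  | zero => exact hu
  | succ t ih =>
    simp only [histMessage]
    refine hv.add (tendsto_multiset_sum_map (β := Bool × Hist t) _ ?_)
    rintro ⟨c, σ⟩ -
    cases c
    · simpa [Function.comp_def] using ((continuous_f hρ).tendsto _).comp (ih σ)
    · simp

/-- As long as no walk closes up, the belief propagation message is a function of the history. -/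
theorem bpPosteriorMessage_eq_histMessage {n K : ℕ} {p q α : ℝ} {ω : Config n} {t : ℕ}
    {D : Finset (Fin n)} {u i : Fin n} (hu : u ∈ D) (h : ¬ω.Closes t D u i) :
    bpPosteriorMessage K p q α t ω i u =
      histMessage (p / q) (-upsilon n K α) (-K * (p - q) - upsilon n K α) t (ω.hist t D i) := by
  classical
  induction t generalizing D u i with
  | zero => simp [bpPosteriorMessage, bpMessage, histMessage]
  | succ t ih =>
    simp only [Config.Closes, not_or, not_exists, not_and] at h
    -- No edge leads from `i` into `D` except possibly to `u`, so the children in the history are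
    -- exactly the neighbours over which the message sums.
    have hn : ω.nbrs D i = Finset.univ.filter fun l => ω.G.Adj i l ∧ l ≠ u := by
      ext k
      simp only [Config.mem_nbrs, Finset.mem_filter, Finset.mem_univ, true_and]
      refine and_congr_right fun hk => ⟨fun hD e => hD (e ▸ hu), fun hne hD => h.1 k hD hne hk⟩
    have hms : (Multiset.map (fun a : Bool × Hist t => if a.1 then Real.log (p / q) else
          f (p / q) (histMessage (p / q) (-upsilon n K α) (-K * (p - q) - upsilon n K α) t a.2))
          (ω.hist (t + 1) D i)).sum
        = ∑ l ∈ ω.nbrs D i, if l ∈ ω.C then Real.log (p / q) else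
            f (p / q) (bpPosteriorMessage K p q α t ω l i) := by
      rw [Config.hist, Multiset.map_map]
      change ∑ l ∈ ω.nbrs D i, _ = _
      refine Finset.sum_congr rfl fun l hl => ?_
      rw [Config.mem_nbrs] at hl
      simp only [Function.comp_apply, decide_eq_true_eq]
      rw [ih (Finset.mem_insert_self i D) (h.2 l hl.1 hl.2)]
    rw [histMessage, hms, hn, Finset.sum_ite, Finset.filter_filter, Finset.filter_filter,
      bpPosteriorMessage, bpMessage]
    have e1 : (Finset.univ.filter fun l => (ω.G.Adj i l ∧ l ≠ u) ∧ l ∈ ω.C)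
        = Finset.univ.filter fun l => ω.G.Adj i l ∧ l ∈ ω.C ∧ l ≠ u := by
      ext l; simp; tauto
    have e2 : (Finset.univ.filter fun l => (ω.G.Adj i l ∧ l ≠ u) ∧ l ∉ ω.C)
        = Finset.univ.filter fun l => ω.G.Adj i l ∧ l ∉ ω.C ∧ l ≠ u := by
      ext l; simp; tauto
    rw [e1, e2]
    simp only [f, bpPosteriorMessage]
    ring

/-! ### Tree-like neighbourhoods with the same history are isomorphic -/

/-- Two families with the same multiset of values are related by a bijection. -/
theorem exists_equiv_of_map_eq {β γ : Type*} {s s' : Finset β} {F F' : β → γ}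
    (h : s.val.map F = s'.val.map F') : ∃ e : s ≃ s', ∀ k, F' (e k) = F k := by
  classical
  have hc : ∀ c, Nonempty ({k : s // F k = c} ≃ {k : s' // F' k = c}) := by
    intro c
    refine Fintype.card_eq.1 ?_
    have := congrArg (Multiset.count c) h
    rw [Multiset.count_map, Multiset.count_map] at this
    have e : ∀ (s : Finset β) (F : β → γ), Fintype.card {k : s // F k = c}
        = (Multiset.filter (fun a => c = F a) s.val).card := by
      intro s F
      rw [Fintype.card_subtype, ← Finset.filter_val, Finset.card_val,
        ← Finset.card_map (Function.Embedding.subtype _)]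
      congr 1
      ext x
      simp [eq_comm, and_comm]
    rw [e, e, this]
  exact ⟨Equiv.ofFiberEquiv (f := fun k : s => F k) (g := fun k : s' => F' k)
    fun c => (hc c).some, fun k => Equiv.ofFiberEquiv_map
    (f := fun k : s => F k) (g := fun k : s' => F' k) (fun c => (hc c).some) k⟩

namespace Config

variable {n : ℕ}

theorem TreeLike.notMem_of_ne {ω : Config n} {t : ℕ} {D : Finset (Fin n)} {l k k' x : Fin n}
    (h : ω.TreeLike (t + 1) D l) (hk : ω.G.Adj l k) (hkD : k ∉ D) (hk' : ω.G.Adj l k')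
    (hkD' : k' ∉ D) (hx : x ∈ ω.reach t (insert l D) k) (hx' : x ∈ ω.reach t (insert l D) k') :
    k = k' := by
  by_contra hne
  exact (h.1 k k' hk hkD hk' hkD' hne x hx x hx').1 rfl

/-- Equal histories match the children of the two roots by a bijection that preserves types, and by
induction matched branches are isomorphic. In a tree-like neighbourhood the branches are disjoint
with no edges between them, so these maps glue. The history omits the cue status of the root, hence
the exclusion of `l` in the last clause. -/
theorem exists_iso {ω ω' : Config n} (t : ℕ) (D D' : Finset (Fin n)) (l l' : Fin n)
    (hT : ω.TreeLike t D l) (hT' : ω'.TreeLike t D' l')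
    (hl : l ∉ D) (hl' : l' ∉ D') (hh : ω.hist t D l = ω'.hist t D' l') :
    ∃ g : Fin n → Fin n, g l = l' ∧ Set.BijOn g (ω.reach t D l) (ω'.reach t D' l') ∧
      (∀ x ∈ ω.reach t D l, ∀ y ∈ ω.reach t D l, ω.G.Adj x y ↔ ω'.G.Adj (g x) (g y)) ∧
      ∀ x ∈ ω.reach t D l, x ≠ l → (x ∈ ω.C ↔ g x ∈ ω'.C) := by
  classical
  induction t generalizing D D' l l' with
  | zero =>
    refine ⟨fun _ => l', rfl, ?_, ?_, ?_⟩
    · simp [reach, Set.BijOn, Set.MapsTo, Set.InjOn, Set.SurjOn]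
    · rintro x rfl y rfl; simp
    · rintro x rfl h; exact absurd rfl h
  | succ t ih =>
    rw [hist, hist] at hh
    obtain ⟨e, he⟩ := exists_equiv_of_map_eq hh
    have hm : ∀ k : ω.nbrs D l, ω.G.Adj l k ∧ (k : Fin n) ∉ D := fun k => mem_nbrs.1 k.2
    have hm' : ∀ k : ω'.nbrs D' l', ω'.G.Adj l' k ∧ (k : Fin n) ∉ D' := fun k => mem_nbrs.1 k.2
    have hni : ∀ k : ω.nbrs D l, (k : Fin n) ∉ insert l D := fun k => by
      simp [(hm k).2, (hm k).1.ne']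
    have hni' : ∀ k : ω'.nbrs D' l', (k : Fin n) ∉ insert l' D' := fun k => by
      simp [(hm' k).2, (hm' k).1.ne']
    choose G hG1 hG2 hG3 hG4 using fun k : ω.nbrs D l =>
      ih (insert l D) (insert l' D') k (e k) (hT.2 k (hm k).1 (hm k).2)
        (hT'.2 (e k) (hm' (e k)).1 (hm' (e k)).2) (hni k) (hni' (e k))
        (Prod.ext_iff.1 (he k)).2.symm
    have hCk : ∀ k : ω.nbrs D l, ((k : Fin n) ∈ ω.C ↔ (e k : Fin n) ∈ ω'.C) := fun k => by
      have := (Prod.ext_iff.1 (he k)).1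
      simpa using this.symm
    have hne : ∀ (k : ω.nbrs D l) x, x ∈ ω.reach t (insert l D) k → x ≠ l := fun k x hx h =>
      notMem_of_mem_reach (hni k) hx (by simp [h])
    have hne' : ∀ (k : ω'.nbrs D' l') x, x ∈ ω'.reach t (insert l' D') k → x ≠ l' :=
      fun k x hx h => notMem_of_mem_reach (hni' k) hx (by simp [h])
    -- By tree-likeness a vertex lies in at most one branch, so the choice of the branch in `g` is
    -- immaterial.
    let P : Fin n → Prop := fun x => ∃ k : ω.nbrs D l, x ∈ ω.reach t (insert l D) k
    let g : Fin n → Fin n := fun x => if x = l then l' else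
      if h : P x then G h.choose x else x
    have hgl : g l = l' := if_pos rfl
    have hg : ∀ (k : ω.nbrs D l) x, x ∈ ω.reach t (insert l D) k → g x = G k x := by
      intro k x hx
      have hP : P x := ⟨k, hx⟩
      have : hP.choose = k := Subtype.ext
        (hT.notMem_of_ne (hm _).1 (hm _).2 (hm _).1 (hm _).2 hP.choose_spec hx)
      simp only [g, if_neg (hne k x hx), dif_pos hP]
      rw [this]
    have hcase : ∀ x ∈ ω.reach (t + 1) D l, x = l ∨ P x := by
      rintro x (rfl | ⟨k, hk, hkD, hx⟩)
      · exact Or.inl rfl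
      · exact Or.inr ⟨⟨k, mem_nbrs.2 ⟨hk, hkD⟩⟩, hx⟩
    have hgm : ∀ (k : ω.nbrs D l) x, x ∈ ω.reach t (insert l D) k →
        g x ∈ ω'.reach t (insert l' D') (e k) := fun k x hx => by
      rw [hg k x hx]; exact (hG2 k).mapsTo hx
    have heq : ∀ (k k' : ω.nbrs D l) z, z ∈ ω'.reach t (insert l' D') (e k) →
        z ∈ ω'.reach t (insert l' D') (e k') → k = k' := fun k k' z hz hz' =>
      e.injective (Subtype.ext
        (hT'.notMem_of_ne (hm' _).1 (hm' _).2 (hm' _).1 (hm' _).2 hz hz'))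
    have hroot : ∀ (k : ω.nbrs D l) x, x ∈ ω.reach t (insert l D) k →
        (ω.G.Adj l x ↔ ω'.G.Adj l' (g x)) := by
      intro k x hx
      have h1 : ω.G.Adj l x ↔ x = k := by
        refine ⟨fun h => ?_, fun h => h ▸ (hm k).1⟩
        have hxD : x ∉ D := fun hD => notMem_of_mem_reach (hni k) hx (by simp [hD])
        exact hT.notMem_of_ne h hxD (hm k).1 (hm k).2 (self_mem_reach _ _ _ _) hx
      have h2 : ω'.G.Adj l' (g x) ↔ g x = e k := by
        refine ⟨fun h => ?_, fun h => h ▸ (hm' _).1⟩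
        have hxD : g x ∉ D' := fun hD => notMem_of_mem_reach (hni' (e k)) (hgm k x hx)
          (by simp [hD])
        exact hT'.notMem_of_ne h hxD (hm' _).1 (hm' _).2 (self_mem_reach _ _ _ _) (hgm k x hx)
      rw [h1, h2, hg k x hx, ← hG1 k]
      exact ((hG2 k).injOn.eq_iff hx (self_mem_reach _ _ _ _)).symm
    refine ⟨g, hgl, ⟨?_, ?_, ?_⟩, ?_, ?_⟩
    · intro x hx
      rcases hcase x hx with rfl | ⟨k, hk⟩
      · rw [hgl]; exact Or.inl rfl
      · exact Or.inr ⟨e k, (hm' _).1, (hm' _).2, hgm k x hk⟩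
    · intro x hx y hy hxy
      rcases hcase x hx with rfl | ⟨k, hk⟩ <;> rcases hcase y hy with rfl | ⟨k', hk'⟩
      · rfl
      · exact absurd (hxy.symm.trans hgl) (hne' _ _ (hgm k' y hk'))
      · exact absurd (hxy.trans hgl) (hne' _ _ (hgm k x hk))
      · obtain rfl := heq k k' (g x) (hgm k x hk) (hxy ▸ hgm k' y hk')
        rw [hg k x hk, hg k y hk'] at hxy
        exact (hG2 k).injOn hk hk' hxy
    · rintro z (rfl | ⟨k', hk', hkD', hz⟩)
      · exact ⟨l, Or.inl rfl, hgl⟩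
      · obtain ⟨k, hk⟩ := e.surjective ⟨k', mem_nbrs.2 ⟨hk', hkD'⟩⟩
        have hz' : z ∈ ω'.reach t (insert l' D') (e k) := by rw [hk]; exact hz
        obtain ⟨x, hx, rfl⟩ := (hG2 k).surjOn hz'
        exact ⟨x, Or.inr ⟨k, (hm k).1, (hm k).2, hx⟩, hg k x hx⟩
    · intro x hx y hy
      rcases hcase x hx with rfl | ⟨k, hk⟩ <;> rcases hcase y hy with rfl | ⟨k', hk'⟩
      · simp
      · rw [hgl]; exact hroot k' y hk'
      · rw [hgl, ω.G.adj_comm, ω'.G.adj_comm]; exact hroot k x hk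
      · by_cases hkk : k = k'
        · subst hkk
          rw [hg k x hk, hg k y hk']
          exact hG3 k x hk y hk'
        · have h1 := (hT.1 k k' (hm k).1 (hm k).2 (hm k').1 (hm k').2
            (fun h => hkk (Subtype.ext h)) x hk y hk').2
          have h2 := (hT'.1 (e k) (e k') (hm' _).1 (hm' _).2 (hm' _).1 (hm' _).2
            (fun h => hkk (e.injective (Subtype.ext h))) _ (hgm k x hk) _ (hgm k' y hk')).2
          exact iff_of_false h1 h2
    · intro x hx hxl
      rcases hcase x hx with rfl | ⟨k, hk⟩
      · exact absurd rfl hxl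
      · rw [hg k x hk]
        by_cases hxk : x = k
        · rw [hxk, hG1]; exact hCk k
        · exact hG4 k x hk hxk

/-! ### Relabelling the vertices -/

/-- The configuration with relabelled vertices. -/
def relabel (g : Equiv.Perm (Fin n)) (ω : Config n) : Config n where
  S := ω.S.map g.toEmbedding
  G := ω.G.comap g.symm
  C := ω.C.map g.toEmbedding

theorem relabel_adj {g : Equiv.Perm (Fin n)} {ω : Config n} {x y : Fin n} :
    (ω.relabel g).G.Adj (g x) (g y) ↔ ω.G.Adj x y := by simp [relabel]

theorem mem_relabel_C {g : Equiv.Perm (Fin n)} {ω : Config n} {x : Fin n} :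
    g x ∈ (ω.relabel g).C ↔ x ∈ ω.C := by simp [relabel]

theorem mem_relabel_S {g : Equiv.Perm (Fin n)} {ω : Config n} {x : Fin n} :
    g x ∈ (ω.relabel g).S ↔ x ∈ ω.S := by simp [relabel]

theorem relabel_symm_relabel (g : Equiv.Perm (Fin n)) (ω : Config n) :
    (ω.relabel g).relabel g.symm = ω := by
  refine Config.ext ?_ ?_ ?_
  · ext x; simp [relabel]
  · ext x y; simp [relabel]
  · ext x; simp [relabel]

theorem relabel_relabel_symm (g : Equiv.Perm (Fin n)) (ω : Config n) :
    (ω.relabel g.symm).relabel g = ω := relabel_symm_relabel g.symm ω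

/-- Relabelling as a bijection. -/
def relabelEquiv (g : Equiv.Perm (Fin n)) : Config n ≃ Config n where
  toFun := relabel g
  invFun := relabel g.symm
  left_inv := relabel_symm_relabel g
  right_inv := relabel_relabel_symm g

theorem view_eq_iff {ω ω' : Config n} {t : ℕ} {i u : Fin n} :
    ω.view t i u = ω'.view t i u ↔ ω.ball t i u = ω'.ball t i u ∧
      (∀ x ∈ ω.ball t i u, ∀ y ∈ ω.ball t i u, ω.G.Adj x y ↔ ω'.G.Adj x y) ∧
      ∀ x ∈ ω.ball t i u, x ∈ ω.C ↔ x ∈ ω'.C := by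
  simp only [view, Prod.mk.injEq]
  refine and_congr_right fun hb => ?_
  rw [← hb]
  refine and_congr ?_ ?_
  · simp only [Set.ext_iff, Set.mem_ofPred_eq, Prod.forall]
    exact ⟨fun h x hx y hy => by simpa [hx, hy] using h x y,
      fun h x y => and_congr_right fun hx => and_congr_right fun hy => h x hx y hy⟩
  · simp only [Set.ext_iff, Set.mem_ofPred_eq]
    exact ⟨fun h x hx => by simpa [hx] using h x, fun h x => and_congr_right fun hx => h x hx⟩

/-- The history and tree-likeness are functions of the view. -/
theorem hist_eq_of_view_eq {ω ω' : Config n} {t : ℕ} {i u : Fin n} (hiu : i ≠ u)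
    (h : ω.view t i u = ω'.view t i u) :
    ω.hist t {u} i = ω'.hist t {u} i ∧ (ω.TreeLike t {u} i ↔ ω'.TreeLike t {u} i) := by
  obtain ⟨hb, ha, hc⟩ := view_eq_iff.1 h
  have := transport (ω := ω) (ω' := ω') (Equiv.refl _) (B := ω.ball t i u) ha hc t {u} i
    (ball_eq_reach hiu).ge (by
      intro y hy
      rw [hb, ball_eq_reach hiu]
      simpa using hy)
  have e : ({u} : Finset (Fin n)).map (Equiv.refl (Fin n)).toEmbedding = {u} := by simp
  rw [e] at this
  exact ⟨this.1, this.2.2⟩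

theorem ball_relabel {g : Equiv.Perm (Fin n)} {ω : Config n} {t : ℕ} {i u : Fin n} (hiu : i ≠ u)
    (hi : g i = i) (hu : g u = u) (x : Fin n) :
    g x ∈ (ω.relabel g).ball t i u ↔ x ∈ ω.ball t i u := by
  have := (transport (ω := ω) (ω' := ω.relabel g) g (B := Set.univ)
    (fun x _ y _ => relabel_adj.symm) (fun x _ => mem_relabel_C.symm) t {u} i
    (Set.subset_univ _) (fun _ _ => Set.mem_univ _)).2.1 x
  rw [ball_eq_reach hiu, ball_eq_reach hiu, this, hi, Finset.map_singleton,
    Equiv.coe_toEmbedding, hu]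

/-- Tree-like neighbourhoods with the same history agree up to a relabelling of the vertices. -/
theorem exists_relabel {ω ω' : Config n} {t : ℕ} {i u : Fin n} (hiu : i ≠ u)
    (hT : ω.TreeLike t {u} i) (hT' : ω'.TreeLike t {u} i)
    (hh : ω.hist t {u} i = ω'.hist t {u} i) (hi : i ∉ ω.C) (hi' : i ∉ ω'.C) :
    ∃ g : Equiv.Perm (Fin n), g i = i ∧ g u = u ∧
      ∀ ω₁ : Config n, (ω₁.relabel g).view t i u = ω'.view t i u ↔
        ω₁.view t i u = ω.view t i u := by
  classical
  have hiu' : i ∉ ({u} : Finset (Fin n)) := by simpa using hiu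
  obtain ⟨g₀, hg0, hbij, hadj, hcue⟩ := exists_iso t {u} {u} i i hT hT' hiu' hiu' hh
  rw [← ball_eq_reach hiu] at hadj hcue hbij
  rw [← ball_eq_reach hiu] at hbij
  have huB : ∀ ω : Config n, u ∉ ω.ball t i u := fun ω h => by
    rw [ball_eq_reach hiu] at h
    exact notMem_of_mem_reach hiu' h (by simp)
  have hiB : ∀ ω : Config n, i ∈ ω.ball t i u := fun ω => by
    rw [ball_eq_reach hiu]; exact self_mem_reach _ _ _ _
  -- Adjoining `u`, sent to itself, before extending to a permutation of all the vertices forces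
  -- that permutation to fix `u`.
  have hbij' : Set.BijOn (Function.update g₀ u u) (insert u (ω.ball t i u))
      (insert u (ω'.ball t i u)) := by
    have h1 : Set.BijOn (Function.update g₀ u u) (ω.ball t i u) (ω'.ball t i u) :=
      hbij.congr fun x hx => by
        rw [Function.update_of_ne]
        rintro rfl
        exact huB _ hx
    have h2 := h1.insert (a := u) (by rw [Function.update_self]; exact huB _)
    rwa [Function.update_self] at h2
  let g : Equiv.Perm (Fin n) := (hbij'.equiv _ : {x // x ∈ insert u (ω.ball t i u)} ≃
    {x // x ∈ insert u (ω'.ball t i u)}).extendSubtype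
  have hgB : ∀ x ∈ ω.ball t i u, g x = g₀ x := by
    intro x hx
    have := Equiv.extendSubtype_apply_of_mem (hbij'.equiv _ : {x // x ∈ insert u (ω.ball t i u)} ≃
      {x // x ∈ insert u (ω'.ball t i u)}) x (Set.mem_insert_of_mem _ hx)
    refine this.trans ?_
    change Function.update g₀ u u x = g₀ x
    rw [Function.update_of_ne]
    rintro rfl
    exact huB _ hx
  have hgu : g u = u := by
    have := Equiv.extendSubtype_apply_of_mem (hbij'.equiv _ : {x // x ∈ insert u (ω.ball t i u)} ≃
      {x // x ∈ insert u (ω'.ball t i u)}) u (Set.mem_insert _ _)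
    refine this.trans ?_
    change Function.update g₀ u u u = u
    rw [Function.update_self]
  have hgi : g i = i := by rw [hgB i (hiB _), hg0]
  have hgmem : ∀ x, g x ∈ ω'.ball t i u ↔ x ∈ ω.ball t i u := by
    intro x
    constructor
    · intro h
      obtain ⟨y, hy, hyx⟩ := hbij.surjOn h
      rw [← hgB y hy] at hyx
      rwa [← g.injective hyx]
    · intro h
      rw [hgB x h]
      exact hbij.mapsTo h
  refine ⟨g, hgi, hgu, fun ω₁ => ?_⟩
  rw [view_eq_iff, view_eq_iff]
  have hball : (ω₁.relabel g).ball t i u = ω'.ball t i u ↔ ω₁.ball t i u = ω.ball t i u := by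
    rw [Set.ext_iff, Set.ext_iff, ← g.forall_congr_right]
    exact forall_congr' fun x => by rw [ball_relabel hiu hgi hgu, hgmem]
  rw [hball]
  refine and_congr_right fun hb => ?_
  have hfor : ∀ Q : Fin n → Prop, (∀ x ∈ (ω₁.relabel g).ball t i u, Q x) ↔
      ∀ x ∈ ω₁.ball t i u, Q (g x) := fun Q => by
    rw [← g.forall_congr_right]
    exact forall_congr' fun x => by rw [ball_relabel hiu hgi hgu]
  simp only [hfor]
  refine and_congr ?_ ?_
  · refine forall₂_congr fun x hx => ?_
    refine forall₂_congr fun y hy => ?_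
    rw [hb] at hx hy
    rw [relabel_adj, hadj x hx y hy, hgB x hx, hgB y hy]
  · refine forall₂_congr fun x hx => ?_
    rw [hb] at hx
    rw [mem_relabel_C]
    by_cases hxi : x = i
    · subst hxi
      rw [hgi]
      simp [hi, hi']
    · rw [hcue x hx hxi, hgB x hx]

end Config

/-! ### Compound Poisson multisets -/

section CompoundPoisson

set_option linter.unusedSectionVars false

instance (T : Type*) : MeasurableSpace (Multiset T) := ⊤

instance (T : Type*) : DiscreteMeasurableSpace (Multiset T) := ⟨fun _ => trivial⟩

variable {T : Type*} [Countable T] [MeasurableSpace T] [DiscreteMeasurableSpace T]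

/-- The image of `ν ^ m` under the map that sends a sequence of length `m` to the multiset of
its terms. -/
noncomputable def multisetPow (ν : Measure T) : ℕ → Measure (Multiset T)
  | 0 => Measure.dirac 0
  | m + 1 => (ν.prod (multisetPow ν m)).map fun x => x.1 ::ₘ x.2

variable (ν : Measure T) [IsFiniteMeasure ν]

theorem multisetPow_univ (m : ℕ) : multisetPow ν m Set.univ = ν Set.univ ^ m := by
  induction m with
  | zero => simp [multisetPow]
  | succ m ih =>
    rw [multisetPow, Measure.map_apply .of_discrete .univ, Set.preimage_univ,
      ← Set.univ_prod_univ, Measure.prod_prod, ih, pow_succ']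

theorem multisetPow_succ_singleton [DecidableEq T] (m : ℕ) (σ : Multiset T) :
    multisetPow ν (m + 1) {σ}
      = ∑' b, ν {b} * (if b ∈ σ then multisetPow ν m {σ.erase b} else 0) := by
  rw [multisetPow, Measure.map_apply .of_discrete (.of_discrete),
    Measure.prod_apply (.of_discrete), lintegral_countable']
  refine tsum_congr fun b => ?_
  rw [mul_comm]
  congr 1
  split_ifs with hb
  · congr 1
    ext τ
    simp only [Set.mem_preimage, Set.mem_singleton_iff]
    constructor
    · rintro rfl; simp
    · rintro rfl; exact Multiset.cons_erase hb
  · convert measure_empty (μ := multisetPow ν m)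
    ext τ
    simp only [Set.mem_preimage, Set.mem_singleton_iff, Set.mem_empty_iff_false, iff_false]
    rintro rfl
    simp at hb

theorem multisetPow_zero_of_ne {σ : Multiset T} (hσ : σ ≠ 0) : multisetPow ν 0 {σ} = 0 := by
  rw [multisetPow, Measure.dirac_apply' _ (.of_discrete)]
  simp [hσ.symm]

/-- Both sides weigh the sequences of length `m + 1` with underlying multiset `a ::ₘ τ` and one
marked occurrence of `a`: each sequence has `count + 1` such occurrences, and the mark has `m + 1`
possible positions. This is the Mecke formula before the number of points is made Poisson. -/
theorem count_mul_multisetPow [DecidableEq T] (m : ℕ) (a : T) (τ : Multiset T) :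
    ((τ.count a + 1 : ℕ) : ℝ≥0∞) * multisetPow ν (m + 1) {a ::ₘ τ}
      = ((m + 1 : ℕ) : ℝ≥0∞) * ν {a} * multisetPow ν m {τ} := by
  induction m generalizing τ with
  | zero =>
    rw [multisetPow_succ_singleton, tsum_eq_single a]
    · rcases eq_or_ne τ 0 with rfl | hτ
      · simp
      · simp [multisetPow_zero_of_ne ν hτ]
    · intro b hb
      split_ifs with h
      · rw [multisetPow_zero_of_ne, mul_zero]
        rw [Multiset.erase_cons_tail _ hb.symm]
        simp
      · simp
  | succ m ih =>
    -- Here `b` is the first point. The additional term is the case where the marked occurrence of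
    -- `a` comes first; otherwise the mark lies among the remaining points and the induction
    -- hypothesis applies.
    have key : ∀ b, ((τ.count a + 1 : ℕ) : ℝ≥0∞) *
        (if b ∈ a ::ₘ τ then multisetPow ν (m + 1) {(a ::ₘ τ).erase b} else 0)
        = (if b = a then multisetPow ν (m + 1) {τ} else 0)
          + ((m + 1 : ℕ) : ℝ≥0∞) * ν {a} * (if b ∈ τ then multisetPow ν m {τ.erase b} else 0) := by
      intro b
      by_cases hba : b = a
      · subst hba
        simp only [Multiset.mem_cons_self, if_true, Multiset.erase_cons_head]
        split_ifs with hb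
        · obtain ⟨τ', rfl⟩ := Multiset.exists_cons_of_mem hb
          rw [Multiset.count_cons_self, Multiset.erase_cons_head, ← ih τ']
          push_cast
          ring
        · rw [Multiset.count_eq_zero_of_notMem hb]
          simp
      · rw [if_neg hba, zero_add]
        by_cases hb : b ∈ τ
        · obtain ⟨τ', rfl⟩ := Multiset.exists_cons_of_mem hb
          rw [if_pos (by simp), if_pos hb, Multiset.erase_cons_head,
            Multiset.erase_cons_tail _ (Ne.symm hba), Multiset.erase_cons_head,
            Multiset.count_cons_of_ne (Ne.symm hba), ih τ']
        · rw [if_neg (by simp [hba, hb]), if_neg hb]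
          simp
    rw [multisetPow_succ_singleton, ← ENNReal.tsum_mul_left]
    have : ∀ b, ((τ.count a + 1 : ℕ) : ℝ≥0∞) * (ν {b} *
        (if b ∈ a ::ₘ τ then multisetPow ν (m + 1) {(a ::ₘ τ).erase b} else 0))
        = (if b = a then ν {a} * multisetPow ν (m + 1) {τ} else 0)
          + ((m + 1 : ℕ) : ℝ≥0∞) * ν {a} *
            (ν {b} * (if b ∈ τ then multisetPow ν m {τ.erase b} else 0)) := by
      intro b
      rw [mul_left_comm, key b, mul_add, mul_left_comm]
      congr 1
      split_ifs with h
      · rw [h]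
      · simp
    simp_rw [this]
    rw [ENNReal.tsum_add, tsum_ite_eq, ENNReal.tsum_mul_left, ← multisetPow_succ_singleton]
    push_cast
    ring

theorem norm_multiset_prod_map_le {z : T → ℂ} (hz : ∀ a, ‖z a‖ ≤ 1) (τ : Multiset T) :
    ‖(τ.map z).prod‖ ≤ 1 := by
  induction τ using Multiset.induction with
  | empty => simp
  | cons a τ ih =>
    rw [Multiset.map_cons, Multiset.prod_cons, norm_mul]
    exact mul_le_one₀ (hz a) (norm_nonneg _) ih

theorem integral_multisetPow {z : T → ℂ} (m : ℕ) :
    ∫ τ, (τ.map z).prod ∂multisetPow ν m = (∫ a, z a ∂ν) ^ m := by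
  induction m with
  | zero => simp [multisetPow]
  | succ m ih =>
    rw [multisetPow, integral_map (Measurable.of_discrete).aemeasurable
      (StronglyMeasurable.of_discrete).aestronglyMeasurable]
    simp only [Multiset.map_cons, Multiset.prod_cons]
    rw [integral_prod_mul (fun a => z a) (fun τ : Multiset T => (τ.map z).prod), ih, pow_succ']

/-- The law of the points of a Poisson process with intensity `ν`. -/
noncomputable def compoundPoisson (ν : Measure T) : Measure (Multiset T) :=
  Measure.sum fun m : ℕ =>
    ENNReal.ofReal (Real.exp (-ν.real Set.univ) / m.factorial) • multisetPow ν m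

theorem compoundPoisson_apply (s : Set (Multiset T)) :
    compoundPoisson ν s = ∑' m : ℕ,
      ENNReal.ofReal (Real.exp (-ν.real Set.univ) / m.factorial) * multisetPow ν m s := by
  simp [compoundPoisson, Measure.sum_apply _ (.of_discrete)]

instance : IsProbabilityMeasure (compoundPoisson ν) := by
  refine ⟨?_⟩
  rw [compoundPoisson_apply]
  have h : ∀ m : ℕ, ENNReal.ofReal (Real.exp (-ν.real Set.univ) / m.factorial) *
      multisetPow ν m Set.univ = ENNReal.ofReal (Real.exp (-ν.real Set.univ) *
        (ν.real Set.univ ^ m / m.factorial)) := by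
    intro m
    rw [multisetPow_univ, ← ENNReal.ofReal_toReal (measure_ne_top ν Set.univ), ← measureReal_def,
      ← ENNReal.ofReal_pow measureReal_nonneg, ← ENNReal.ofReal_mul (by positivity)]
    congr 1
    ring
  simp_rw [h]
  have hs := (NormedSpace.expSeries_div_hasSum_exp (ν.real Set.univ)).mul_left
    (Real.exp (-ν.real Set.univ))
  rw [← Real.exp_eq_exp_ℝ, ← Real.exp_add, neg_add_cancel, Real.exp_zero] at hs
  rw [← ENNReal.ofReal_tsum_of_nonneg (fun m => by positivity) hs.summable, hs.tsum_eq,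
    ENNReal.ofReal_one]

/-- The Mecke formula. -/
theorem count_mul_compoundPoisson [DecidableEq T] (a : T) (τ : Multiset T) :
    ((τ.count a : ℝ) + 1) * (compoundPoisson ν).real {a ::ₘ τ}
      = ν.real {a} * (compoundPoisson ν).real {τ} := by
  have h : ((τ.count a + 1 : ℕ) : ℝ≥0∞) * compoundPoisson ν {a ::ₘ τ}
      = ν {a} * compoundPoisson ν {τ} := by
    -- The empty sequence cannot produce `a ::ₘ τ`. After the shift of index, the factor `m + 1` is
    -- absorbed by the factorial.
    rw [compoundPoisson_apply, compoundPoisson_apply, tsum_eq_zero_add' ENNReal.summable,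
      multisetPow_zero_of_ne ν (by simp), mul_zero, zero_add, ← ENNReal.tsum_mul_left,
      ← ENNReal.tsum_mul_left]
    refine tsum_congr fun m => ?_
    have hfac : ENNReal.ofReal (Real.exp (-ν.real Set.univ) / (m + 1).factorial) *
        ((m + 1 : ℕ) : ℝ≥0∞) = ENNReal.ofReal (Real.exp (-ν.real Set.univ) / m.factorial) := by
      rw [← ENNReal.ofReal_natCast, ← ENNReal.ofReal_mul (by positivity)]
      congr 1
      rw [Nat.factorial_succ]
      push_cast
      field_simp
    rw [mul_left_comm, count_mul_multisetPow, ← hfac]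
    ring
  have := congrArg ENNReal.toReal h
  rw [ENNReal.toReal_mul, ENNReal.toReal_mul, ENNReal.toReal_natCast] at this
  push_cast at this
  exact this

theorem compoundPoisson_zero :
    (compoundPoisson ν).real {0} = Real.exp (-ν.real Set.univ) := by
  rw [measureReal_def, compoundPoisson_apply, tsum_eq_single 0]
  · simp [multisetPow, Real.exp_nonneg]
  · intro m hm
    obtain ⟨m, rfl⟩ := Nat.exists_eq_succ_of_ne_zero hm
    classical
    rw [multisetPow_succ_singleton]
    simp

/-- The generating functional. -/
theorem integral_compoundPoisson {z : T → ℂ} (hz : ∀ a, ‖z a‖ ≤ 1) :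
    ∫ τ, (τ.map z).prod ∂compoundPoisson ν
      = Complex.exp (-ν.real Set.univ + ∫ a, z a ∂ν) := by
  have hint : Integrable (fun τ : Multiset T => (τ.map z).prod) (compoundPoisson ν) :=
    Integrable.of_bound (StronglyMeasurable.of_discrete).aestronglyMeasurable 1
      (Eventually.of_forall fun τ => norm_multiset_prod_map_le hz τ)
  have h := hasSum_integral_measure (μ := fun m : ℕ =>
    ENNReal.ofReal (Real.exp (-ν.real Set.univ) / m.factorial) • multisetPow ν m) hint
  have hs := (NormedSpace.expSeries_div_hasSum_exp (∫ a, z a ∂ν)).mul_left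
    (Complex.exp (-ν.real Set.univ))
  rw [← Complex.exp_eq_exp_ℂ, ← Complex.exp_add] at hs
  refine h.unique ?_
  have e : (fun m : ℕ => ∫ τ : Multiset T, (τ.map z).prod ∂(ENNReal.ofReal
      (Real.exp (-ν.real Set.univ) / m.factorial) • multisetPow ν m))
      = fun m : ℕ => Complex.exp (-ν.real Set.univ) * ((∫ a, z a ∂ν) ^ m / m.factorial) := by
    funext m
    rw [integral_smul_measure, integral_multisetPow, ENNReal.toReal_ofReal (by positivity),
      Complex.real_smul]
    push_cast
    ring
  rw [e]
  exact hs

end CompoundPoisson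

/-! ### The limiting laws -/

/-- The constants of the model. -/
structure Params where
  a : ℝ
  b : ℝ
  κ : ℝ
  α : ℝ
  a_pos : 0 < a
  b_pos : 0 < b
  κ_pos : 0 < κ
  κ_lt_one : κ < 1
  α_pos : 0 < α
  α_lt_one : α < 1

namespace Params

variable (P : Params)

/-- The limiting proportion of the vertices with label `y`. -/
noncomputable def kap (y : Fin 2) : ℝ := if y = 1 then P.κ else 1 - P.κ

/-- `n` times the edge probability between vertices with labels `x` and `y`. -/
noncomputable def deg (x y : Fin 2) : ℝ := if x = 1 ∧ y = 1 then P.a else P.b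

/-- The probability that a vertex with label `y` has cue status `c`. -/
noncomputable def cueProb (y : Fin 2) (c : Bool) : ℝ :=
  let r := if y = 1 then P.α else 0
  if c then r else 1 - r

theorem kap_pos (y : Fin 2) : 0 < P.kap y := by
  unfold kap; split_ifs; exacts [P.κ_pos, by linarith [P.κ_lt_one]]

theorem deg_pos (x y : Fin 2) : 0 < P.deg x y := by
  unfold deg; split_ifs; exacts [P.a_pos, P.b_pos]

theorem cueProb_nonneg (y : Fin 2) (c : Bool) : 0 ≤ P.cueProb y c := by
  have := P.α_pos; have := P.α_lt_one
  unfold cueProb; dsimp only; split_ifs <;> linarith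

theorem cueProb_le_one (y : Fin 2) (c : Bool) : P.cueProb y c ≤ 1 := by
  have := P.α_pos; have := P.α_lt_one
  unfold cueProb; dsimp only; split_ifs <;> linarith

/-- The law of the cue status of a vertex with label `y`. -/
noncomputable def cueLaw (y : Fin 2) : Measure Bool :=
  ENNReal.ofReal (P.cueProb y true) • Measure.dirac true +
    ENNReal.ofReal (P.cueProb y false) • Measure.dirac false

theorem cueLaw_real_singleton (y : Fin 2) (c : Bool) :
    (P.cueLaw y).real {c} = P.cueProb y c := by
  rw [cueLaw, measureReal_def]
  cases c <;> simp [P.cueProb_nonneg]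

instance (y : Fin 2) : IsProbabilityMeasure (P.cueLaw y) := by
  refine ⟨?_⟩
  simp only [cueLaw, Measure.coe_add, Measure.coe_smul, Pi.add_apply, Pi.smul_apply, measure_univ,
    smul_eq_mul, mul_one]
  rw [← ENNReal.ofReal_add (P.cueProb_nonneg _ _) (P.cueProb_nonneg _ _), ← ENNReal.ofReal_one]
  congr 1
  simp [cueProb]

/-- The intensity of the offspring of a vertex with label `x`. -/
noncomputable def offspring {t : ℕ} (μ : Fin 2 → Measure (Hist t)) (x : Fin 2) :
    Measure (Bool × Hist t) :=
  ∑ y, ENNReal.ofReal (P.kap y * P.deg x y) • (P.cueLaw y).prod (μ y)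

/-- The limiting law of the history of a vertex with label `x`. -/
noncomputable def limitLaw : (t : ℕ) → Fin 2 → Measure (Hist t)
  | 0, _ => Measure.dirac ()
  | t + 1, x => compoundPoisson (P.offspring (limitLaw t) x)

instance {t : ℕ} (μ : Fin 2 → Measure (Hist t)) [∀ y, IsFiniteMeasure (μ y)] (x : Fin 2) :
    IsFiniteMeasure (P.offspring μ x) := by
  rw [offspring, Fin.sum_univ_two]
  have : ∀ y, IsFiniteMeasure (ENNReal.ofReal (P.kap y * P.deg x y) •
      (P.cueLaw y).prod (μ y)) := fun y => Measure.smul_finite _ ENNReal.ofReal_ne_top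
  infer_instance

instance (t : ℕ) (x : Fin 2) : IsProbabilityMeasure (P.limitLaw t x) := by
  induction t generalizing x with
  | zero => exact Measure.dirac.isProbabilityMeasure
  | succ t ih =>
    rw [limitLaw]
    exact inferInstanceAs (IsProbabilityMeasure (compoundPoisson (T := Bool × Hist t) _))

/-- The probability mass function of the limiting law. -/
noncomputable def pmf (t : ℕ) (x : Fin 2) (τ : Hist t) : ℝ := (P.limitLaw t x).real {τ}

/-- The limiting mean degree. -/
noncomputable def lam (x : Fin 2) : ℝ := ∑ y, P.kap y * P.deg x y

/-- The limiting mean number of children of type `(c, σ)`. -/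
noncomputable def rate (t : ℕ) (x : Fin 2) (e : Bool × Hist t) : ℝ :=
  ∑ y, P.kap y * P.deg x y * (P.cueProb y e.1 * P.pmf t y e.2)

theorem pmf_nonneg (t : ℕ) (x : Fin 2) (τ : Hist t) : 0 ≤ P.pmf t x τ := measureReal_nonneg

theorem pmf_le_one (t : ℕ) (x : Fin 2) (τ : Hist t) : P.pmf t x τ ≤ 1 := measureReal_le_one

theorem pmf_zero (x : Fin 2) (τ : Hist 0) : P.pmf 0 x τ = 1 := by
  have : ({τ} : Set (Hist 0)) = Set.univ := Set.eq_univ_of_forall fun y => (rfl : y = τ)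
  rw [pmf, this, probReal_univ]

theorem offspring_real_univ (t : ℕ) (x : Fin 2) :
    (P.offspring (P.limitLaw t) x).real Set.univ = P.lam x := by
  have h : ∀ y, 0 ≤ P.kap y * P.deg x y := fun y => (mul_pos (P.kap_pos y) (P.deg_pos x y)).le
  rw [offspring, lam, Fin.sum_univ_two, Fin.sum_univ_two, measureReal_def, Measure.add_apply,
    Measure.smul_apply, Measure.smul_apply, measure_univ, measure_univ, smul_eq_mul, mul_one,
    smul_eq_mul, mul_one, ENNReal.toReal_add ENNReal.ofReal_ne_top ENNReal.ofReal_ne_top,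
    ENNReal.toReal_ofReal (h 0), ENNReal.toReal_ofReal (h 1)]

theorem offspring_real_singleton (t : ℕ) (x : Fin 2) (e : Bool × Hist t) :
    (P.offspring (P.limitLaw t) x).real {e} = P.rate t x e := by
  have h : ∀ y, 0 ≤ P.kap y * P.deg x y := fun y => (mul_pos (P.kap_pos y) (P.deg_pos x y)).le
  obtain ⟨c, σ⟩ := e
  have h2 : ∀ y, (ENNReal.ofReal (P.kap y * P.deg x y) *
      ((P.cueLaw y).prod (P.limitLaw t y)) {(c, σ)}).toReal
      = P.kap y * P.deg x y * (P.cueProb y c * P.pmf t y σ) := by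
    intro y
    rw [← Set.singleton_prod_singleton, Measure.prod_prod, ENNReal.toReal_mul, ENNReal.toReal_mul,
      ENNReal.toReal_ofReal (h y), ← measureReal_def, cueLaw_real_singleton, pmf, measureReal_def]
  rw [offspring, rate, Fin.sum_univ_two, Fin.sum_univ_two, measureReal_def, Measure.add_apply,
    Measure.smul_apply, Measure.smul_apply, smul_eq_mul, smul_eq_mul,
    ENNReal.toReal_add (ENNReal.mul_ne_top ENNReal.ofReal_ne_top (measure_ne_top _ _))
      (ENNReal.mul_ne_top ENNReal.ofReal_ne_top (measure_ne_top _ _)), h2, h2]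

theorem pmf_succ_zero (t : ℕ) (x : Fin 2) :
    P.pmf (t + 1) x (0 : Multiset (Bool × Hist t)) = Real.exp (-P.lam x) := by
  rw [← P.offspring_real_univ t x]
  exact compoundPoisson_zero _

theorem count_mul_pmf (t : ℕ) (x : Fin 2) (e : Bool × Hist t) (τ : Multiset (Bool × Hist t)) :
    ((τ.count e : ℝ) + 1) * P.pmf (t + 1) x (e ::ₘ τ) = P.rate t x e * P.pmf (t + 1) x τ := by
  rw [← P.offspring_real_singleton t x e]
  exact count_mul_compoundPoisson (P.offspring (P.limitLaw t) x) e τ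

/-- By the Mecke formula a history can be built from the empty one by adding children, each of
positive rate. Positivity for both labels is what makes the limiting likelihood ratio meaningful at
every single history. -/
theorem pmf_pos (t : ℕ) (x : Fin 2) (τ : Hist t) : 0 < P.pmf t x τ := by
  induction t generalizing x with
  | zero =>
    rw [pmf_zero]; exact one_pos
  | succ t ih =>
    have hr : ∀ e : Bool × Hist t, 0 < P.rate t x e := by
      rintro ⟨c, σ⟩
      have h : ∀ y, 0 ≤ P.kap y * P.deg x y * (P.cueProb y c * P.pmf t y σ) := fun y =>
        mul_nonneg (mul_pos (P.kap_pos y) (P.deg_pos x y)).le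
          (mul_nonneg (P.cueProb_nonneg _ _) (P.pmf_nonneg _ _ _))
      -- The summand of label `1` is kept because both cue statuses are possible there; with label
      -- `0` a cue has probability zero.
      refine lt_of_lt_of_le ?_ (Finset.single_le_sum (fun y _ => h y) (Finset.mem_univ 1))
      refine mul_pos (mul_pos (P.kap_pos _) (P.deg_pos _ _)) (mul_pos ?_ (ih _ _))
      have := P.α_pos; have := P.α_lt_one
      simp only [cueProb]
      split_ifs <;> simp_all
    have key : ∀ τ : Multiset (Bool × Hist t), 0 < P.pmf (t + 1) x τ := by
      intro τ
      induction τ using Multiset.induction with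
      | empty => exact (P.pmf_succ_zero t x).symm ▸ Real.exp_pos _
      | cons e τ ihτ =>
        have := P.count_mul_pmf t x e τ
        have h2 := mul_pos (hr e) ihτ
        rw [← this] at h2
        exact pos_of_mul_pos_right h2 (by positivity)
    exact key τ

theorem lam_sub : P.lam 1 - P.lam 0 = P.κ * (P.a - P.b) := by
  simp [lam, Fin.sum_univ_two, kap, deg]
  ring

/-- The initial value of the limiting messages. -/
noncomputable def init : ℝ := Real.log (P.κ * (1 - P.α) / (1 - P.κ))

/-- The external field of the limiting recursion. -/
noncomputable def field : ℝ :=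
  -P.κ * (P.a - P.b) - Real.log ((1 - P.κ) / (P.κ * (1 - P.α)))

/-- The limiting message of a history. -/
noncomputable def message (t : ℕ) (τ : Hist t) : ℝ :=
  histMessage (P.a / P.b) P.init P.field t τ

/-- The probabilities `exp (-lam x)` of having no children contribute `-(lam 1 - lam 0)` to the
log-likelihood ratio, and the prior odds contribute `init`. -/
theorem field_eq : P.field = -(P.lam 1 - P.lam 0) + P.init := by
  rw [lam_sub, field, init, ← inv_div (1 - P.κ), Real.log_inv]
  ring

/-- The limiting message is the posterior log-likelihood ratio of the limiting model. -/
theorem log_likelihood_eq_message (t : ℕ) (τ : Hist t) :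
    Real.log (P.κ * (1 - P.α) * P.pmf t 1 τ / ((1 - P.κ) * P.pmf t 0 τ)) = P.message t τ := by
  have hκ := P.κ_pos; have hκ' := P.κ_lt_one; have hα := P.α_pos; have hα' := P.α_lt_one
  have ha := P.a_pos; have hb := P.b_pos
  have hκ1 : 0 < 1 - P.κ := by linarith
  have hα1 : 0 < 1 - P.α := by linarith
  have hsplit : ∀ (t : ℕ) (τ : Hist t),
      Real.log (P.κ * (1 - P.α) * P.pmf t 1 τ / ((1 - P.κ) * P.pmf t 0 τ))
      = P.init + Real.log (P.pmf t 1 τ / P.pmf t 0 τ) := by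
    intro t τ
    have h1 := P.pmf_pos t 1 τ
    have h0 := P.pmf_pos t 0 τ
    rw [init, ← Real.log_mul (by positivity) (by positivity)]
    congr 1
    field_simp
  induction t with
  | zero =>
    rw [hsplit]
    simp [pmf_zero, message, histMessage]
  | succ t ih =>
    rw [hsplit]
    -- For an uncued child, the ratio averages `a` and `b` according to the posterior odds `exp
    -- (message)` of the child, which is the shape of `f`. A cued child has label `1` for certain
    -- and leaves `a / b`.
    have hrate : ∀ e : Bool × Hist t, Real.log (P.rate t 1 e / P.rate t 0 e)
        = if e.1 then Real.log (P.a / P.b) else f (P.a / P.b) (P.message t e.2) := by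
      rintro ⟨c, σ⟩
      have h1 := P.pmf_pos t 1 σ
      have h0 := P.pmf_pos t 0 σ
      cases c
      · simp only [Bool.false_eq_true, if_false]
        rw [f, ← ih σ, Real.exp_log (by positivity)]
        congr 1
        simp [rate, Fin.sum_univ_two, kap, deg, cueProb]
        field_simp
        ring
      · simp only [if_true]
        congr 1
        simp [rate, kap, deg, cueProb]
        field_simp
    have hr : ∀ x (e : Bool × Hist t), 0 < P.rate t x e := by
      intro x e
      have h2 := P.count_mul_pmf t x e 0
      have h3 : 0 < P.pmf (t + 1) x (0 : Multiset (Bool × Hist t)) := P.pmf_pos _ _ _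
      have h4 : 0 < P.pmf (t + 1) x (e ::ₘ (0 : Multiset (Bool × Hist t))) := P.pmf_pos _ _ _
      have h5 : 0 < P.rate t x e * P.pmf (t + 1) x (0 : Multiset (Bool × Hist t)) := by
        rw [← h2]; positivity
      exact pos_of_mul_pos_left h5 h3.le
    -- Adding a child multiplies the mass under either label by its rate divided by the same `count
    -- + 1`, which cancels in the ratio.
    have key : ∀ τ : Multiset (Bool × Hist t), Real.log (P.pmf (t + 1) 1 τ / P.pmf (t + 1) 0 τ)
        = -(P.lam 1 - P.lam 0) + (τ.map fun e : Bool × Hist t =>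
          if e.1 then Real.log (P.a / P.b) else f (P.a / P.b) (P.message t e.2)).sum := by
      intro τ
      induction τ using Multiset.induction with
      | empty =>
        have h : ∀ x, P.pmf (t + 1) x (0 : Multiset (Bool × Hist t)) = Real.exp (-P.lam x) :=
          P.pmf_succ_zero t
        rw [h 1, h 0, ← Real.exp_sub, Real.log_exp]
        simp
        ring
      | cons e τ ihτ =>
        have h1 := P.count_mul_pmf t 1 e τ
        have h0 := P.count_mul_pmf t 0 e τ
        have p1 : 0 < P.pmf (t + 1) 1 τ := P.pmf_pos _ _ _
        have p0 : 0 < P.pmf (t + 1) 0 τ := P.pmf_pos _ _ _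
        have hc : (0 : ℝ) < (τ.count e : ℝ) + 1 := by positivity
        rw [← mul_div_mul_left _ _ hc.ne', h1, h0, mul_div_mul_comm,
          Real.log_mul (div_pos (hr 1 e) (hr 0 e)).ne' (div_pos p1 p0).ne', ihτ, hrate e,
          Multiset.map_cons, Multiset.sum_cons]
        ring
    have hm : P.message (t + 1) τ = P.field + (Multiset.map (fun e : Bool × Hist t =>
          if e.1 then Real.log (P.a / P.b) else f (P.a / P.b) (P.message t e.2)) τ).sum := rfl
    rw [hm, field_eq, key τ]
    ring

/-- All but an arbitrarily small part of the mass is carried by a finite set. -/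
theorem exists_finset_pmf (t : ℕ) (x : Fin 2) {ε : ℝ} (hε : 0 < ε) :
    ∃ A : Finset (Hist t), 1 - ε < ∑ τ ∈ A, P.pmf t x τ := by
  have hs : HasSum (fun τ => P.pmf t x τ) 1 := by
    have h := hasSum_integral_iUnion (μ := P.limitLaw t x) (f := fun _ => (1 : ℝ))
      (s := fun τ : Hist t => {τ}) (fun _ => .of_discrete)
      (fun a b hab => by simpa using hab) (by simp)
    simpa [pmf, Set.iUnion_of_singleton, measureReal_def] using h
  exact ((tendsto_order.1 hs).1 _ (by linarith)).exists

end Params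

/-! ### The recursion of the limiting laws -/

theorem integral_pow_poissonMeasure (r : ℝ≥0) {w : ℂ} (hw : ‖w‖ ≤ 1) :
    ∫ m, w ^ m ∂poissonMeasure r = Complex.exp (r * (w - 1)) := by
  have hint : Integrable (fun m : ℕ => w ^ m) (poissonMeasure r) :=
    Integrable.of_bound (StronglyMeasurable.of_discrete).aestronglyMeasurable 1
      (Eventually.of_forall fun m => by
        rw [norm_pow]; exact pow_le_one₀ (norm_nonneg _) hw)
  have h := hasSum_integral_poissonMeasure hint
  have hs := (NormedSpace.expSeries_div_hasSum_exp (r * w)).mul_left (Complex.exp (-r))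
  rw [← Complex.exp_eq_exp_ℂ, ← Complex.exp_add, show -(r : ℂ) + r * w = r * (w - 1) by ring] at hs
  refine h.unique ?_
  have e : (fun m : ℕ => (Real.exp (-r) * r ^ m / m.factorial) • w ^ m)
      = fun m : ℕ => Complex.exp (-r) * ((r * w) ^ m / m.factorial) := by
    funext m
    rw [Complex.real_smul, mul_pow]
    push_cast
    ring
  rw [e]
  exact hs

theorem integral_prod_infinitePi (μ : ProbabilityMeasure ℝ) {z : ℝ → ℂ} (hz : Measurable z)
    (m : ℕ) :
    ∫ ξ, ∏ i ∈ Finset.range m, z (ξ i) ∂(Measure.infinitePi fun _ : ℕ => (μ : Measure ℝ))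
      = (∫ y, z y ∂(μ : Measure ℝ)) ^ m := by
  have h := Measure.infinitePi_map_restrict (fun _ : ℕ => (μ : Measure ℝ)) (I := Finset.range m)
  have h2 := integral_fintype_prod_eq_prod (fun (_ : Finset.range m) (y : ℝ) => z y)
    (μ := fun _ => (μ : Measure ℝ))
  rw [← h, integral_map (by fun_prop) (Measurable.aestronglyMeasurable (by fun_prop))] at h2
  simp only [Finset.restrict, Finset.prod_const, Finset.card_univ, Fintype.card_coe,
    Finset.card_range] at h2
  rw [← h2]
  refine integral_congr_ae (Eventually.of_forall fun ξ => ?_)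
  exact (Finset.prod_coe_sort (Finset.range m) (fun i => z (ξ i))).symm

theorem measurable_prod_range {z : ℝ → ℂ} (hz : Measurable z) :
    Measurable fun x : ℕ × (ℕ → ℝ) => ∏ i ∈ Finset.range x.1, z (x.2 i) := by
  refine measurable_from_prod_countable_right fun m => ?_
  dsimp only
  fun_prop

theorem measurable_sum_range {g : ℝ → ℝ} (hg : Measurable g) :
    Measurable fun x : ℕ × (ℕ → ℝ) => ∑ i ∈ Finset.range x.1, g (x.2 i) := by
  refine measurable_from_prod_countable_right fun m => ?_
  dsimp only
  fun_prop

theorem measurable_poissonSum (h : ℝ) {ρ : ℝ} (hρ : 0 < ρ) :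
    Measurable fun x : ℕ × ℕ × ℕ × (ℕ → ℝ) × (ℕ → ℝ) =>
      h + ∑ _i ∈ Finset.range x.1, Real.log ρ + ∑ i ∈ Finset.range x.2.1, f ρ (x.2.2.2.1 i)
        + ∑ i ∈ Finset.range x.2.2.1, f ρ (x.2.2.2.2 i) := by
  have hf : Measurable (f ρ) := (continuous_f hρ).measurable
  have h1 : Measurable fun x : ℕ × ℕ × ℕ × (ℕ → ℝ) × (ℕ → ℝ) =>
      ∑ i ∈ Finset.range x.2.1, f ρ (x.2.2.2.1 i) :=
    (measurable_sum_range hf).comp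
      (f := fun x : ℕ × ℕ × ℕ × (ℕ → ℝ) × (ℕ → ℝ) => (x.2.1, x.2.2.2.1)) (by fun_prop)
  have h2 : Measurable fun x : ℕ × ℕ × ℕ × (ℕ → ℝ) × (ℕ → ℝ) =>
      ∑ i ∈ Finset.range x.2.2.1, f ρ (x.2.2.2.2 i) :=
    (measurable_sum_range hf).comp
      (f := fun x : ℕ × ℕ × ℕ × (ℕ → ℝ) × (ℕ → ℝ) => (x.2.2.1, x.2.2.2.2)) (by fun_prop)
  have h3 : Measurable fun x : ℕ × ℕ × ℕ × (ℕ → ℝ) × (ℕ → ℝ) =>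
      ∑ _i ∈ Finset.range x.1, Real.log ρ := by
    exact (Measurable.of_discrete (f := fun m : ℕ => ∑ _i ∈ Finset.range m, Real.log ρ)).comp
      measurable_fst
  exact ((measurable_const.add h3).add h1).add h2

/-- The character of a real number. -/
noncomputable def character (θ y : ℝ) : ℂ := Complex.exp (θ * y * Complex.I)

theorem norm_character (θ y : ℝ) : ‖character θ y‖ = 1 := by
  rw [character, ← Complex.ofReal_mul, Complex.norm_exp_ofReal_mul_I]

theorem character_add (θ x y : ℝ) : character θ (x + y) = character θ x * character θ y := by
  rw [character, character, character, ← Complex.exp_add]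
  push_cast
  ring_nf

theorem character_sum (θ : ℝ) {β : Type*} (s : Finset β) (g : β → ℝ) :
    character θ (∑ i ∈ s, g i) = ∏ i ∈ s, character θ (g i) := by
  classical
  induction s using Finset.induction with
  | empty => simp [character]
  | insert a s ha ih => rw [Finset.sum_insert ha, Finset.prod_insert ha, character_add, ih]

theorem character_multiset_sum (θ : ℝ) {β : Type*} (s : Multiset β) (g : β → ℝ) :
    character θ (s.map g).sum = (s.map fun a => character θ (g a)).prod := by
  induction s using Multiset.induction with
  | empty => simp [character]
  | cons a s ih => simp [character_add, ih]

theorem continuous_character (θ : ℝ) : Continuous (character θ) := by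
  unfold character
  fun_prop

theorem norm_integral_le_one {Ω : Type*} [MeasurableSpace Ω] (μ : Measure Ω)
    [IsProbabilityMeasure μ] {z : Ω → ℂ} (hz : ∀ y, ‖z y‖ ≤ 1) : ‖∫ y, z y ∂μ‖ ≤ 1 := by
  refine (norm_integral_le_of_norm_le_const (Eventually.of_forall hz)).trans ?_
  simp

/-- Characters turn the independent sums into products. Integrating the sequences first gives powers
indexed by the Poisson variables, and these integrate to exponentials. -/
theorem charFun_poissonSumLaw (h : ℝ) {ρ : ℝ} (hρ : 0 < ρ) (rc r0 r1 : ℝ≥0)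
    (μ₀ μ₁ : ProbabilityMeasure ℝ) (θ : ℝ) :
    charFun (poissonSumLaw h ρ rc r0 r1 μ₀ μ₁) θ = character θ h *
      (Complex.exp (rc * (character θ (Real.log ρ) - 1)) *
        (Complex.exp (r0 * (∫ y, character θ (f ρ y) ∂(μ₀ : Measure ℝ) - 1)) *
          Complex.exp (r1 * (∫ y, character θ (f ρ y) ∂(μ₁ : Measure ℝ) - 1)))) := by
  have hz : Measurable fun y => character θ (f ρ y) :=
    ((continuous_character θ).comp (continuous_f hρ)).measurable
  set w₀ := ∫ y, character θ (f ρ y) ∂(μ₀ : Measure ℝ)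
  set w₁ := ∫ y, character θ (f ρ y) ∂(μ₁ : Measure ℝ)
  have hw₀ : ‖w₀‖ ≤ 1 := norm_integral_le_one _ fun y => (norm_character _ _).le
  have hw₁ : ‖w₁‖ ≤ 1 := norm_integral_le_one _ fun y => (norm_character _ _).le
  have hm := measurable_poissonSum h hρ
  rw [charFun_apply_real, poissonSumLaw, integral_map hm.aemeasurable
    (Measurable.aestronglyMeasurable (by fun_prop))]
  let Z : ℕ → (ℕ → ℝ) → ℂ := fun m ξ => ∏ i ∈ Finset.range m, character θ (f ρ (ξ i))
  have hZn : ∀ m ξ, ‖Z m ξ‖ ≤ 1 := fun m ξ => by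
    simp [Z, norm_prod, norm_character]
  have e : ∀ x : ℕ × ℕ × ℕ × (ℕ → ℝ) × (ℕ → ℝ),
      Complex.exp (θ * ((h + ∑ _i ∈ Finset.range x.1, Real.log ρ
        + ∑ i ∈ Finset.range x.2.1, f ρ (x.2.2.2.1 i)
        + ∑ i ∈ Finset.range x.2.2.1, f ρ (x.2.2.2.2 i) : ℝ) : ℂ) * Complex.I)
      = character θ h * (character θ (Real.log ρ) ^ x.1 *
        (Z x.2.1 x.2.2.2.1 * Z x.2.2.1 x.2.2.2.2)) := by
    intro x
    change character θ _ = _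
    rw [character_add, character_add, character_add, character_sum, character_sum, character_sum]
    simp only [Finset.prod_const, Finset.card_range, Z]
    ring
  have hZm : Measurable fun x : ℕ × ℕ × (ℕ → ℝ) × (ℕ → ℝ) => Z x.1 x.2.2.1 * Z x.2.1 x.2.2.2 := by
    have h1 := (measurable_prod_range hz).comp
      (f := fun x : ℕ × ℕ × (ℕ → ℝ) × (ℕ → ℝ) => (x.1, x.2.2.1)) (by fun_prop)
    have h2 := (measurable_prod_range hz).comp
      (f := fun x : ℕ × ℕ × (ℕ → ℝ) × (ℕ → ℝ) => (x.2.1, x.2.2.2)) (by fun_prop)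
    exact h1.mul h2
  have hb : ∀ x : ℕ × ℕ × (ℕ → ℝ) × (ℕ → ℝ), ‖Z x.1 x.2.2.1 * Z x.2.1 x.2.2.2‖ ≤ 1 := fun x => by
    rw [norm_mul]; exact mul_le_one₀ (hZn _ _) (norm_nonneg _) (hZn _ _)
  refine (integral_congr_ae (Eventually.of_forall e)).trans ?_
  rw [integral_const_mul, integral_prod_mul (fun m : ℕ => character θ (Real.log ρ) ^ m)
    (fun x : ℕ × ℕ × (ℕ → ℝ) × (ℕ → ℝ) => Z x.1 x.2.2.1 * Z x.2.1 x.2.2.2),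
    integral_pow_poissonMeasure _ (norm_character _ _).le]
  congr 2
  rw [integral_prod _ (Integrable.of_bound hZm.aestronglyMeasurable 1 (Eventually.of_forall hb))]
  have inner : ∀ L0 : ℕ, ∫ x, Z L0 x.2.1 * Z x.1 x.2.2 ∂((poissonMeasure r1).prod
      ((Measure.infinitePi fun _ : ℕ => (μ₀ : Measure ℝ)).prod
        (Measure.infinitePi fun _ : ℕ => (μ₁ : Measure ℝ))))
      = w₀ ^ L0 * Complex.exp (r1 * (w₁ - 1)) := by
    intro L0
    have hi : Integrable (fun x : ℕ × (ℕ → ℝ) × (ℕ → ℝ) => Z L0 x.2.1 * Z x.1 x.2.2)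
        ((poissonMeasure r1).prod ((Measure.infinitePi fun _ : ℕ => (μ₀ : Measure ℝ)).prod
          (Measure.infinitePi fun _ : ℕ => (μ₁ : Measure ℝ)))) :=
      Integrable.of_bound
        (hZm.comp (measurable_prodMk_left (x := L0))).aestronglyMeasurable 1
        (Eventually.of_forall fun x => hb (L0, x))
    rw [integral_prod _ hi]
    have h2 : ∀ L1 : ℕ, ∫ y, Z L0 y.1 * Z L1 y.2 ∂((Measure.infinitePi fun _ : ℕ =>
        (μ₀ : Measure ℝ)).prod (Measure.infinitePi fun _ : ℕ => (μ₁ : Measure ℝ)))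
        = w₀ ^ L0 * w₁ ^ L1 := fun L1 => by
      rw [integral_prod_mul (fun ξ => Z L0 ξ) (fun ξ => Z L1 ξ), integral_prod_infinitePi μ₀ hz,
        integral_prod_infinitePi μ₁ hz]
    simp only [h2]
    rw [integral_const_mul, integral_pow_poissonMeasure _ hw₁]
  simp only [inner]
  rw [integral_mul_const, integral_pow_poissonMeasure _ hw₀]

instance (h ρ : ℝ) (rc r0 r1 : ℝ≥0) (μ₀ μ₁ : ProbabilityMeasure ℝ) :
    IsFiniteMeasure (poissonSumLaw h ρ rc r0 r1 μ₀ μ₁) := by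
  unfold poissonSumLaw
  infer_instance

namespace Params

variable (P : Params)

/-- The limiting law of the messages sent by vertices with label `x`. -/
noncomputable def messageLaw (t : ℕ) (x : Fin 2) : ProbabilityMeasure ℝ :=
  ⟨(P.limitLaw t x).map (P.message t),
    Measure.isProbabilityMeasure_map (Measurable.of_discrete).aemeasurable⟩

theorem messageLaw_coe (t : ℕ) (x : Fin 2) :
    (P.messageLaw t x : Measure ℝ) = (P.limitLaw t x).map (P.message t) := rfl

theorem messageLaw_zero (x : Fin 2) :
    (P.messageLaw 0 x : Measure ℝ) = Measure.dirac P.init := by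
  have : P.message 0 = fun _ => P.init := rfl
  rw [messageLaw_coe, this, Measure.map_const]
  simp

theorem integral_messageLaw (t : ℕ) (x : Fin 2) {z : ℝ → ℂ} (hz : Measurable z) :
    ∫ y, z y ∂(P.messageLaw t x : Measure ℝ) = ∫ τ, z (P.message t τ) ∂P.limitLaw t x := by
  rw [messageLaw_coe, integral_map (Measurable.of_discrete).aemeasurable hz.aestronglyMeasurable]

theorem integral_offspring (t : ℕ) (x : Fin 2) {z : Bool × Hist t → ℂ} (hz : ∀ e, ‖z e‖ ≤ 1) :
    ∫ e, z e ∂P.offspring (P.limitLaw t) x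
      = ∑ y, (P.kap y * P.deg x y : ℝ) * (P.cueProb y true * (∫ τ, z (true, τ) ∂P.limitLaw t y) +
          P.cueProb y false * ∫ τ, z (false, τ) ∂P.limitLaw t y) := by
  have hi : ∀ y, Integrable z ((P.cueLaw y).prod (P.limitLaw t y)) := fun y =>
    Integrable.of_bound (StronglyMeasurable.of_discrete).aestronglyMeasurable 1
      (Eventually.of_forall hz)
  rw [offspring, integral_finsetSum_measure fun y _ => (hi y).smul_measure ENNReal.ofReal_ne_top]
  refine Finset.sum_congr rfl fun y _ => ?_
  rw [integral_smul_measure, ENNReal.toReal_ofReal (mul_pos (P.kap_pos y) (P.deg_pos x y)).le,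
    Complex.real_smul, integral_prod _ (hi y), integral_fintype (by exact .of_finite),
    Fintype.sum_bool, cueLaw_real_singleton, cueLaw_real_singleton, Complex.real_smul,
    Complex.real_smul]

/-- The characteristic functions agree. On the left it is the generating functional of the Poisson
process of children, an exponential of an integral against the intensity. That integral splits over
label and cue status; label `0` with a cue has rate zero, and the other three classes give the three
Poisson sums. -/
theorem messageLaw_succ (t : ℕ) (x : Fin 2) :
    (P.messageLaw (t + 1) x : Measure ℝ) = poissonSumLaw P.field (P.a / P.b)
      (P.κ * P.deg x 1 * P.α).toNNReal ((1 - P.κ) * P.deg x 0).toNNReal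
      (P.κ * P.deg x 1 * (1 - P.α)).toNNReal (P.messageLaw t 0) (P.messageLaw t 1) := by
  have hρ : 0 < P.a / P.b := div_pos P.a_pos P.b_pos
  have hκ := P.κ_pos; have hκ' := P.κ_lt_one; have hα := P.α_pos; have hα' := P.α_lt_one
  refine Measure.ext_of_charFun (funext fun θ => ?_)
  rw [charFun_poissonSumLaw _ hρ, charFun_apply_real]
  have hz : Measurable fun y => character θ (f (P.a / P.b) y) :=
    ((continuous_character θ).comp (continuous_f hρ)).measurable
  have hL := P.integral_messageLaw (t + 1) x (z := character θ) (continuous_character θ).measurable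
  change ∫ y, character θ y ∂_ = _
  rw [hL]
  let z : Bool × Hist t → ℂ := fun e => character θ
    (if e.1 then Real.log (P.a / P.b) else f (P.a / P.b) (P.message t e.2))
  have e : ∀ τ : Hist (t + 1), character θ (P.message (t + 1) τ)
      = character θ P.field * (Multiset.map z τ).prod := fun τ => by
    have hm : P.message (t + 1) τ = P.field + (Multiset.map (fun e : Bool × Hist t =>
          if e.1 then Real.log (P.a / P.b) else f (P.a / P.b) (P.message t e.2)) τ).sum := rfl
    rw [hm, character_add]
    exact congrArg _ (character_multiset_sum θ (β := Bool × Hist t) τ _)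
  simp only [e]
  have hI : ∫ τ, (Multiset.map z τ).prod ∂P.limitLaw (t + 1) x
      = Complex.exp (-P.lam x + ∫ e, z e ∂P.offspring (P.limitLaw t) x) := by
    rw [← P.offspring_real_univ t x]
    exact integral_compoundPoisson _ fun e => (norm_character _ _).le
  rw [integral_const_mul, hI, integral_offspring _ _ _ fun e => (norm_character _ _).le,
    P.integral_messageLaw t 0 hz, P.integral_messageLaw t 1 hz, ← Complex.exp_add,
    ← Complex.exp_add]
  have hd := P.deg_pos x
  have hκ1 : 0 < 1 - P.κ := by linarith
  have hα1 : 0 < 1 - P.α := by linarith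
  rw [Real.coe_toNNReal _ (by have := hd 1; positivity),
    Real.coe_toNNReal _ (by have := hd 0; positivity),
    Real.coe_toNNReal _ (by have := hd 1; positivity)]
  congr 2
  simp only [Fin.sum_univ_two, lam, kap, cueProb, if_true, Bool.false_eq_true, if_false,
    integral_const, probReal_univ, one_smul, zero_ne_one]
  push_cast
  ring

end Params

/-! ### Short cycles are rare -/

section EdgeFree

variable {n : ℕ} {i j l k : Fin n} {D : Finset (Fin n)}

/-- An exploration outside `D` never inspects an edge with an end in `D`. When `D` contains the
parent, the branch behind a child is therefore independent of the edge that leads to it. -/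
theorem edgeFree_hist (t : ℕ) (hi : i ∈ D) (hl : l ∉ D) :
    EdgeFree i j fun ω => ω.hist t D l := fun _ _ _ hC hG =>
  Config.hist_congr hl (fun x y hx hy => hG x y (fun h => hx (h.1 ▸ hi)) (fun h => hy (h.2 ▸ hi)))
    (fun x _ _ => by rw [hC])

theorem edgeFree_reach (t : ℕ) (hi : i ∈ D) (hl : l ∉ D) :
    EdgeFree i j fun ω => ω.reach t D l := fun _ _ _ _ hG =>
  Config.reach_congr hl (fun x y hx hy => hG x y (fun h => hx (h.1 ▸ hi)) (fun h => hy (h.2 ▸ hi)))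

theorem edgeFree_treeLike (t : ℕ) (hi : i ∈ D) (hl : l ∉ D) :
    EdgeFree i j fun ω => ω.TreeLike t D l := fun _ _ _ _ hG =>
  propext (Config.treeLike_congr hl
    (fun x y hx hy => hG x y (fun h => hx (h.1 ▸ hi)) (fun h => hy (h.2 ▸ hi))))

theorem edgeFree_closes (t : ℕ) (hi : i ∈ D) (hl : l ∉ D) :
    EdgeFree l i fun ω => ω.Closes t D i l := fun _ _ _ _ hG =>
  propext (Config.closes_congr hl hi fun x y hx h => hG x y h fun h' => hx (h'.1 ▸ hi))

end EdgeFree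

namespace Model

variable {n : ℕ} (M : Model n)

open Classical in
theorem Pr_adj_and {i j : Fin n} (hij : i ≠ j) {A : Config n → Prop} (hA : EdgeFree i j A) :
    M.Pr {ω | ω.G.Adj i j ∧ A ω} = M.edge i j * M.Pr {ω | A ω} := by
  rw [Pr, Pr, ← M.E_adj_mul hij (Y := ({ω | A ω} : Set (Config n)).indicator fun _ => 1)]
  · congr 1
    ext ω
    by_cases h : ω.G.Adj i j <;> by_cases h' : A ω <;> simp [h, h']
  · exact hA.comp fun p => if p then (1 : ℝ) else 0

theorem Pr_eq_zero {A : Set (Config n)} (h : ∀ ω, ω ∉ A) : M.Pr A = 0 := by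
  have : A = ∅ := Set.eq_empty_of_forall_notMem h
  rw [Pr, this]
  simpa using M.E_const 0

theorem Pr_adj (i j : Fin n) : M.Pr {ω | ω.G.Adj i j} ≤ M.edge i j := by
  by_cases hij : i = j
  · rw [M.Pr_eq_zero (by simp [hij])]
    exact M.edge_nonneg _ _
  · have := M.Pr_adj_and hij (A := fun _ => True) (fun _ _ _ _ _ => rfl)
    simp only [and_true] at this
    rw [this]
    exact mul_le_of_le_one_right (M.edge_nonneg _ _) (M.Pr_le_one _)

/-- A first-moment bound over the neighbours of `l`. -/
theorem Pr_exists_nbr_le {c δ : ℝ} (hc : ∀ i j, M.edge i j ≤ c / n) (hc0 : 0 ≤ c) (hδ : 0 ≤ δ)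
    {D : Finset (Fin n)} {l : Fin n} {A : Fin n → Config n → Prop}
    (hA : ∀ k, k ∉ D → k ≠ l → EdgeFree l k (A k))
    (hP : ∀ k, k ∉ D → k ≠ l → M.Pr {ω | A k ω} ≤ δ) :
    M.Pr {ω | ∃ k, ω.G.Adj l k ∧ k ∉ D ∧ A k ω} ≤ c * δ := by
  have hn : 0 < (n : ℝ) := by exact_mod_cast l.pos
  have h1 := M.Pr_exists_le Finset.univ fun k => {ω | ω.G.Adj l k ∧ k ∉ D ∧ A k ω}
  simp only [Finset.mem_univ, true_and] at h1
  refine h1.trans ((Finset.sum_le_card_nsmul _ _ (c / n * δ) fun k _ => ?_).trans_eq ?_)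
  · by_cases hk : k ∈ D ∨ k = l
    · rw [M.Pr_eq_zero]
      · positivity
      · rintro ω ⟨h, h', _⟩
        rcases hk with hk | rfl
        exacts [h' hk, h.ne rfl]
    · rw [not_or] at hk
      calc M.Pr {ω | ω.G.Adj l k ∧ k ∉ D ∧ A k ω} ≤ M.Pr {ω | ω.G.Adj l k ∧ A k ω} :=
            M.Pr_mono fun ω h => ⟨h.1, h.2.2⟩
        _ = M.edge l k * M.Pr {ω | A k ω} := M.Pr_adj_and (Ne.symm hk.2) (hA k hk.1 hk.2)
        _ ≤ c / n * δ := mul_le_mul (hc _ _) (hP k hk.1 hk.2) (M.Pr_nonneg _) (by positivity)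
  · rw [Finset.card_univ, Fintype.card_fin, nsmul_eq_mul]
    field_simp

end Model

/-- Two given vertices are close with probability `O(1/n)`. -/
theorem exists_Pr_reach_le (c : ℝ) (hc0 : 0 ≤ c) (t : ℕ) : ∃ R : ℝ, 0 ≤ R ∧
    ∀ {n : ℕ} (M : Model n), (∀ i j, M.edge i j ≤ c / n) → ∀ (D : Finset (Fin n)) (l v : Fin n),
      l ∉ D → v ≠ l → M.Pr {ω | v ∈ ω.reach t D l} ≤ R / n := by
  induction t with
  | zero =>
    refine ⟨0, le_rfl, fun M _ D l v _ hv => ?_⟩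
    rw [M.Pr_eq_zero (A := {ω | v ∈ ω.reach 0 D l}) fun ω h => hv h]
    simp
  | succ t ih =>
    obtain ⟨R, hR0, hR⟩ := ih
    refine ⟨c + c * R, by positivity, fun {n} M hc D l v hl hv => ?_⟩
    -- Either `v` is adjacent to `l`, at cost `c / n`, or it is reached through another neighbour,
    -- at cost `c` times the previous bound.
    have hsub : {ω : Config n | v ∈ ω.reach (t + 1) D l} ⊆ {ω | ω.G.Adj l v} ∪
        {ω | ∃ k, ω.G.Adj l k ∧ k ∉ D ∧ (k ≠ v ∧ v ∈ ω.reach t (insert l D) k)} := by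
      rintro ω (h | ⟨k, hk, hkD, h⟩)
      · exact absurd h hv
      · by_cases hkv : k = v
        · exact Or.inl (hkv ▸ hk)
        · exact Or.inr ⟨k, hk, hkD, hkv, h⟩
    refine (M.Pr_mono hsub).trans ((M.Pr_union_le _ _).trans ?_)
    rw [add_div, mul_div_assoc c R]
    refine add_le_add ((M.Pr_adj _ _).trans (hc _ _)) (M.Pr_exists_nbr_le hc hc0 (by positivity)
      ?_ ?_)
    · intro k hkD hkl
      exact (edgeFree_reach t (Finset.mem_insert_self _ _) (by simp [hkD, hkl])).comp
        fun s => k ≠ v ∧ v ∈ s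
    · intro k hkD hkl
      by_cases hkv : k = v
      · rw [M.Pr_eq_zero fun ω h => h.1 hkv]
        positivity
      · exact (M.Pr_mono fun ω h => h.2).trans
          (hR M hc _ k v (by simp [hkD, hkl]) (Ne.symm hkv))

/-- Walks close up with probability `O(1/n)`. -/
theorem exists_Pr_closes_le (c : ℝ) (hc0 : 0 ≤ c) (t m : ℕ) : ∃ R : ℝ, 0 ≤ R ∧
    ∀ {n : ℕ} (M : Model n), (∀ i j, M.edge i j ≤ c / n) → ∀ (D : Finset (Fin n)) (u l : Fin n),
      D.card ≤ m → l ∉ D → M.Pr {ω | ω.Closes t D u l} ≤ R / n := by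
  induction t generalizing m with
  | zero =>
    refine ⟨0, le_rfl, fun M _ D u l _ _ => ?_⟩
    rw [M.Pr_eq_zero (A := {ω | ω.Closes 0 D u l}) fun ω h => h]
    simp
  | succ t ih =>
    obtain ⟨R, hR0, hR⟩ := ih (m + 1)
    -- The term `m * c` pays for edges into the removed set. The recursion removes one more vertex,
    -- which is why the induction hypothesis is taken at `m + 1`.
    refine ⟨m * c + c * R, by positivity, fun {n} M hc D u l hD hl => ?_⟩
    have hsub : {ω : Config n | ω.Closes (t + 1) D u l} ⊆
        {ω | ∃ d ∈ D, ω ∈ {ω : Config n | ω.G.Adj l d}} ∪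
        {ω | ∃ k, ω.G.Adj l k ∧ k ∉ D ∧ ω.Closes t (insert l D) l k} := by
      rintro ω (⟨d, hd, _, h⟩ | h)
      · exact Or.inl ⟨d, hd, h⟩
      · exact Or.inr h
    refine (M.Pr_mono hsub).trans ((M.Pr_union_le _ _).trans ?_)
    rw [add_div, mul_div_assoc c R]
    refine add_le_add ?_ (M.Pr_exists_nbr_le hc hc0 (by positivity) ?_ ?_)
    · refine (M.Pr_exists_le D _).trans ((Finset.sum_le_card_nsmul _ _ (c / n) fun d _ =>
        (M.Pr_adj _ _).trans (hc _ _)).trans ?_)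
      rw [nsmul_eq_mul, mul_div_assoc]
      have : (D.card : ℝ) ≤ m := by exact_mod_cast hD
      gcongr
    · intro k hkD hkl
      exact (edgeFree_closes t (Finset.mem_insert_self _ _) (by simp [hkD, hkl])).symm
    · intro k hkD hkl
      exact hR M hc _ l k ((Finset.card_insert_le _ _).trans (by omega)) (by simp [hkD, hkl])

/-- Neighbourhoods fail to be tree-like with probability `O(1/n)`. -/
theorem exists_Pr_not_treeLike_le (c : ℝ) (hc0 : 0 ≤ c) (t : ℕ) : ∃ R : ℝ, 0 ≤ R ∧
    ∀ {n : ℕ} (M : Model n), (∀ i j, M.edge i j ≤ c / n) → ∀ (D : Finset (Fin n)) (l : Fin n),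
      l ∉ D → M.Pr {ω | ¬ω.TreeLike t D l} ≤ R / n := by
  induction t with
  | zero =>
    refine ⟨0, le_rfl, fun M _ D l _ => ?_⟩
    rw [M.Pr_eq_zero (A := {ω | ¬ω.TreeLike 0 D l}) fun ω h => h trivial]
    simp
  | succ t ih =>
    obtain ⟨R, hR0, hR⟩ := ih
    obtain ⟨R', hR0', hR'⟩ := exists_Pr_reach_le c hc0 (t + 1 + t)
    refine ⟨c * (c * R') + c * R, by positivity, fun {n} M hc D l hl => ?_⟩
    -- If two branches meet or are joined by an edge, then `t` steps down one, possibly one step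
    -- across and `t` steps up the other lead from the child `k` to the child `k'` without visiting
    -- `l`.
    have hsub : {ω : Config n | ¬ω.TreeLike (t + 1) D l} ⊆
        {ω | ∃ k, ω.G.Adj l k ∧ k ∉ D ∧ ∃ k', ω.G.Adj l k' ∧ k' ∉ insert k D ∧
          k' ∈ ω.reach (t + 1 + t) (insert l D) k} ∪
        {ω | ∃ k, ω.G.Adj l k ∧ k ∉ D ∧ ¬ω.TreeLike t (insert l D) k} := by
      intro ω h
      by_contra hcon
      rw [Set.mem_union, not_or] at hcon
      refine h ⟨?_, fun k hk hkD => ?_⟩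
      · intro k k' hk hkD hk' hkD' hne x hx y hy
        have hkl' : k' ∉ insert l D := by simp [hkD', hk'.ne']
        have hy' := Config.reach_symm hkl' hy
        have hyD := Config.notMem_of_mem_reach hkl' hy
        refine ⟨?_, ?_⟩
        · rintro rfl
          refine hcon.1 ⟨k, hk, hkD, k', hk', by simp [hne.symm, hkD'], ?_⟩
          exact Config.reach_mono (by omega) (Config.reach_trans hx hy')
        · intro hxy
          refine hcon.1 ⟨k, hk, hkD, k', hk', by simp [hne.symm, hkD'], ?_⟩
          exact Config.reach_trans (Config.reach_succ_of_adj hx hxy hyD) hy'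
      · by_contra hT
        exact hcon.2 ⟨k, hk, hkD, hT⟩
    refine (M.Pr_mono hsub).trans ((M.Pr_union_le _ _).trans ?_)
    rw [add_div, mul_div_assoc c R, mul_div_assoc c (c * R'), mul_div_assoc c R']
    refine add_le_add (M.Pr_exists_nbr_le hc hc0 (by positivity) ?_ ?_)
      (M.Pr_exists_nbr_le hc hc0 (by positivity) ?_ ?_)
    -- The second child ranges outside `insert k D`, so the event attached to `k` involves only
    -- edges from `l` to other vertices and is independent of the edge `{l, k}`.
    · intro k hkD hkl ω ω' hS hC hG
      have hre := edgeFree_reach (j := k) (t + 1 + t) (Finset.mem_insert_self l D)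
        (show k ∉ insert l D by simp [hkD, hkl]) ω ω' hS hC hG
      refine propext (exists_congr fun k' => ?_)
      dsimp only at hre
      rw [hre]
      by_cases hkk : k' ∈ insert k D
      · simp [hkk]
      · have : k' ≠ k := fun e => hkk (by simp [e])
        rw [hG l k' (fun h => this h.2) (fun h => hkl h.1.symm)]
    · intro k hkD hkl
      refine M.Pr_exists_nbr_le hc hc0 (by positivity) ?_ ?_
      · intro k' hkD' hkl'
        exact (edgeFree_reach _ (Finset.mem_insert_self l D) (by simp [hkD, hkl])).comp
          fun s => k' ∈ s
      · intro k' hkD' hkl'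
        exact hR' M hc _ k k' (by simp [hkD, hkl]) (fun e => hkD' (by simp [e]))
    · intro k hkD hkl
      exact (edgeFree_treeLike t (Finset.mem_insert_self _ _) (by simp [hkD, hkl])).comp Not
    · intro k hkD hkl
      exact hR M hc _ k (by simp [hkD, hkl])

/-! ### Indicators -/

open Classical in
/-- The indicator of a proposition. -/
noncomputable def ind (p : Prop) : ℝ := if p then 1 else 0

theorem ind_of {p : Prop} (h : p) : ind p = 1 := if_pos h

theorem ind_of_not {p : Prop} (h : ¬p) : ind p = 0 := if_neg h

theorem ind_nonneg (p : Prop) : 0 ≤ ind p := by unfold ind; split_ifs <;> norm_num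

theorem ind_le_one (p : Prop) : ind p ≤ 1 := by unfold ind; split_ifs <;> norm_num

theorem ind_not (p : Prop) : ind (¬p) = 1 - ind p := by
  by_cases h : p <;> simp [ind, h]

theorem ind_and (p q : Prop) : ind (p ∧ q) = ind p * ind q := by
  by_cases h : p <;> by_cases h' : q <;> simp [ind, h, h']

theorem abs_ind_sub_ind_le {p q r : Prop} (h : ¬r → (p ↔ q)) : |ind p - ind q| ≤ ind r := by
  by_cases hr : r
  · rw [ind_of hr, abs_le]
    constructor <;> linarith [ind_nonneg p, ind_nonneg q, ind_le_one p, ind_le_one q]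
  · rw [propext (h hr), sub_self, abs_zero]
    exact ind_nonneg r

theorem abs_mul_sub_mul_le {a b c d : ℝ} (hb : |b| ≤ 1) (hc : |c| ≤ 1) :
    |a * b - c * d| ≤ |a - c| + |b - d| := by
  have : a * b - c * d = (a - c) * b + c * (b - d) := by ring
  rw [this]
  refine (abs_add_le _ _).trans (add_le_add ?_ ?_)
  · rw [abs_mul]; exact mul_le_of_le_one_right (abs_nonneg _) hb
  · rw [abs_mul]; exact mul_le_of_le_one_left (abs_nonneg _) hc

namespace Model

variable {n : ℕ} (M : Model n)

theorem Pr_eq_E_ind (A : Config n → Prop) : M.Pr {ω | A ω} = M.E fun ω => ind (A ω) := by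
  rw [Pr]
  congr 1

theorem E_ind_adj_mul {i j : Fin n} (hij : i ≠ j) {Y : Config n → ℝ} (hY : EdgeFree i j Y) :
    M.E (fun ω => ind (ω.G.Adj i j) * Y ω) = M.edge i j * M.E Y := M.E_adj_mul hij hY

theorem E_ind_adj_le (i j : Fin n) : M.E (fun ω => ind (ω.G.Adj i j)) ≤ M.edge i j := by
  rw [← Pr_eq_E_ind]
  exact M.Pr_adj i j

/-- The label of a vertex. -/
def lab (k : Fin n) : Fin 2 := if k ∈ M.S then 1 else 0

/-- The vertices outside `D` with label `y`. -/
def cls (D : Finset (Fin n)) (y : Fin 2) : Finset (Fin n) :=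
  Finset.univ.filter fun k => k ∉ D ∧ M.lab k = y

theorem mem_cls {D : Finset (Fin n)} {y : Fin 2} {k : Fin n} :
    k ∈ M.cls D y ↔ k ∉ D ∧ M.lab k = y := by simp [cls]

theorem sum_cls (D : Finset (Fin n)) (F : Fin n → ℝ) :
    ∑ k ∈ Finset.univ.filter (fun k => k ∉ D), F k = ∑ y, ∑ k ∈ M.cls D y, F k := by
  rw [← Finset.sum_fiberwise (Finset.univ.filter fun k => k ∉ D) M.lab]
  refine Finset.sum_congr rfl fun y _ => Finset.sum_congr ?_ fun _ _ => rfl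
  ext k
  simp [cls]

end Model

/-! ### Separating one child from a history -/

namespace Config

variable {n : ℕ}

/-- The cue status and the history of `k`. -/
noncomputable def type (ω : Config n) (t : ℕ) (D : Finset (Fin n)) (k : Fin n) : Bool × Hist t :=
  (decide (k ∈ ω.C), ω.hist t D k)

/-- The history of `l` without the child `k`. -/
noncomputable def histErase (ω : Config n) (t : ℕ) (D : Finset (Fin n)) (l k : Fin n) :
    Multiset (Bool × Hist t) :=
  ((ω.nbrs D l).erase k).val.map fun k' => ω.type t (insert l D) k'

theorem hist_eq_cons {ω : Config n} {t : ℕ} {D : Finset (Fin n)} {l k : Fin n}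
    (hk : k ∈ ω.nbrs D l) :
    ω.hist (t + 1) D l = ω.type t (insert l D) k ::ₘ ω.histErase t D l k := by
  have h : (ω.nbrs D l).val = k ::ₘ ((ω.nbrs D l).erase k).val := by
    rw [Finset.erase_val, Multiset.cons_erase hk]
  rw [hist, h, Multiset.map_cons]
  rfl

theorem hist_eq_histErase {ω : Config n} {t : ℕ} {D : Finset (Fin n)} {l k : Fin n}
    (hk : ¬ω.G.Adj l k) : ω.hist (t + 1) D l = ω.histErase t D l k := by
  rw [hist, histErase, Finset.erase_eq_of_notMem fun h => hk (mem_nbrs.1 h).1]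
  rfl

/-- A pointwise Mecke identity: if the history is `e ::ₘ τ`, exactly `count + 1` children have type
`e`, and removing any of them leaves `τ`. The type of `k` and the remaining children are both
insensitive to the edge `{l, k}`, so each summand factors under the expectation. -/
theorem count_mul_ind_hist (ω : Config n) (t : ℕ) (D : Finset (Fin n)) (l : Fin n)
    (e : Bool × Hist t) (τ : Multiset (Bool × Hist t)) :
    ((τ.count e : ℝ) + 1) * ind (ω.hist (t + 1) D l = e ::ₘ τ)
      = ∑ k ∈ Finset.univ.filter (fun k => k ∉ insert l D), ind (ω.G.Adj l k) *
        (ind (ω.type t (insert l D) k = e) * ind (ω.histErase t D l k = τ)) := by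
  have hsub : ω.nbrs D l ⊆ Finset.univ.filter (fun k => k ∉ insert l D) := by
    intro k hk
    rw [mem_nbrs] at hk
    simp [hk.2, hk.1.ne']
  rw [← Finset.sum_subset hsub]
  · by_cases h : ω.hist (t + 1) D l = e ::ₘ τ
    · have h1 : ∀ k ∈ ω.nbrs D l, ind (ω.G.Adj l k) *
          (ind (ω.type t (insert l D) k = e) * ind (ω.histErase t D l k = τ))
          = if ω.type t (insert l D) k = e then 1 else 0 := by
        intro k hk
        rw [ind_of (mem_nbrs.1 hk).1, one_mul]
        split_ifs with hke
        · rw [hist_eq_cons hk, hke] at h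
          rw [ind_of hke, ind_of ((Multiset.cons_inj_right _).1 h), one_mul]
        · rw [ind_of_not hke, zero_mul]
      rw [Finset.sum_congr rfl h1, ind_of h, mul_one, Finset.sum_boole]
      have h2 := congrArg (Multiset.count e) h
      rw [Multiset.count_cons_self] at h2
      have h3 : Multiset.count e (ω.hist (t + 1) D l)
          = ((ω.nbrs D l).filter fun k => ω.type t (insert l D) k = e).card := by
        rw [hist]
        refine (Multiset.count_map _ _ _).trans ?_
        rw [← Finset.filter_val, Finset.card_val]
        congr 1
        ext k
        simp [type, eq_comm]
      rw [← h3]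
      exact_mod_cast h2.symm
    · rw [ind_of_not h, mul_zero]
      refine (Finset.sum_eq_zero fun k hk => ?_).symm
      by_cases hke : ω.type t (insert l D) k = e
      · rw [ind_of_not (p := ω.histErase t D l k = τ)]
        · simp
        · intro h'
          exact h (by rw [hist_eq_cons hk, hke, h'])
      · rw [ind_of_not hke]; simp
  · intro k hk hk'
    rw [Finset.mem_filter, Finset.mem_insert, not_or] at hk
    rw [ind_of_not fun h => hk' (mem_nbrs.2 ⟨h, hk.2.2⟩), zero_mul]

end Config

theorem edgeFree_type {n : ℕ} {i j l : Fin n} {D : Finset (Fin n)} (t : ℕ) (hi : i ∈ D)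
    (hl : l ∉ D) : EdgeFree i j fun ω => ω.type t D l :=
  (edgeFree_C i j fun C => decide (l ∈ C)).comp₂ (edgeFree_hist t hi hl) Prod.mk

theorem edgeFree_histErase {n : ℕ} {l k : Fin n} {D : Finset (Fin n)} (t : ℕ) :
    EdgeFree l k fun ω => ω.histErase t D l k := by
  intro ω ω' hS hC hG
  have hn : (ω.nbrs D l).erase k = (ω'.nbrs D l).erase k := by
    ext k'
    rw [Finset.mem_erase, Finset.mem_erase, Config.mem_nbrs, Config.mem_nbrs]
    refine and_congr_right fun hne => ?_
    rw [hG l k' (fun h => hne h.2) (fun h => hne (h.2.trans h.1))]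
  simp only [Config.histErase, hn]
  refine Multiset.map_congr rfl fun k' hk' => ?_
  rw [Finset.mem_val, Finset.mem_erase, Config.mem_nbrs] at hk'
  exact edgeFree_type t (Finset.mem_insert_self l D) (by simp [hk'.2.2, hk'.2.1.ne']) ω ω' hS hC hG

/-! ### Models with the prescribed parameters: class sizes and mean degrees -/

namespace Params

variable (P : Params) (K : ℕ → ℕ)

/-- The model on `n` vertices has the parameters prescribed by `P` and `K`. -/
structure Fits {n : ℕ} (M : Model n) : Prop where
  p_eq : M.p = P.a / n
  q_eq : M.q = P.b / n
  α_eq : M.α = P.α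
  card_eq : M.S.card = K n

/-- A bound for the degrees. -/
noncomputable def degBound : ℝ := P.a + P.b

theorem degBound_pos : 0 < P.degBound := add_pos P.a_pos P.b_pos

theorem deg_le (x y : Fin 2) : P.deg x y ≤ P.degBound := by
  have := P.a_pos; have := P.b_pos
  unfold deg degBound
  split_ifs <;> linarith

variable {P K} {n : ℕ} {M : Model n}

theorem Fits.edge_eq (h : P.Fits K M) (i j : Fin n) :
    M.edge i j = P.deg (M.lab i) (M.lab j) / n := by
  unfold Model.edge deg Model.lab
  rw [h.p_eq, h.q_eq]
  by_cases hi : i ∈ M.S <;> by_cases hj : j ∈ M.S <;> simp [hi, hj]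

theorem Fits.edge_le (h : P.Fits K M) (i j : Fin n) : M.edge i j ≤ P.degBound / n := by
  rw [h.edge_eq]
  gcongr
  exact P.deg_le _ _

theorem Fits.E_cue_mul (h : P.Fits K M) (k : Fin n) (c : Bool) {Y : Config n → ℝ}
    (hY : CueFree k Y) :
    M.E (fun ω => ind (decide (k ∈ ω.C) = c) * Y ω) = P.cueProb (M.lab k) c * M.E Y := by
  have hcue : M.cue k = P.cueProb (M.lab k) true := by
    unfold Model.cue cueProb Model.lab
    rw [h.α_eq]
    by_cases hk : k ∈ M.S <;> simp [hk]
  have h1 : M.E (fun ω => ind (k ∈ ω.C) * Y ω) = M.cue k * M.E Y := by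
    convert M.E_cue_mul k hY using 4
    unfold ind
    congr
  cases c
  · have h2 : P.cueProb (M.lab k) false = 1 - M.cue k := by
      rw [hcue]; simp [cueProb]
    simp only [decide_eq_false_iff_not, ind_not]
    rw [h2, sub_mul, one_mul, ← h1, ← Model.E_sub]
    congr 1
    ext ω
    ring
  · simp only [decide_eq_true_eq]
    rw [h1, hcue]

theorem Fits.E_cue (h : P.Fits K M) (k : Fin n) (c : Bool) :
    M.E (fun ω => ind (decide (k ∈ ω.C) = c)) = P.cueProb (M.lab k) c := by
  have := h.E_cue_mul k c (Y := fun _ => 1) (fun _ _ _ _ _ => rfl)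
  simpa [M.E_one] using this

theorem Fits.E_cue_cue (h : P.Fits K M) {k k' : Fin n} (hk : k ≠ k') (c c' : Bool) :
    M.E (fun ω => ind (decide (k ∈ ω.C) = c) * ind (decide (k' ∈ ω.C) = c'))
      = P.cueProb (M.lab k) c * P.cueProb (M.lab k') c' := by
  rw [h.E_cue_mul k c, h.E_cue]
  intro ω ω' _ _ hC
  have : decide (k' ∈ ω.C) = decide (k' ∈ ω'.C) := by simp [hC k' hk.symm]
  simp only [this]

/-- The proportion of the vertices with a given label. -/
theorem Fits.abs_card_cls_sub_le (h : P.Fits K M) (hn : 0 < n) {D : Finset (Fin n)} {m : ℕ}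
    (hD : D.card ≤ m) (y : Fin 2) :
    |((M.cls D y).card : ℝ) / n - P.kap y| ≤ |(K n : ℝ) / n - P.κ| + m / n := by
  have hn' : (0 : ℝ) < n := by exact_mod_cast hn
  -- The classes of the two labels are complementary, so their proportions deviate from the limits
  -- by opposite amounts.
  have h0 : ((M.cls ∅ y).card : ℝ) / n - P.kap y = (if y = 1 then 1 else -1) *
      ((K n : ℝ) / n - P.κ) := by
    have h1 : M.cls ∅ 1 = M.S := by
      ext k; simp [Model.cls, Model.lab]
    have h2 : M.cls ∅ 0 = M.Sᶜ := by
      ext k; simp [Model.cls, Model.lab]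
    match y with
    | 1 => simp [h1, h.card_eq, kap]
    | 0 =>
      have h3 : ((M.Sᶜ.card : ℕ) : ℝ) = n - K n := by
        rw [Finset.card_compl, Fintype.card_fin, Nat.cast_sub, h.card_eq]
        simpa using Finset.card_le_univ M.S
      simp only [h2, h3, kap]
      simp
      field_simp
      ring
  have hle : (M.cls D y).card ≤ (M.cls ∅ y).card := by
    refine Finset.card_le_card fun k hk => ?_
    rw [Model.mem_cls] at hk ⊢
    exact ⟨by simp, hk.2⟩
  have hge : (M.cls ∅ y).card ≤ (M.cls D y).card + m := by
    have : M.cls ∅ y ⊆ M.cls D y ∪ D := by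
      intro k hk
      rw [Finset.mem_union, Model.mem_cls]
      rw [Model.mem_cls] at hk
      by_cases hkD : k ∈ D
      · exact Or.inr hkD
      · exact Or.inl ⟨hkD, hk.2⟩
    exact (Finset.card_le_card this).trans ((Finset.card_union_le _ _).trans (by omega))
  have hd : |((M.cls D y).card : ℝ) / n - (M.cls ∅ y).card / n| ≤ m / n := by
    rw [← sub_div, abs_div, abs_of_pos hn']
    gcongr
    have h1 : ((M.cls D y).card : ℝ) ≤ (M.cls ∅ y).card := by exact_mod_cast hle
    have h2 : ((M.cls ∅ y).card : ℝ) ≤ (M.cls D y).card + m := by exact_mod_cast hge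
    rw [abs_le]
    constructor <;> linarith
  have h3 : |((M.cls ∅ y).card : ℝ) / n - P.kap y| = |(K n : ℝ) / n - P.κ| := by
    rw [h0, abs_mul]
    split_ifs <;> simp
  calc |((M.cls D y).card : ℝ) / n - P.kap y|
      ≤ |((M.cls D y).card : ℝ) / n - (M.cls ∅ y).card / n|
        + |((M.cls ∅ y).card : ℝ) / n - P.kap y| := abs_sub_le _ _ _
    _ ≤ _ := by rw [h3, add_comm]; gcongr

/-- The mean degree outside `D`. -/
theorem Fits.abs_sum_edge_sub_le (h : P.Fits K M) {D : Finset (Fin n)} {m : ℕ}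
    (hD : D.card ≤ m) (l : Fin n) :
    |∑ k ∈ Finset.univ.filter (fun k => k ∉ D), M.edge l k - P.lam (M.lab l)|
      ≤ 2 * P.degBound * (|(K n : ℝ) / n - P.κ| + m / n) := by
  have hn : 0 < n := l.pos
  have hs : ∀ y, ∑ k ∈ M.cls D y, M.edge l k = P.deg (M.lab l) y * ((M.cls D y).card / n) := by
    intro y
    rw [Finset.sum_congr rfl fun k hk => by rw [h.edge_eq, ((M.mem_cls).1 hk).2],
      Finset.sum_const, nsmul_eq_mul]
    ring
  rw [M.sum_cls, lam, ← Finset.sum_sub_distrib]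
  refine (Finset.abs_sum_le_sum_abs _ _).trans ?_
  refine (Finset.sum_le_card_nsmul _ _ (P.degBound * (|(K n : ℝ) / n - P.κ| + m / n))
    fun y _ => ?_).trans_eq (by simp; ring)
  rw [hs, mul_comm (P.kap y), ← mul_sub, abs_mul, abs_of_pos (P.deg_pos _ _)]
  exact mul_le_mul (P.deg_le _ _) (h.abs_card_cls_sub_le hn hD y) (abs_nonneg _) P.degBound_pos.le

end Params

/-! ### Convergence of histories -/

theorem abs_exp_neg_sub_le {x y : ℝ} (hx : 0 ≤ x) (hy : 0 ≤ y) :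
    |Real.exp (-x) - Real.exp (-y)| ≤ |x - y| := by
  wlog hxy : x ≤ y generalizing x y
  · rw [abs_sub_comm, abs_sub_comm x]
    exact this hy hx (not_le.1 hxy).le
  have h1 : Real.exp (-y) = Real.exp (-x) * Real.exp (x - y) := by
    rw [← Real.exp_add]; congr 1; ring
  have h2 : Real.exp (-y) ≤ Real.exp (-x) := Real.exp_le_exp.2 (by linarith)
  have h3 : Real.exp (-x) ≤ 1 := Real.exp_le_one_iff.2 (by linarith)
  have h4 := Real.add_one_le_exp (x - y)
  have h5 := Real.exp_pos (-x)
  rw [abs_of_nonneg (by linarith), abs_of_nonpos (by linarith), h1]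
  nlinarith

/-- Factors are exchanged one at a time: `1 - w k` and `exp (-w k)` differ by at most `w k ^ 2`, and
all the factors are bounded by one. For edge probabilities of order `1/n` the total error is of
order `1/n`. -/
theorem abs_prod_one_sub_sub_exp_le {β : Type*} (s : Finset β) {w : β → ℝ} (h0 : ∀ k, 0 ≤ w k)
    (h1 : ∀ k, w k ≤ 1) :
    |∏ k ∈ s, (1 - w k) - Real.exp (-∑ k ∈ s, w k)| ≤ ∑ k ∈ s, w k ^ 2 := by
  classical
  induction s using Finset.induction with
  | empty => simp
  | insert k s hk ih =>
    rw [Finset.prod_insert hk, Finset.sum_insert hk, Finset.sum_insert hk, neg_add, Real.exp_add]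
    have hp : |∏ k ∈ s, (1 - w k)| ≤ 1 := by
      rw [Finset.abs_prod]
      refine Finset.prod_le_one (fun _ _ => abs_nonneg _) fun k _ => ?_
      rw [abs_le]; constructor <;> linarith [h0 k, h1 k]
    have he : |Real.exp (-w k)| ≤ 1 := by
      rw [abs_of_pos (Real.exp_pos _)]
      exact Real.exp_le_one_iff.2 (by linarith [h0 k])
    refine (abs_mul_sub_mul_le hp he).trans (add_le_add ?_ ih)
    have := Real.abs_exp_sub_one_sub_id_le (x := -w k)
      (by rw [abs_neg, abs_of_nonneg (h0 k)]; exact h1 k)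
    rw [abs_sub_comm]
    calc |Real.exp (-w k) - (1 - w k)| = |Real.exp (-w k) - 1 - -w k| := by congr 1; ring
      _ ≤ (-w k) ^ 2 := this
      _ = w k ^ 2 := by ring

theorem EdgeFree.ind {n : ℕ} {i j : Fin n} {β : Type*} {Y : Config n → β} (h : EdgeFree i j Y)
    (p : β → Prop) : EdgeFree i j fun ω => ind (p (Y ω)) := h.comp fun b => HiddenCommunity.ind (p b)

namespace Model

variable {n : ℕ} (M : Model n)

/-- The probability that `l` has no neighbour in `s`. -/
theorem E_prod_not_adj_mul {l : Fin n} (s : Finset (Fin n)) (hs : l ∉ s) {Y : Config n → ℝ}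
    (hY : ∀ k ∈ s, EdgeFree l k Y) :
    M.E (fun ω => (∏ k ∈ s, ind (¬ω.G.Adj l k)) * Y ω) = (∏ k ∈ s, (1 - M.edge l k)) * M.E Y := by
  induction s using Finset.induction with
  | empty => simp
  | insert k s hk ih =>
    have hlk : l ≠ k := fun e => hs (by simp [e])
    have hZ : EdgeFree l k fun ω => (∏ k' ∈ s, ind (¬ω.G.Adj l k')) * Y ω := by
      refine EdgeFree.comp₂ ?_ (hY k (Finset.mem_insert_self _ _)) (· * ·)
      intro ω ω' _ _ hG
      refine Finset.prod_congr rfl fun k' hk' => ?_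
      have : k' ≠ k := fun e => hk (e ▸ hk')
      rw [hG l k' (fun h => this h.2) (fun h => hlk h.1)]
    have h1 := M.E_ind_adj_mul hlk hZ
    rw [Finset.prod_insert hk, mul_assoc, ← ih (fun h => hs (by simp [h]))
      (fun k' hk' => hY k' (Finset.mem_insert_of_mem hk')), sub_mul, one_mul, ← h1, ← E_sub]
    congr 1
    ext ω
    rw [Finset.prod_insert hk, ind_not]
    ring

end Model

theorem abs_le_one_of_mem {x : ℝ} (h0 : 0 ≤ x) (h1 : x ≤ 1) : |x| ≤ 1 := by
  rwa [abs_of_nonneg h0]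

namespace Params

variable {P : Params} {K : ℕ → ℕ} {n : ℕ} {M : Model n}

/-- The Mecke formula holds approximately for histories. -/
theorem Fits.mecke_approx (h : P.Fits K M) {D : Finset (Fin n)} {l : Fin n} {t : ℕ}
    (e : Bool × Hist t) (τ : Multiset (Bool × Hist t)) {Y : Config n → ℝ} (hY0 : ∀ ω, 0 ≤ Y ω)
    (hY1 : ∀ ω, Y ω ≤ 1) (hYf : ∀ k, k ∉ D → k ≠ l → EdgeFree l k Y) {δ : ℝ}
    (hδ : ∀ y, M.E (fun ω =>
      |(∑ k ∈ M.cls (insert l D) y, ind (ω.type t (insert l D) k = e)) / n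
        - P.kap y * (P.cueProb y e.1 * P.pmf t y e.2)|) ≤ δ) :
    |((τ.count e : ℝ) + 1) * M.E (fun ω => ind (ω.hist (t + 1) D l = e ::ₘ τ) * Y ω)
      - P.rate t (M.lab l) e * M.E (fun ω => ind (ω.hist (t + 1) D l = τ) * Y ω)|
      ≤ P.degBound ^ 2 / n + 2 * (P.degBound * δ) := by
  have hn : (0 : ℝ) < n := by exact_mod_cast l.pos
  set s : Finset (Fin n) := Finset.univ.filter (fun k => k ∉ insert l D) with hs
  have hmem : ∀ k ∈ s, k ∉ D ∧ k ≠ l := fun k hk => by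
    rw [hs, Finset.mem_filter, Finset.mem_insert, not_or] at hk
    exact ⟨hk.2.2, hk.2.1⟩
  -- A child is marked and its edge is integrated out: the type of `k`, the rest of the history and
  -- `Y` all ignore the edge `{l, k}`.
  have h1 : ((τ.count e : ℝ) + 1) * M.E (fun ω => ind (ω.hist (t + 1) D l = e ::ₘ τ) * Y ω)
      = ∑ k ∈ s, M.edge l k * M.E (fun ω => ind (ω.type t (insert l D) k = e) *
        (ind (ω.histErase t D l k = τ) * Y ω)) := by
    have hk : ∀ k ∈ s, M.edge l k * M.E (fun ω => ind (ω.type t (insert l D) k = e) *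
        (ind (ω.histErase t D l k = τ) * Y ω)) = M.E (fun ω => ind (ω.G.Adj l k) *
          (ind (ω.type t (insert l D) k = e) * (ind (ω.histErase t D l k = τ) * Y ω))) := by
      intro k hk
      obtain ⟨hkD, hkl⟩ := hmem k hk
      refine (M.E_ind_adj_mul hkl.symm ?_).symm
      exact ((edgeFree_type t (Finset.mem_insert_self l D) (by simp [hkD, hkl])).ind
        (· = e)).comp₂ (((edgeFree_histErase t).ind (· = τ)).comp₂ (hYf k hkD hkl) (· * ·)) (· * ·)
    rw [Finset.sum_congr rfl hk, ← Model.E_sum, ← Model.E_mul_left]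
    congr 1
    ext ω
    rw [← mul_assoc, Config.count_mul_ind_hist, Finset.sum_mul]
    exact Finset.sum_congr rfl fun k _ => by ring
  -- Forgetting to erase `k` matters only if `l ∼ k`. Each term then costs an edge probability
  -- twice, and there are at most `n` terms.
  have h2 : |∑ k ∈ s, M.edge l k * M.E (fun ω => ind (ω.type t (insert l D) k = e) *
        (ind (ω.histErase t D l k = τ) * Y ω))
      - ∑ k ∈ s, M.edge l k * M.E (fun ω => ind (ω.type t (insert l D) k = e) *
        (ind (ω.hist (t + 1) D l = τ) * Y ω))| ≤ P.degBound ^ 2 / n := by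
    rw [← Finset.sum_sub_distrib]
    refine (Finset.abs_sum_le_sum_abs _ _).trans ?_
    refine (Finset.sum_le_card_nsmul _ _ ((P.degBound / n) ^ 2) fun k _ => ?_).trans ?_
    · rw [← mul_sub, abs_mul, abs_of_nonneg (M.edge_nonneg _ _), pow_two]
      refine mul_le_mul (h.edge_le _ _) ?_ (abs_nonneg _) (div_nonneg P.degBound_pos.le hn.le)
      refine ((M.abs_E_sub_le _ _).trans ?_).trans (h.edge_le l k)
      refine (M.E_mono fun ω => ?_).trans (M.E_ind_adj_le l k)
      rw [← mul_sub, ← sub_mul, abs_mul, abs_mul]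
      have a1 := abs_le_one_of_mem (ind_nonneg (ω.type t (insert l D) k = e)) (ind_le_one _)
      have a2 := abs_le_one_of_mem (hY0 ω) (hY1 ω)
      have a3 : |ind (ω.histErase t D l k = τ) - ind (ω.hist (t + 1) D l = τ)|
          ≤ ind (ω.G.Adj l k) :=
        abs_ind_sub_ind_le fun hadj => by rw [Config.hist_eq_histErase hadj]; exact Iff.rfl
      calc _ ≤ 1 * (|ind (ω.histErase t D l k = τ) - ind (ω.hist (t + 1) D l = τ)| * 1) := by
            gcongr
        _ ≤ _ := by rw [one_mul, mul_one]; exact a3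
    · rw [nsmul_eq_mul]
      have : (s.card : ℝ) ≤ n := by
        exact_mod_cast (Finset.card_le_univ s).trans_eq (Fintype.card_fin n)
      calc (s.card : ℝ) * (P.degBound / n) ^ 2 ≤ n * (P.degBound / n) ^ 2 := by gcongr
        _ = P.degBound ^ 2 / n := by field_simp
  -- Edge probabilities depend only on labels, so the sum over `k` regroups into empirical
  -- frequencies of types, to which the hypothesis on `δ` applies.
  have h3 : ∑ k ∈ s, M.edge l k * M.E (fun ω => ind (ω.type t (insert l D) k = e) *
        (ind (ω.hist (t + 1) D l = τ) * Y ω))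
      = M.E (fun ω => (∑ y, P.deg (M.lab l) y *
        ((∑ k ∈ M.cls (insert l D) y, ind (ω.type t (insert l D) k = e)) / n)) *
          (ind (ω.hist (t + 1) D l = τ) * Y ω)) := by
    simp only [← Model.E_mul_left]
    rw [← Model.E_sum]
    congr 1
    ext ω
    rw [M.sum_cls, Finset.sum_mul]
    refine Finset.sum_congr rfl fun y _ => ?_
    rw [Finset.sum_div, Finset.mul_sum, Finset.sum_mul]
    refine Finset.sum_congr rfl fun k hk => ?_
    rw [h.edge_eq, ((M.mem_cls).1 hk).2]
    ring
  have h4 : |M.E (fun ω => (∑ y, P.deg (M.lab l) y *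
        ((∑ k ∈ M.cls (insert l D) y, ind (ω.type t (insert l D) k = e)) / n)) *
          (ind (ω.hist (t + 1) D l = τ) * Y ω))
      - P.rate t (M.lab l) e * M.E (fun ω => ind (ω.hist (t + 1) D l = τ) * Y ω)|
      ≤ 2 * (P.degBound * δ) := by
    rw [← Model.E_mul_left]
    refine (M.abs_E_sub_le _ _).trans ?_
    have hb : ∑ y, P.degBound * M.E (fun ω =>
      |(∑ k ∈ M.cls (insert l D) y, ind (ω.type t (insert l D) k = e)) / n
        - P.kap y * (P.cueProb y e.1 * P.pmf t y e.2)|) ≤ 2 * (P.degBound * δ) := by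
      refine (Finset.sum_le_card_nsmul _ _ (P.degBound * δ) fun y _ => ?_).trans_eq (by simp)
      exact mul_le_mul_of_nonneg_left (hδ y) P.degBound_pos.le
    refine le_trans ?_ hb
    simp only [← Model.E_mul_left]
    rw [← Model.E_sum]
    refine M.E_mono fun ω => ?_
    rw [← sub_mul, abs_mul, rate, ← Finset.sum_sub_distrib]
    have a1 : |ind (ω.hist (t + 1) D l = τ) * Y ω| ≤ 1 := by
      rw [abs_mul]
      exact mul_le_one₀ (abs_le_one_of_mem (ind_nonneg _) (ind_le_one _)) (abs_nonneg _)
        (abs_le_one_of_mem (hY0 ω) (hY1 ω))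
    refine (mul_le_of_le_one_right (abs_nonneg _) a1).trans ?_
    refine (Finset.abs_sum_le_sum_abs _ _).trans (Finset.sum_le_sum fun y _ => ?_)
    rw [mul_comm (P.kap y), mul_assoc, ← mul_sub, abs_mul, abs_of_pos (P.deg_pos _ _)]
    exact mul_le_mul_of_nonneg_right (P.deg_le _ _) (abs_nonneg _)
  rw [h1]
  refine (abs_sub_le _ _ _).trans (add_le_add h2 ?_)
  rw [h3]
  exact h4

/-- A vertex is isolated with the asymptotic probability `exp (-λ)`. -/
theorem Fits.abs_E_hist_zero_sub_le (h : P.Fits K M) {D : Finset (Fin n)} {l : Fin n} {t m : ℕ}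
    (hD : D.card ≤ m) {Y : Config n → ℝ} (hY0 : ∀ ω, 0 ≤ Y ω)
    (hY1 : ∀ ω, Y ω ≤ 1) (hYf : ∀ k, k ∉ D → k ≠ l → EdgeFree l k Y) :
    |M.E (fun ω => ind (ω.hist (t + 1) D l = (0 : Multiset (Bool × Hist t))) * Y ω)
      - Real.exp (-P.lam (M.lab l)) * M.E Y|
      ≤ P.degBound ^ 2 / n
        + 2 * P.degBound * (|(K n : ℝ) / n - P.κ| + (m + 1 : ℕ) / n) := by
  have hn : (0 : ℝ) < n := by exact_mod_cast l.pos
  set s : Finset (Fin n) := Finset.univ.filter (fun k => k ∉ insert l D) with hs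
  have hmem : ∀ k, k ∈ s ↔ k ∉ D ∧ k ≠ l := fun k => by
    rw [hs, Finset.mem_filter, Finset.mem_insert, not_or, and_comm (a := k ≠ l)]
    simp
  have h1 : M.E (fun ω => ind (ω.hist (t + 1) D l = (0 : Multiset (Bool × Hist t))) * Y ω)
      = (∏ k ∈ s, (1 - M.edge l k)) * M.E Y := by
    rw [← M.E_prod_not_adj_mul s (fun hh => ((hmem l).1 hh).2 rfl)
      fun k hk => hYf k ((hmem k).1 hk).1 ((hmem k).1 hk).2]
    congr 1
    ext ω
    congr 1
    by_cases hz : ω.nbrs D l = ∅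
    · rw [ind_of (by rw [Config.hist, hz]; rfl)]
      refine (Finset.prod_eq_one fun k hk => ind_of fun hadj => ?_).symm
      have : k ∈ ω.nbrs D l := Config.mem_nbrs.2 ⟨hadj, ((hmem k).1 hk).1⟩
      simp [hz] at this
    · obtain ⟨k, hk⟩ := Finset.nonempty_iff_ne_empty.2 hz
      rw [ind_of_not]
      · rw [Config.mem_nbrs] at hk
        exact (Finset.prod_eq_zero ((hmem k).2 ⟨hk.2, hk.1.ne'⟩)
          (ind_of_not fun hh => hh hk.1)).symm
      · rw [Config.hist_eq_cons hk]
        exact Multiset.cons_ne_zero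
  have hEY : |M.E Y| ≤ 1 := abs_le_one_of_mem (M.E_nonneg hY0) (M.E_le_of_le hY1)
  have hlam : 0 ≤ P.lam (M.lab l) :=
    Finset.sum_nonneg fun y _ => (mul_pos (P.kap_pos y) (P.deg_pos _ _)).le
  rw [h1, ← sub_mul, abs_mul]
  refine (mul_le_of_le_one_right (abs_nonneg _) hEY).trans ?_
  refine (abs_sub_le _ (Real.exp (-∑ k ∈ s, M.edge l k)) _).trans (add_le_add ?_ ?_)
  · refine (abs_prod_one_sub_sub_exp_le s (M.edge_nonneg l) (M.edge_le_one l)).trans ?_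
    refine (Finset.sum_le_card_nsmul _ _ ((P.degBound / n) ^ 2) fun k _ =>
      pow_le_pow_left₀ (M.edge_nonneg _ _) (h.edge_le _ _) 2).trans ?_
    rw [nsmul_eq_mul]
    have : (s.card : ℝ) ≤ n := by
      exact_mod_cast (Finset.card_le_univ s).trans_eq (Fintype.card_fin n)
    calc (s.card : ℝ) * (P.degBound / n) ^ 2 ≤ n * (P.degBound / n) ^ 2 := by gcongr
      _ = P.degBound ^ 2 / n := by field_simp
  · refine (abs_exp_neg_sub_le (Finset.sum_nonneg fun k _ => M.edge_nonneg _ _) hlam).trans ?_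
    exact h.abs_sum_edge_sub_le ((Finset.card_insert_le _ _).trans (by omega)) l

variable (P K)

/-- The empirical measure of the types of the vertices with label `y` converges. -/
def TypesConverge (t : ℕ) : Prop :=
  ∀ (m : ℕ) (y : Fin 2) (e : Bool × Hist t), ∃ ε : ℕ → ℝ, Tendsto ε atTop (𝓝 0) ∧
    ∀ {n : ℕ} (M : Model n), 0 < n → P.Fits K M → ∀ D : Finset (Fin n), D.card ≤ m →
      M.E (fun ω => |(∑ k ∈ M.cls D y, ind (ω.type t D k = e)) / n
        - P.kap y * (P.cueProb y e.1 * P.pmf t y e.2)|) ≤ ε n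

/-- The law of the history of a vertex converges, independently of everything that does not depend
on its edges. -/
def HistConverges (t : ℕ) : Prop :=
  ∀ (m : ℕ) (x : Fin 2) (τ : Hist t), ∃ ε : ℕ → ℝ, Tendsto ε atTop (𝓝 0) ∧
    ∀ {n : ℕ} (M : Model n), P.Fits K M → ∀ (D : Finset (Fin n)) (l : Fin n), D.card ≤ m →
      l ∉ D → M.lab l = x → ∀ Y : Config n → ℝ, (∀ ω, 0 ≤ Y ω) → (∀ ω, Y ω ≤ 1) →
        (∀ k, k ∉ D → k ≠ l → EdgeFree l k Y) →
        |M.E (fun ω => ind (ω.hist t D l = τ) * Y ω) - P.pmf t x τ * M.E Y| ≤ ε n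

variable {P K}

theorem tendsto_const_div_nat (c : ℝ) : Tendsto (fun n : ℕ => c / (n : ℝ)) atTop (𝓝 0) :=
  tendsto_const_div_atTop_nhds_zero_nat c

theorem histConverges_zero : P.HistConverges K 0 := by
  intro m x τ
  refine ⟨fun _ => 0, tendsto_const_nhds, fun M _ D l _ _ _ Y _ _ _ => ?_⟩
  have : ∀ ω, ind (Config.hist ω 0 D l = τ) = 1 := fun ω => ind_of rfl
  simp [this, pmf_zero]

/-- Induction on the multiset `τ`: the empty one is the isolation estimate, and adding a child
compares the approximate Mecke formula of the graph with the exact one of the limit. The common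
factor `count + 1` is at least one, so dividing by it does not enlarge the error. -/
theorem TypesConverge.histConverges_succ {t : ℕ} (hT : P.TypesConverge K t)
    (hK : Tendsto (fun n : ℕ => (K n : ℝ) / n) atTop (𝓝 P.κ)) : P.HistConverges K (t + 1) := by
  intro m x τ
  change Multiset (Bool × Hist t) at τ
  have hK0 : Tendsto (fun n : ℕ => |(K n : ℝ) / n - P.κ|) atTop (𝓝 0) := by
    simpa using (hK.sub_const P.κ).abs
  induction τ using Multiset.induction with
  | empty =>
    refine ⟨fun n => P.degBound ^ 2 / n
        + 2 * P.degBound * (|(K n : ℝ) / n - P.κ| + (m + 1 : ℕ) / n), ?_, ?_⟩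
    · have := (tendsto_const_div_nat (P.degBound ^ 2)).add
        ((hK0.add (tendsto_const_div_nat ((m + 1 : ℕ) : ℝ))).const_mul (2 * P.degBound))
      simpa using this
    · intro n M h D l hD hl hx Y hY0 hY1 hYf
      have h1 := h.abs_E_hist_zero_sub_le (t := t) hD hY0 hY1 hYf
      rw [hx, ← P.pmf_succ_zero t x] at h1
      exact h1
  | cons e τ ih =>
    obtain ⟨ε, hε, hεb⟩ := ih
    choose δ hδ hδb using fun y => hT (m + 1) y e
    refine ⟨fun n => P.degBound ^ 2 / n + 2 * (P.degBound * (δ 0 n + δ 1 n))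
      + P.rate t x e * ε n, ?_, ?_⟩
    · have := ((tendsto_const_div_nat (P.degBound ^ 2)).add
        ((((hδ 0).add (hδ 1)).const_mul P.degBound).const_mul 2)).add (hε.const_mul (P.rate t x e))
      simpa using this
    · intro n M h D l hD hl hx Y hY0 hY1 hYf
      have hcard : (insert l D).card ≤ m + 1 := (Finset.card_insert_le _ _).trans (by omega)
      have hδ0 : ∀ y, 0 ≤ δ y n := fun y =>
        (M.E_nonneg fun ω => abs_nonneg _).trans (hδb y M l.pos h (insert l D) hcard)
      have h1 := h.mecke_approx e τ hY0 hY1 hYf (δ := δ 0 n + δ 1 n) (fun y => by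
        refine (hδb y M l.pos h (insert l D) hcard).trans ?_
        match y with
        | 0 => linarith [hδ0 1]
        | 1 => linarith [hδ0 0])
      have h2 := hεb M h D l hD hl hx Y hY0 hY1 hYf
      have h3 := P.count_mul_pmf t x e τ
      have hrate : 0 ≤ P.rate t x e := Finset.sum_nonneg fun y _ =>
        mul_nonneg (mul_pos (P.kap_pos y) (P.deg_pos _ _)).le
          (mul_nonneg (P.cueProb_nonneg _ _) (P.pmf_nonneg _ _ _))
      rw [hx] at h1
      set A := M.E fun ω => ind (ω.hist (t + 1) D l = e ::ₘ τ) * Y ω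
      set B := M.E fun ω => ind (ω.hist (t + 1) D l = τ) * Y ω
      have hc : (1 : ℝ) ≤ (τ.count e : ℝ) + 1 := by
        have : (0 : ℝ) ≤ τ.count e := by positivity
        linarith
      have h4 : ((τ.count e : ℝ) + 1) * (A - P.pmf (t + 1) x (e ::ₘ τ) * M.E Y)
          = (((τ.count e : ℝ) + 1) * A - P.rate t x e * B)
            + P.rate t x e * (B - P.pmf (t + 1) x τ * M.E Y) := by
        linear_combination (-M.E Y) * h3
      have h5 : |A - P.pmf (t + 1) x (e ::ₘ τ) * M.E Y|
          ≤ |((τ.count e : ℝ) + 1) * (A - P.pmf (t + 1) x (e ::ₘ τ) * M.E Y)| := by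
        rw [abs_mul, abs_of_pos (show (0:ℝ) < (τ.count e : ℝ) + 1 by linarith)]
        exact le_mul_of_one_le_left (abs_nonneg _) hc
      refine h5.trans ?_
      rw [h4]
      refine (abs_add_le _ _).trans (add_le_add h1 ?_)
      rw [abs_mul, abs_of_nonneg hrate]
      exact mul_le_mul_of_nonneg_left h2 hrate

end Params

/-! ### From single vertices to the empirical measure -/

namespace Params

variable {P : Params} {K : ℕ → ℕ} {t : ℕ}

theorem ind_type {n : ℕ} (ω : Config n) (D : Finset (Fin n)) (k : Fin n) (c : Bool) (σ : Hist t) :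
    ind (ω.type t D k = (c, σ)) = ind (decide (k ∈ ω.C) = c) * ind (ω.hist t D k = σ) := by
  rw [← ind_and]
  exact congrArg ind (propext Prod.mk_inj)

theorem edgeFree_ind_cue {n : ℕ} (i j k : Fin n) (c : Bool) :
    EdgeFree i j fun ω => ind (decide (k ∈ ω.C) = c) :=
  edgeFree_C i j fun C => ind (decide (k ∈ C) = c)

/-- The history of `k` omits the cue status of `k` itself, which ignores all edges and so may serve
as the test variable `Y`. -/
theorem HistConverges.exists_abs_E_type_sub_le (h : P.HistConverges K t) (m : ℕ) (y : Fin 2)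
    (e : Bool × Hist t) : ∃ ε : ℕ → ℝ, Tendsto ε atTop (𝓝 0) ∧
      ∀ {n : ℕ} (M : Model n), P.Fits K M → ∀ (D : Finset (Fin n)) (k : Fin n), D.card ≤ m →
        k ∉ D → M.lab k = y →
        |M.E (fun ω => ind (ω.type t D k = e)) - P.cueProb y e.1 * P.pmf t y e.2| ≤ ε n := by
  obtain ⟨c, σ⟩ := e
  obtain ⟨ε, hε, hb⟩ := h m y σ
  refine ⟨ε, hε, fun M hM D k hD hk hy => ?_⟩
  have := hb M hM D k hD hk hy (fun ω => ind (decide (k ∈ ω.C) = c)) (fun _ => ind_nonneg _)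
    (fun _ => ind_le_one _) (fun j _ _ => edgeFree_ind_cue k j k c)
  rw [hM.E_cue, hy, mul_comm (P.pmf t y σ)] at this
  simp only [ind_type]
  simpa only [mul_comm (ind (decide (k ∈ _) = c))] using this

/-- Two vertices are explored with the other one removed. This changes their histories only if one
reaches the other, which has probability of order `1/n`. After that, `HistConverges` is applied
first at `k` and then at `k'`. -/
theorem HistConverges.exists_abs_E_type_mul_type_sub_le (h : P.HistConverges K t) (m : ℕ)
    (y : Fin 2) (e : Bool × Hist t) : ∃ ε : ℕ → ℝ, Tendsto ε atTop (𝓝 0) ∧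
      ∀ {n : ℕ} (M : Model n), P.Fits K M → ∀ (D : Finset (Fin n)) (k k' : Fin n), D.card ≤ m →
        k ∉ D → k' ∉ D → k ≠ k' → M.lab k = y → M.lab k' = y →
        |M.E (fun ω => ind (ω.type t D k = e) * ind (ω.type t D k' = e))
          - (P.cueProb y e.1 * P.pmf t y e.2) ^ 2| ≤ ε n := by
  obtain ⟨c, σ⟩ := e
  obtain ⟨ε, hε, hb⟩ := h (m + 1) y σ
  obtain ⟨R, hR, hRb⟩ := exists_Pr_reach_le P.degBound P.degBound_pos.le t
  refine ⟨fun n => 2 * (R / n) + 2 * ε n, ?_, fun {n} M hM D k k' hD hk hk' hne hy hy' => ?_⟩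
  · simpa using ((tendsto_const_div_nat R).const_mul 2).add (hε.const_mul 2)
  have hcard : ∀ v : Fin n, (insert v D).card ≤ m + 1 := fun v =>
    (Finset.card_insert_le _ _).trans (by omega)
  have hkD : k ∉ insert k' D := by simp [hk, hne]
  have hkD' : k' ∉ insert k D := by simp [hk', hne.symm]
  set cc : Config n → ℝ := fun ω =>
    ind (decide (k ∈ ω.C) = c) * ind (decide (k' ∈ ω.C) = c) with hcc
  have hcc0 : ∀ ω, 0 ≤ cc ω := fun ω => mul_nonneg (ind_nonneg _) (ind_nonneg _)
  have hcc1 : ∀ ω, cc ω ≤ 1 := fun ω => mul_le_one₀ (ind_le_one _) (ind_nonneg _) (ind_le_one _)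
  have hccf : ∀ i j, EdgeFree i j cc := fun i j =>
    (edgeFree_ind_cue i j k c).comp₂ (edgeFree_ind_cue i j k' c) (· * ·)
  have h1 : |M.E (fun ω => ind (ω.type t D k = (c, σ)) * ind (ω.type t D k' = (c, σ)))
      - M.E (fun ω => ind (ω.hist t (insert k' D) k = σ)
        * (ind (ω.hist t (insert k D) k' = σ) * cc ω))| ≤ 2 * (R / n) := by
    refine (M.abs_E_sub_le _ _).trans ?_
    have h2 : ∀ ω : Config n, |ind (ω.type t D k = (c, σ)) * ind (ω.type t D k' = (c, σ))
        - ind (ω.hist t (insert k' D) k = σ) * (ind (ω.hist t (insert k D) k' = σ) * cc ω)|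
        ≤ ind (k' ∈ ω.reach t D k) + ind (k ∈ ω.reach t D k') := by
      intro ω
      rw [ind_type, ind_type]
      have e1 : ind (decide (k ∈ ω.C) = c) * ind (ω.hist t D k = σ)
          * (ind (decide (k' ∈ ω.C) = c) * ind (ω.hist t D k' = σ))
          - ind (ω.hist t (insert k' D) k = σ) * (ind (ω.hist t (insert k D) k' = σ) * cc ω)
          = cc ω * (ind (ω.hist t D k = σ) * ind (ω.hist t D k' = σ)
            - ind (ω.hist t (insert k' D) k = σ) * ind (ω.hist t (insert k D) k' = σ)) := by
        rw [hcc]; ring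
      rw [e1, abs_mul, abs_of_nonneg (hcc0 ω)]
      refine (mul_le_of_le_one_left (abs_nonneg _) (hcc1 ω)).trans ?_
      refine (abs_mul_sub_mul_le ?_ ?_).trans (add_le_add ?_ ?_)
      · rw [abs_of_nonneg (ind_nonneg _)]; exact ind_le_one _
      · rw [abs_of_nonneg (ind_nonneg _)]; exact ind_le_one _
      · exact abs_ind_sub_ind_le fun hr => by rw [Config.hist_insert hr]
      · exact abs_ind_sub_ind_le fun hr => by rw [Config.hist_insert hr]
    refine (M.E_mono h2).trans ?_
    rw [M.E_add, ← M.Pr_eq_E_ind, ← M.Pr_eq_E_ind, two_mul]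
    exact add_le_add (hRb M hM.edge_le D k k' hk hne.symm) (hRb M hM.edge_le D k' k hk' hne)
  -- The history of `k'` with `k` removed ignores every edge at `k`, so it is an admissible part of
  -- the test variable at `k`.
  have h2 := hb M hM (insert k' D) k (hcard k') hkD hy
    (fun ω => ind (ω.hist t (insert k D) k' = σ) * cc ω)
    (fun ω => mul_nonneg (ind_nonneg _) (hcc0 ω))
    (fun ω => mul_le_one₀ (ind_le_one _) (hcc0 ω) (hcc1 ω))
    (fun j _ _ => (((edgeFree_hist t (Finset.mem_insert_self k D) hkD').comp
      fun τ => ind (τ = σ)).comp₂ (hccf k j) (· * ·)))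
  have h3 := hb M hM (insert k D) k' (hcard k) hkD' hy' cc hcc0 hcc1 (fun j _ _ => hccf k' j)
  rw [hcc, hM.E_cue_cue hne, hy, hy', ← hcc] at h3
  have hp := P.pmf_nonneg t y σ
  have h4 : |P.pmf t y σ * M.E (fun ω => ind (ω.hist t (insert k D) k' = σ) * cc ω)
      - P.pmf t y σ * (P.pmf t y σ * (P.cueProb y c * P.cueProb y c))| ≤ ε n := by
    rw [← mul_sub, abs_mul, abs_of_nonneg hp]
    exact (mul_le_of_le_one_left (abs_nonneg _) (P.pmf_le_one t y σ)).trans h3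
  rw [abs_le] at h1 h2 h4 ⊢
  constructor <;> nlinarith [h1.1, h1.2, h2.1, h2.2, h4.1, h4.2]

/-- A weak law of large numbers: asymptotic pairwise independence bounds the variance of the
frequency, and Cauchy-Schwarz turns this into a bound in mean. -/
theorem HistConverges.typesConverge (h : P.HistConverges K t)
    (hK : Tendsto (fun n : ℕ => (K n : ℝ) / n) atTop (𝓝 P.κ)) : P.TypesConverge K t := by
  intro m y e
  obtain ⟨ε₁, hε₁, hb₁⟩ := h.exists_abs_E_type_sub_le m y e
  obtain ⟨ε₂, hε₂, hb₂⟩ := h.exists_abs_E_type_mul_type_sub_le m y e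
  set r := P.cueProb y e.1 * P.pmf t y e.2 with hr
  have hr0 : 0 ≤ r := mul_nonneg (P.cueProb_nonneg _ _) (P.pmf_nonneg _ _ _)
  have hr1 : r ≤ 1 := mul_le_one₀ (P.cueProb_le_one _ _) (P.pmf_nonneg _ _ _) (P.pmf_le_one _ _ _)
  refine ⟨fun n => √(1 / n + (|ε₂ n| + 2 * |ε₁ n|)) + (|(K n : ℝ) / n - P.κ| + m / n), ?_,
    fun {n} M hn hM D hD => ?_⟩
  · have hK0 : Tendsto (fun n : ℕ => |(K n : ℝ) / n - P.κ|) atTop (𝓝 0) := by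
      simpa using (hK.sub_const P.κ).abs
    have h1 := ((tendsto_const_div_nat 1).add (hε₂.abs.add (hε₁.abs.const_mul 2))).sqrt
    simpa using h1.add (hK0.add (tendsto_const_div_nat (m : ℝ)))
  have hn' : (0 : ℝ) < n := by exact_mod_cast hn
  set s := M.cls D y with hs
  set X : Fin n → Config n → ℝ := fun k ω => ind (ω.type t D k = e) with hX
  have hcard : (s.card : ℝ) ≤ n := by
    exact_mod_cast (Finset.card_le_univ s).trans_eq (Fintype.card_fin n)
  -- The at most `n` diagonal pairs are bounded by one, which becomes `1 / n` after division by `n ^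
  -- 2`. Off the diagonal, expanding the product leaves the error `ε₂` of the joint probability and
  -- `ε₁` once for each vertex.
  have hpair : ∀ k ∈ s, ∀ k' ∈ s, M.E (fun ω => (X k ω - r) * (X k' ω - r))
      ≤ (if k = k' then 1 else 0) + (|ε₂ n| + 2 * |ε₁ n|) := by
    intro k hk k' hk'
    rw [hs, M.mem_cls] at hk hk'
    by_cases hkk : k = k'
    · subst hkk
      rw [if_pos rfl]
      refine le_add_of_le_of_nonneg (M.E_le_of_le fun ω => ?_) (by positivity)
      have h0 := ind_nonneg (ω.type t D k = e)
      have h1 := ind_le_one (ω.type t D k = e)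
      simp only [hX]
      nlinarith
    · have e1 : M.E (fun ω => (X k ω - r) * (X k' ω - r))
          = M.E (fun ω => X k ω * X k' ω) - r * M.E (X k) - r * M.E (X k') + r ^ 2 := by
        have : (fun ω => (X k ω - r) * (X k' ω - r))
            = fun ω => ((X k ω * X k' ω - r * X k ω) - r * X k' ω) + r ^ 2 := by
          ext ω; ring
        rw [this, M.E_add, M.E_sub, M.E_sub, M.E_mul_left, M.E_mul_left, M.E_const]
      have g1 := hb₁ M hM D k hD hk.1 hk.2
      have g2 := hb₁ M hM D k' hD hk'.1 hk'.2
      have g3 := hb₂ M hM D k k' hD hk.1 hk'.1 hkk hk.2 hk'.2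
      have g1' := (abs_le.1 (g1.trans (le_abs_self _))).1
      have g2' := (abs_le.1 (g2.trans (le_abs_self _))).1
      have g3' := (abs_le.1 (g3.trans (le_abs_self _))).2
      rw [e1, if_neg hkk]
      have f1 : r * (r - M.E (X k)) ≤ |ε₁ n| := by
        refine (mul_le_mul_of_nonneg_left (by linarith : _ ≤ |ε₁ n|) hr0).trans ?_
        exact mul_le_of_le_one_left (abs_nonneg _) hr1
      have f2 : r * (r - M.E (X k')) ≤ |ε₁ n| := by
        refine (mul_le_mul_of_nonneg_left (by linarith : _ ≤ |ε₁ n|) hr0).trans ?_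
        exact mul_le_of_le_one_left (abs_nonneg _) hr1
      nlinarith
  have hsq : M.E (fun ω => ((∑ k ∈ s, (X k ω - r)) / n) ^ 2)
      ≤ 1 / n + (|ε₂ n| + 2 * |ε₁ n|) := by
    have e1 : (fun ω => ((∑ k ∈ s, (X k ω - r)) / n) ^ 2)
        = fun ω => (1 / (n : ℝ) ^ 2) * ∑ k ∈ s, ∑ k' ∈ s, (X k ω - r) * (X k' ω - r) := by
      ext ω
      rw [← Finset.sum_mul_sum]
      ring
    rw [e1, M.E_mul_left, M.E_sum]
    simp only [M.E_sum]
    have e2 : ∑ k ∈ s, ∑ k' ∈ s, M.E (fun ω => (X k ω - r) * (X k' ω - r))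
        ≤ n + n ^ 2 * (|ε₂ n| + 2 * |ε₁ n|) := by
      refine (Finset.sum_le_sum fun k hk => Finset.sum_le_sum fun k' hk' =>
        hpair k hk k' hk').trans ?_
      simp only [Finset.sum_add_distrib, Finset.sum_ite_eq, Finset.sum_const, nsmul_eq_mul]
      have : ∑ k ∈ s, (if k ∈ s then (1 : ℝ) else 0) = s.card := by
        rw [Finset.sum_congr rfl fun k hk => if_pos hk]; simp
      have hs2 : (s.card : ℝ) ^ 2 * (|ε₂ n| + 2 * |ε₁ n|)
          ≤ n ^ 2 * (|ε₂ n| + 2 * |ε₁ n|) := by gcongr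
      rw [this]
      linarith
    calc 1 / (n : ℝ) ^ 2 * _ ≤ 1 / (n : ℝ) ^ 2 * (n + n ^ 2 * (|ε₂ n| + 2 * |ε₁ n|)) := by gcongr
      _ = _ := by field_simp
  have habs : M.E (fun ω => |(∑ k ∈ s, (X k ω - r)) / n|)
      ≤ √(1 / n + (|ε₂ n| + 2 * |ε₁ n|)) :=
    Real.le_sqrt_of_sq_le ((M.E_abs_sq_le _).trans hsq)
  have hpt : ∀ ω, |(∑ k ∈ s, X k ω) / n - P.kap y * r|
      ≤ |(∑ k ∈ s, (X k ω - r)) / n| + (|(K n : ℝ) / n - P.κ| + m / n) := by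
    intro ω
    have e1 : (∑ k ∈ s, X k ω) / n - P.kap y * r
        = (∑ k ∈ s, (X k ω - r)) / n + r * (s.card / n - P.kap y) := by
      rw [Finset.sum_sub_distrib, Finset.sum_const, nsmul_eq_mul]
      ring
    rw [e1]
    refine (abs_add_le _ _).trans (add_le_add le_rfl ?_)
    rw [abs_mul, abs_of_nonneg hr0]
    exact (mul_le_of_le_one_left (abs_nonneg _) hr1).trans (hM.abs_card_cls_sub_le hn hD y)
  refine (M.E_mono hpt).trans ?_
  rw [M.E_add, M.E_const]
  exact add_le_add habs le_rfl

theorem histConverges (hK : Tendsto (fun n : ℕ => (K n : ℝ) / n) atTop (𝓝 P.κ)) (t : ℕ) :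
    P.HistConverges K t := by
  induction t with
  | zero => exact histConverges_zero
  | succ t ih => exact (ih.typesConverge hK).histConverges_succ hK

end Params

/-! ### The exact posterior on tree-like neighbourhoods -/

/-- Pairs with `e.1 < e.2` stand for unordered pairs. A permutation may reverse their order, so its
action is followed by sorting, which symmetry of `F` makes harmless. -/
theorem prod_lt_perm {n : ℕ} {F : Fin n → Fin n → ℝ} (hF : ∀ x y, F x y = F y x)
    (g : Equiv.Perm (Fin n)) :
    ∏ e ∈ (Finset.univ : Finset (Fin n × Fin n)).filter (fun e => e.1 < e.2), F (g e.1) (g e.2)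
      = ∏ e ∈ (Finset.univ : Finset (Fin n × Fin n)).filter (fun e => e.1 < e.2), F e.1 e.2 := by
  have hne : ∀ (g : Equiv.Perm (Fin n)) {x y : Fin n}, x < y → ¬g x < g y → g y < g x :=
    fun g x y h h' => lt_of_le_of_ne (not_lt.1 h') fun h'' => h.ne' (g.injective h'')
  have hinv : ∀ (g : Equiv.Perm (Fin n)) (e : Fin n × Fin n), e.1 < e.2 →
      (if g.symm (if g e.1 < g e.2 then (g e.1, g e.2) else (g e.2, g e.1)).1
          < g.symm (if g e.1 < g e.2 then (g e.1, g e.2) else (g e.2, g e.1)).2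
        then (g.symm (if g e.1 < g e.2 then (g e.1, g e.2) else (g e.2, g e.1)).1,
          g.symm (if g e.1 < g e.2 then (g e.1, g e.2) else (g e.2, g e.1)).2)
        else (g.symm (if g e.1 < g e.2 then (g e.1, g e.2) else (g e.2, g e.1)).2,
          g.symm (if g e.1 < g e.2 then (g e.1, g e.2) else (g e.2, g e.1)).1)) = e := by
    rintro g ⟨x, y⟩ h
    by_cases h1 : g x < g y
    · simp only [if_pos h1, Equiv.symm_apply_apply, if_pos h]
    · simp only [if_neg h1, Equiv.symm_apply_apply, if_neg (not_lt.2 (le_of_lt h))]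
  refine Finset.prod_nbij'
    (fun e => if g e.1 < g e.2 then (g e.1, g e.2) else (g e.2, g e.1))
    (fun e => if g.symm e.1 < g.symm e.2 then (g.symm e.1, g.symm e.2)
      else (g.symm e.2, g.symm e.1)) ?_ ?_ ?_ ?_ ?_
  · intro e he
    rw [Finset.mem_filter] at he ⊢
    refine ⟨Finset.mem_univ _, ?_⟩
    split_ifs with h
    · exact h
    · exact hne g he.2 h
  · intro e he
    rw [Finset.mem_filter] at he ⊢
    refine ⟨Finset.mem_univ _, ?_⟩
    split_ifs with h
    · exact h
    · exact hne g.symm he.2 h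
  · intro e he
    exact hinv g e (Finset.mem_filter.1 he).2
  · intro e he
    exact hinv g.symm e (Finset.mem_filter.1 he).2
  · intro e he
    split_ifs with h
    · rfl
    · exact hF _ _

theorem weight_relabel {n : ℕ} (K : ℕ) (p q α : ℝ) (g : Equiv.Perm (Fin n)) (ω : Config n) :
    weight K p q α (ω.relabel g) = weight K p q α ω := by
  classical
  unfold weight
  congr 1
  · congr 1
    · simp [Config.relabel]
    · refine (prod_lt_perm (F := fun x y =>
        (let r := if x ∈ (ω.relabel g).S ∧ y ∈ (ω.relabel g).S then p else q
         if (ω.relabel g).G.Adj x y then r else 1 - r)) ?_ g).symm.trans ?_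
      · intro x y
        simp only [and_comm, SimpleGraph.adj_comm]
      · simp only [Config.relabel_adj, Config.mem_relabel_S]
  · refine (Equiv.prod_comp g _).symm.trans ?_
    simp only [Config.mem_relabel_C, Config.mem_relabel_S]

namespace Params

variable (P : Params) (K : ℕ → ℕ) {n : ℕ}

/-- The law of the model on `n` vertices. -/
noncomputable def law (n : ℕ) : Measure (Config n) :=
  HiddenCommunity.law n (K n) (P.a / n) (P.b / n) P.α

instance : IsFiniteMeasure (P.law K n) := by unfold law; infer_instance

/-- The model given the community. -/
noncomputable def model (hn : P.degBound ≤ n) (S : Finset (Fin n)) : Model n where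
  S := S
  p := P.a / n
  q := P.b / n
  α := P.α
  p_nonneg := div_nonneg P.a_pos.le n.cast_nonneg
  p_le_one := div_le_one_of_le₀ (by linarith [P.b_pos, show P.degBound = P.a + P.b from rfl])
    n.cast_nonneg
  q_nonneg := div_nonneg P.b_pos.le n.cast_nonneg
  q_le_one := div_le_one_of_le₀ (by linarith [P.a_pos, show P.degBound = P.a + P.b from rfl])
    n.cast_nonneg
  α_nonneg := P.α_pos.le
  α_le_one := P.α_lt_one.le

variable {P}

theorem fits_model (hn : P.degBound ≤ n) {S : Finset (Fin n)} (hS : S.card = K n) :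
    P.Fits K (P.model hn S) := ⟨rfl, rfl, rfl, hS⟩

theorem integral_law (hn : P.degBound ≤ n) (Y : Config n → ℝ) :
    ∫ ω, Y ω ∂(P.law K n) = ∑ ω, weight (K n) (P.a / n) (P.b / n) P.α ω * Y ω :=
  HiddenCommunity.integral_law (K n) (P.model hn ∅).p_nonneg (P.model hn ∅).p_le_one
    (P.model hn ∅).q_nonneg (P.model hn ∅).q_le_one P.α_pos.le P.α_lt_one.le Y

theorem integral_law_eq_sum_E (hn : P.degBound ≤ n) (Y : Config n → ℝ) :
    ∫ ω, Y ω ∂(P.law K n) = ((n.choose (K n) : ℕ) : ℝ)⁻¹ *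
      ∑ S ∈ Finset.univ.powersetCard (K n), (P.model hn S).E Y :=
  HiddenCommunity.integral_law_eq_sum_E (K n) (P.model hn ∅).p_nonneg (P.model hn ∅).p_le_one
    (P.model hn ∅).q_nonneg (P.model hn ∅).q_le_one P.α_pos.le P.α_lt_one.le Y

theorem measureReal_law_eq_integral (A : Config n → Prop) :
    (P.law K n).real {ω | A ω} = ∫ ω, ind (A ω) ∂(P.law K n) := by
  classical
  rw [← integral_indicator_one (by trivial)]
  congr 1

theorem measureReal_law_relabel (hn : P.degBound ≤ n) (g : Equiv.Perm (Fin n))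
    (A : Config n → Prop) :
    (P.law K n).real {ω | A (ω.relabel g)} = (P.law K n).real {ω | A ω} := by
  rw [measureReal_law_eq_integral, measureReal_law_eq_integral, integral_law K hn,
    integral_law K hn]
  refine Eq.trans (Finset.sum_congr rfl fun ω _ => ?_) ((Config.relabelEquiv g).sum_comp _)
  rw [Config.relabelEquiv, Equiv.coe_fn_mk, weight_relabel]

/-- The probability that the history of `i` is `τ`, that `i` is uncued and that its label is `x`. -/
noncomputable def joint (n t : ℕ) (τ : Hist t) (x : Fin 2) (i u : Fin n) : ℝ :=
  (P.law K n).real {ω | (ω.TreeLike t {u} i ∧ ω.hist t {u} i = τ ∧ i ∉ ω.C) ∧ ω.label i = x}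

/-- The probability of a view together with the label `x` at an uncued centre. -/
noncomputable def viewProb (t : ℕ) (ω : Config n) (x : Fin 2) (i u : Fin n) : ℝ :=
  (P.law K n).real {ω' | (ω'.view t i u = ω.view t i u ∧ i ∉ ω'.C) ∧ ω'.label i = x}

theorem exactPosteriorMessage_eq_log_viewProb (t : ℕ) (ω : Config n) (i u : Fin n) :
    exactPosteriorMessage (K n) (P.a / n) (P.b / n) P.α t ω i u
      = Real.log (viewProb (P := P) K t ω 1 i u / viewProb (P := P) K t ω 0 i u) := by
  unfold exactPosteriorMessage viewProb
  change Real.log (((P.law K n)[|_]).real _ / ((P.law K n)[|_]).real _) = _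
  set B : Set (Config n) := {ω' | ω'.view t i u = ω.view t i u ∧ i ∉ ω'.C} with hB
  have hcond : ∀ A : Set (Config n), ((P.law K n)[|B]).real A
      = ((P.law K n).real B)⁻¹ * (P.law K n).real (B ∩ A) := fun A => by
    simp [measureReal_def, cond_apply (show MeasurableSet B from trivial)]
  rw [hcond, hcond]
  -- When the conditioning event is null, both denominators vanish and both quotients are zero by
  -- the convention `x / 0 = 0`.
  by_cases h0 : (P.law K n).real B = 0
  · have h1 : ∀ A, (P.law K n).real (B ∩ A) = 0 := fun A =>
      measureReal_mono_null Set.inter_subset_left h0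
    have h2 := h1 {ω' | ω'.label i = 0}
    rw [h2, mul_zero, div_zero]
    change _ = Real.log (_ / (P.law K n).real (B ∩ {ω' | ω'.label i = 0}))
    rw [h2, div_zero]
  · rw [mul_div_mul_left _ _ (inv_ne_zero h0)]
    rfl

/-- The relabelling of `Config.exists_relabel` carries one view to the other, keeps the label and
the cue status of the fixed vertex `i`, and preserves the law. -/
theorem viewProb_eq (hn : P.degBound ≤ n) {t : ℕ} {ω ω' : Config n} {i u : Fin n} (hiu : i ≠ u)
    (hT : ω.TreeLike t {u} i) (hT' : ω'.TreeLike t {u} i)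
    (hh : ω.hist t {u} i = ω'.hist t {u} i) (hi : i ∉ ω.C) (hi' : i ∉ ω'.C) (x : Fin 2) :
    viewProb (P := P) K t ω' x i u = viewProb (P := P) K t ω x i u := by
  obtain ⟨g, hgi, -, hg⟩ := Config.exists_relabel hiu hT hT' hh hi hi'
  unfold viewProb
  rw [← measureReal_law_relabel K hn g]
  congr 1
  ext ω₁
  have hC : i ∈ (ω₁.relabel g).C ↔ i ∈ ω₁.C := by
    conv_lhs => rw [← hgi]
    exact Config.mem_relabel_C
  have hS : i ∈ (ω₁.relabel g).S ↔ i ∈ ω₁.S := by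
    conv_lhs => rw [← hgi]
    exact Config.mem_relabel_S
  simp only [Set.mem_ofPred_eq, hg, hC, Config.label, hS]

/-- A view determines the history and tree-likeness, so the event in `joint` is a disjoint union of
view events, equally likely for a given label. The factor `N` is the number of these views; it is
the same for both labels and cancels in the posterior odds. -/
theorem exists_joint_eq (hn : P.degBound ≤ n) {t : ℕ} {ω : Config n} {i u : Fin n} (hiu : i ≠ u)
    (hT : ω.TreeLike t {u} i) (hi : i ∉ ω.C) :
    ∃ N : ℝ, N ≠ 0 ∧ ∀ x, joint (P := P) K n t (ω.hist t {u} i) x i u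
      = N * viewProb (P := P) K t ω x i u := by
  classical
  obtain ⟨A, hA⟩ : ∃ A : Finset (Config n), ∀ ω', ω' ∈ A ↔
      ω'.TreeLike t {u} i ∧ ω'.hist t {u} i = ω.hist t {u} i ∧ i ∉ ω'.C :=
    ⟨Finset.univ.filter _, fun ω' => Finset.mem_filter_univ ω'⟩
  obtain ⟨V, hV⟩ : ∃ V : Finset (Set (Fin n) × Set (Fin n × Fin n) × Set (Fin n)),
      ∀ v, v ∈ V ↔ ∃ ω' ∈ A, ω'.view t i u = v :=
    ⟨A.image _, fun v => Finset.mem_image⟩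
  have hωA : ω ∈ A := (hA ω).2 ⟨hT, rfl, hi⟩
  refine ⟨V.card, ?_, fun x => ?_⟩
  · rw [Nat.cast_ne_zero, Finset.card_ne_zero]
    exact ⟨_, (hV _).2 ⟨ω, hωA, rfl⟩⟩
  have hsum : ∀ ω₁ : Config n,
      ind ((ω₁.TreeLike t {u} i ∧ ω₁.hist t {u} i = ω.hist t {u} i ∧ i ∉ ω₁.C) ∧ ω₁.label i = x)
        = ∑ v ∈ V, ind ((ω₁.view t i u = v ∧ i ∉ ω₁.C) ∧ ω₁.label i = x) := by
    intro ω₁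
    by_cases h1 : ω₁ ∈ A
    · have hv : ω₁.view t i u ∈ V := (hV _).2 ⟨ω₁, h1, rfl⟩
      rw [hA] at h1
      rw [Finset.sum_eq_single_of_mem _ hv]
      · simp [h1]
      · intro v _ hne
        exact ind_of_not fun h => hne h.1.1.symm
    · rw [ind_of_not fun h => h1 ((hA _).2 h.1),
        Finset.sum_eq_zero]
      intro v hv
      refine ind_of_not fun h => h1 ?_
      obtain ⟨ω₂, h2, rfl⟩ := (hV _).1 hv
      rw [hA] at h2 ⊢
      have h3 := Config.hist_eq_of_view_eq hiu h.1.1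
      exact ⟨h3.2.2 h2.1, h3.1.trans h2.2.1, h.1.2⟩
  unfold joint
  rw [measureReal_law_eq_integral]
  simp only [hsum]
  rw [integral_finsetSum _ fun v _ => Integrable.of_finite, Finset.sum_congr rfl (g := fun _ =>
    viewProb (P := P) K t ω x i u), Finset.sum_const, nsmul_eq_mul]
  intro v hv
  obtain ⟨ω₂, h2, rfl⟩ := (hV _).1 hv
  rw [hA] at h2
  rw [← measureReal_law_eq_integral]
  exact viewProb_eq K hn hiu hT h2.1 h2.2.1.symm hi h2.2.2 x

theorem exactPosteriorMessage_eq_log_joint (hn : P.degBound ≤ n) {t : ℕ} {ω : Config n}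
    {i u : Fin n} (hiu : i ≠ u) (hT : ω.TreeLike t {u} i) (hi : i ∉ ω.C) :
    exactPosteriorMessage (K n) (P.a / n) (P.b / n) P.α t ω i u
      = Real.log (joint (P := P) K n t (ω.hist t {u} i) 1 i u
        / joint (P := P) K n t (ω.hist t {u} i) 0 i u) := by
  obtain ⟨N, hN, h⟩ := exists_joint_eq (P := P) K hn hiu hT hi
  rw [exactPosteriorMessage_eq_log_viewProb, h, h, mul_div_mul_left _ _ hN]

end Params

/-! ### Counting communities and the limit of the joint probabilities -/

theorem card_filter_notMem_powersetCard {n : ℕ} (i : Fin n) {k : ℕ} (hk : k ≤ n) :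
    ((((Finset.univ.powersetCard k).filter fun S : Finset (Fin n) => i ∉ S).card : ℕ) : ℝ)
      = (1 - (k : ℝ) / n) * (n.choose k : ℕ) := by
  have h1 : (Finset.univ.powersetCard k).filter (fun S : Finset (Fin n) => i ∉ S)
      = (Finset.univ.erase i).powersetCard k := by
    ext S
    simp only [Finset.mem_filter, Finset.mem_powersetCard, Finset.subset_univ, true_and,
      Finset.subset_erase]
    tauto
  rw [h1, Finset.card_powersetCard, Finset.card_erase_of_mem (Finset.mem_univ i),
    Finset.card_univ, Fintype.card_fin]
  obtain ⟨m, rfl⟩ : ∃ m, n = m + 1 := ⟨n - 1, by have := i.pos; omega⟩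
  have h2 := Nat.choose_mul_succ_eq m k
  have h3 : (m.choose k : ℝ) * ((m + 1 : ℕ) : ℝ)
      = ((m + 1).choose k : ℕ) * (((m + 1 : ℕ) : ℝ) - k) := by
    rw [← Nat.cast_sub hk]
    exact_mod_cast h2
  have h4 : ((m + 1 : ℕ) : ℝ) ≠ 0 := by positivity
  rw [Nat.add_sub_cancel]
  field_simp
  linarith

namespace Params

variable {P : Params} {K : ℕ → ℕ} {n : ℕ}

theorem label_eq_lab {M : Model n} {ω : Config n} (h : ω.S = M.S) (i : Fin n) :
    ω.label i = M.lab i := by rw [Config.label, h]; rfl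

/-- The communities of the prescribed size for which the label of `i` is `x`. -/
noncomputable def communities (hn : P.degBound ≤ n) (K : ℕ → ℕ) (i : Fin n) (x : Fin 2) :
    Finset (Finset (Fin n)) :=
  (Finset.univ.powersetCard (K n)).filter fun S => (P.model hn S).lab i = x

theorem card_communities (hn : P.degBound ≤ n) (hK : K n ≤ n) (i : Fin n) (x : Fin 2) :
    ((communities hn K i x).card : ℝ)
      = (if x = 1 then (K n : ℝ) / n else 1 - (K n : ℝ) / n) * (n.choose (K n) : ℕ) := by
  have h0 : communities hn K i 0 = (Finset.univ.powersetCard (K n)).filter fun S => i ∉ S := by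
    refine Finset.filter_congr fun S _ => ?_
    unfold Model.lab model
    by_cases h : i ∈ S <;> simp [h]
  have h1 : communities hn K i 1 = (Finset.univ.powersetCard (K n)).filter fun S => ¬i ∉ S := by
    refine Finset.filter_congr fun S _ => ?_
    unfold Model.lab model
    by_cases h : i ∈ S <;> simp [h]
  have h2 := Finset.card_filter_add_card_filter_not
    (s := (Finset.univ : Finset (Fin n)).powersetCard (K n)) (fun S => i ∉ S)
  rw [Finset.card_powersetCard, Finset.card_univ, Fintype.card_fin] at h2
  have h3 := card_filter_notMem_powersetCard i hK
  have h2' : (((Finset.univ.powersetCard (K n)).filter fun S => i ∉ S).card : ℝ)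
    + ((Finset.univ.powersetCard (K n)).filter fun S => ¬i ∉ S).card = (n.choose (K n) : ℕ) := by
    exact_mod_cast h2
  fin_cases x
  · simp only [Fin.zero_eta, h0, h3, zero_ne_one, if_false]
  · simp only [Fin.mk_one, h1, if_true]
    linarith

theorem integral_law_label (hn : P.degBound ≤ n) (i : Fin n) (x : Fin 2) (Y : Config n → ℝ) :
    ∫ ω, ind (ω.label i = x) * Y ω ∂(P.law K n) = ((n.choose (K n) : ℕ) : ℝ)⁻¹ *
      ∑ S ∈ communities hn K i x, (P.model hn S).E Y := by
  rw [integral_law_eq_sum_E K hn, communities, Finset.sum_filter]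
  congr 1
  refine Finset.sum_congr rfl fun S _ => ?_
  split_ifs with h
  · refine Model.E_congr_of_S _ fun ω hω => ?_
    rw [ind_of ((label_eq_lab hω i).trans h), one_mul]
  · rw [← Model.E_const (P.model hn S) 0]
    refine Model.E_congr_of_S _ fun ω hω => ?_
    rw [ind_of_not fun h' => h ((label_eq_lab hω i).symm.trans h'), zero_mul]

theorem fits_of_mem_communities (hn : P.degBound ≤ n) {i : Fin n} {x : Fin 2}
    {S : Finset (Fin n)} (hS : S ∈ communities hn K i x) :
    P.Fits K (P.model hn S) ∧ (P.model hn S).lab i = x := by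
  rw [communities, Finset.mem_filter, Finset.mem_powersetCard] at hS
  exact ⟨fits_model K hn hS.1.2, hS.2⟩

theorem eventually_degBound_le (P : Params) : ∀ᶠ n : ℕ in atTop, P.degBound ≤ n :=
  tendsto_natCast_atTop_atTop.eventually_ge_atTop _

theorem eventually_lt (hK : Tendsto (fun n : ℕ => (K n : ℝ) / n) atTop (𝓝 P.κ)) :
    ∀ᶠ n : ℕ in atTop, 0 < K n ∧ K n < n := by
  filter_upwards [hK.eventually_lt_const P.κ_lt_one, hK.eventually_const_lt P.κ_pos,
    eventually_gt_atTop 0] with n h1 h2 h3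
  have hn : (0 : ℝ) < n := by exact_mod_cast h3
  rw [div_lt_one hn] at h1
  rw [lt_div_iff₀ hn, zero_mul] at h2
  exact ⟨by exact_mod_cast h2, by exact_mod_cast h1⟩

/-- The fraction `w` of communities that give `i` the label `x` tends to `kap x`. For each of them
the conditional probability of history `τ` at an uncued `i` converges uniformly, and demanding
tree-likeness alters it by at most `R / n`. -/
theorem eventually_abs_joint_sub_lt
    (hK : Tendsto (fun n : ℕ => (K n : ℝ) / n) atTop (𝓝 P.κ)) (t : ℕ) (τ : Hist t) (x : Fin 2)
    {ε : ℝ} (hε : 0 < ε) : ∀ᶠ n : ℕ in atTop, ∀ i u : Fin n, i ≠ u →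
      |joint (P := P) K n t τ x i u - P.kap x * (P.cueProb x false * P.pmf t x τ)| < ε := by
  obtain ⟨δ, hδ, hb⟩ := (histConverges hK t).exists_abs_E_type_sub_le 1 x (false, τ)
  obtain ⟨R, hR, hRb⟩ := exists_Pr_not_treeLike_le P.degBound P.degBound_pos.le t
  have hlim : Tendsto (fun n : ℕ => |δ n + R / n| + |(K n : ℝ) / n - P.κ|) atTop (𝓝 0) := by
    simpa using (hδ.add (tendsto_const_div_nat R)).abs.add (hK.sub_const P.κ).abs
  filter_upwards [eventually_degBound_le P, eventually_lt hK, hlim.eventually_lt_const hε]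
    with n hn hKn hlt i u hiu
  set r := P.cueProb x false * P.pmf t x τ with hr
  have hr0 : 0 ≤ r := mul_nonneg (P.cueProb_nonneg _ _) (P.pmf_nonneg _ _ _)
  have hr1 : r ≤ 1 := mul_le_one₀ (P.cueProb_le_one _ _) (P.pmf_nonneg _ _ _) (P.pmf_le_one _ _ _)
  have hN : (0 : ℝ) < (n.choose (K n) : ℕ) := by exact_mod_cast Nat.choose_pos hKn.2.le
  set T : Config n → Prop := fun ω =>
    ω.TreeLike t {u} i ∧ ω.hist t {u} i = τ ∧ i ∉ ω.C with hT
  have hiu' : i ∉ ({u} : Finset (Fin n)) := by simpa using hiu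
  have hS : ∀ S ∈ communities hn K i x,
      |(P.model hn S).E (fun ω => ind (T ω)) - r| ≤ δ n + R / n := by
    intro S hS
    obtain ⟨hM, hlab⟩ := fits_of_mem_communities hn hS
    have h1 := hb _ hM {u} i (by simp) hiu' hlab
    have h2 : |(P.model hn S).E (fun ω => ind (T ω))
        - (P.model hn S).E (fun ω => ind (ω.type t {u} i = (false, τ)))| ≤ R / n := by
      refine ((P.model hn S).abs_E_sub_le _ _).trans (le_trans ?_ (hRb _ hM.edge_le {u} i hiu'))
      rw [Model.Pr_eq_E_ind]
      refine Model.E_mono _ fun ω => abs_ind_sub_ind_le fun h => ?_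
      rw [not_not] at h
      simp only [hT, h, true_and, Config.type, Prod.mk.injEq, decide_eq_false_iff_not]
      exact and_comm
    rw [abs_le] at h1 h2 ⊢
    constructor <;> linarith [h1.1, h1.2, h2.1, h2.2]
  have hjoint : joint (P := P) K n t τ x i u = ((n.choose (K n) : ℕ) : ℝ)⁻¹ *
      ∑ S ∈ communities hn K i x, (P.model hn S).E fun ω => ind (T ω) := by
    rw [joint, measureReal_law_eq_integral, ← integral_law_label hn]
    refine integral_congr_ae (Eventually.of_forall fun ω => ?_)
    change ind (T ω ∧ _) = _
    rw [ind_and, mul_comm]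
  set w : ℝ := (communities hn K i x).card / (n.choose (K n) : ℕ) with hw
  have hw' : w = if x = 1 then (K n : ℝ) / n else 1 - (K n : ℝ) / n := by
    rw [hw, card_communities hn hKn.2.le, mul_div_assoc, div_self hN.ne', mul_one]
  have hwκ : |w - P.kap x| ≤ |(K n : ℝ) / n - P.κ| := by
    rw [hw']
    unfold kap
    split_ifs with h
    · exact le_rfl
    · rw [show 1 - (K n : ℝ) / n - (1 - P.κ) = -((K n : ℝ) / n - P.κ) by ring, abs_neg]
  have hw1 : w ≤ 1 := by
    have hdiv : (K n : ℝ) / n ≤ 1 := div_le_one_of_le₀ (by exact_mod_cast hKn.2.le) n.cast_nonneg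
    have hdiv0 : (0 : ℝ) ≤ (K n : ℝ) / n := by positivity
    rw [hw']
    split_ifs <;> linarith
  have hw0 : 0 ≤ w := by positivity
  have h3 : |joint (P := P) K n t τ x i u - w * r| ≤ w * (δ n + R / n) := by
    have e1 : joint (P := P) K n t τ x i u - w * r = ((n.choose (K n) : ℕ) : ℝ)⁻¹ *
        ∑ S ∈ communities hn K i x, ((P.model hn S).E (fun ω => ind (T ω)) - r) := by
      rw [hjoint, Finset.sum_sub_distrib, Finset.sum_const, nsmul_eq_mul, hw]
      ring
    rw [e1, abs_mul, abs_of_pos (inv_pos.2 hN)]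
    calc _ ≤ ((n.choose (K n) : ℕ) : ℝ)⁻¹ * ∑ S ∈ communities hn K i x, (δ n + R / n) := by
          gcongr
          exact (Finset.abs_sum_le_sum_abs _ _).trans (Finset.sum_le_sum hS)
      _ = _ := by rw [Finset.sum_const, nsmul_eq_mul, hw]; ring
  have hδR : w * (δ n + R / n) ≤ |δ n + R / n| := by
    refine (mul_le_mul_of_nonneg_left (le_abs_self _) hw0).trans ?_
    exact mul_le_of_le_one_left (abs_nonneg _) hw1
  have h4 : |w * r - P.kap x * r| ≤ |(K n : ℝ) / n - P.κ| := by
    rw [← sub_mul, abs_mul, abs_of_nonneg hr0]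
    exact (mul_le_of_le_one_right (abs_nonneg _) hr1).trans hwκ
  calc _ ≤ |joint (P := P) K n t τ x i u - w * r| + |w * r - P.kap x * r| := abs_sub_le _ _ _
    _ ≤ |δ n + R / n| + |(K n : ℝ) / n - P.κ| := add_le_add (h3.trans hδR) h4
    _ < ε := hlt

end Params

/-! ### Convergence of messages -/

namespace Params

variable {P : Params} {K : ℕ → ℕ} {n : ℕ}

theorem one_sub_α_le_cueProb (P : Params) (y : Fin 2) : 1 - P.α ≤ P.cueProb y false := by
  have := P.α_pos
  unfold cueProb
  split_ifs <;> simp_all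
  linarith

/-- Histories are countable, so truncation to a finite set `A` loses only the mass outside `A`. It
allows errors that are controlled one history at a time to be summed. -/
theorem abs_integral_messageLaw_sub_le (t : ℕ) (x : Fin 2) (g : ℝ →ᵇ ℝ) (A : Finset (Hist t)) :
    |∑ τ ∈ A, g (P.message t τ) * P.pmf t x τ - ∫ y, g y ∂(P.messageLaw t x : Measure ℝ)|
      ≤ ‖g‖ * (1 - ∑ τ ∈ A, P.pmf t x τ) := by
  have hint : Integrable (fun τ => g (P.message t τ)) (P.limitLaw t x) :=
    Integrable.of_bound (Measurable.of_discrete).aestronglyMeasurable ‖g‖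
      (Eventually.of_forall fun τ => g.norm_coe_le_norm _)
  have hA : MeasurableSet (A : Set (Hist t)) := .of_discrete
  have h1 : ∫ y, g y ∂(P.messageLaw t x : Measure ℝ) = ∫ τ, g (P.message t τ) ∂P.limitLaw t x := by
    rw [messageLaw_coe, integral_map (Measurable.of_discrete).aemeasurable
      g.continuous.aestronglyMeasurable]
  have h2 : ∑ τ ∈ A, g (P.message t τ) * P.pmf t x τ
      = ∫ τ in (A : Set (Hist t)), g (P.message t τ) ∂P.limitLaw t x := by
    rw [setIntegral_finset A hint.integrableOn]
    exact Finset.sum_congr rfl fun τ _ => by rw [smul_eq_mul, mul_comm]; rfl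
  have h3 : 1 - ∑ τ ∈ A, P.pmf t x τ = (P.limitLaw t x).real (A : Set (Hist t))ᶜ := by
    rw [probReal_compl_eq_one_sub hA, ← sum_measureReal_singleton]
    rfl
  rw [h1, h2, h3, ← integral_add_compl hA hint, sub_add_cancel_left, abs_neg]
  exact norm_setIntegral_le_of_norm_le_const (measure_lt_top _ _)
    fun τ _ => g.norm_coe_le_norm _

/-- The indicator that `i` and `u` are uncued. -/
noncomputable def uncued (i u : Fin n) (ω : Config n) : ℝ :=
  ind (decide (i ∈ ω.C) = false) * ind (decide (u ∈ ω.C) = false)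

theorem uncued_nonneg (i u : Fin n) (ω : Config n) : 0 ≤ uncued i u ω :=
  mul_nonneg (ind_nonneg _) (ind_nonneg _)

theorem uncued_le_one (i u : Fin n) (ω : Config n) : uncued i u ω ≤ 1 :=
  mul_le_one₀ (ind_le_one _) (ind_nonneg _) (ind_le_one _)

theorem edgeFree_uncued (j k i u : Fin n) : EdgeFree j k (uncued i u) :=
  (edgeFree_ind_cue j k i false).comp₂ (edgeFree_ind_cue j k u false) (· * ·)

theorem le_E_uncued {M : Model n} (hM : P.Fits K M) {i u : Fin n} (hiu : i ≠ u) :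
    (1 - P.α) ^ 2 ≤ M.E (uncued i u) := by
  have := hM.E_cue_cue hiu false false
  change M.E (uncued i u) = _ at this
  have hα := P.α_lt_one
  rw [this, sq]
  exact mul_le_mul (P.one_sub_α_le_cueProb _) (P.one_sub_α_le_cueProb _) (by linarith)
    (P.cueProb_nonneg _ _)

/-- If a message is close to the limiting message of the history outside of an unlikely event, then
its conditional expectations given the community converge. -/
theorem eventually_abs_E_message_sub_le
    (hK : Tendsto (fun n : ℕ => (K n : ℝ) / n) atTop (𝓝 P.κ)) {t : ℕ} (x : Fin 2)
    {X : ∀ n, Config n → Fin n → Fin n → ℝ} {Bad : ∀ n, Fin n → Fin n → Config n → Prop}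
    (hfree : ∀ n i u, i ≠ u → EdgeFree i u (Bad n i u)) {R : ℝ}
    (hbad : ∀ n (M : Model n), P.Fits K M → ∀ i u, i ≠ u → M.Pr {ω | Bad n i u ω} ≤ R / n)
    (hX : ∀ (τ : Hist t) (δ : ℝ), 0 < δ → ∀ᶠ n in atTop, ∀ i u, i ≠ u → ∀ ω : Config n,
      i ∉ ω.C → ¬Bad n i u ω → ω.hist t {u} i = τ → |X n ω i u - P.message t τ| < δ)
    (g : ℝ →ᵇ ℝ) {ε : ℝ} (hε : 0 < ε) :
    ∀ᶠ n : ℕ in atTop, ∀ M : Model n, P.Fits K M → ∀ i u : Fin n, i ≠ u → M.lab i = x →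
      |M.E (fun ω => ind (ω.G.Adj i u) * (uncued i u ω * g (X n ω i u)))
        - (∫ y, g y ∂(P.messageLaw t x : Measure ℝ))
          * M.E (fun ω => ind (ω.G.Adj i u) * uncued i u ω)|
        ≤ ε * M.E (fun ω => ind (ω.G.Adj i u) * uncued i u ω) := by
  set γ := ∫ y, g y ∂(P.messageLaw t x : Measure ℝ) with hγ
  set B := ‖g‖ with hB
  have hB0 : 0 ≤ B := norm_nonneg g
  have hc0 : 0 < (1 - P.α) ^ 2 := pow_pos (by linarith [P.α_lt_one]) 2
  -- The error budget: closeness of messages on `A` costs `ε'`, and the histories outside `A` cost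
  -- `2 * B * ε'` in the graph and `B * ε'` in the limit. Together this is `ε / 2`, leaving the
  -- other half for the terms that vanish with `n`.
  set ε' := ε / (2 * (1 + 3 * B)) with hε'
  have hε'0 : 0 < ε' := by positivity
  have hε'' : ε' + 3 * B * ε' = ε / 2 := by rw [hε']; field_simp
  obtain ⟨A, hA⟩ := P.exists_finset_pmf t x hε'0
  choose δ hδ hδb using fun τ => histConverges hK t 1 x τ
  have hclose : ∀ τ : Hist t, ∀ᶠ n in atTop, ∀ i u, i ≠ u → ∀ ω : Config n,
      i ∉ ω.C → ¬Bad n i u ω → ω.hist t {u} i = τ →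
        |g (X n ω i u) - g (P.message t τ)| ≤ ε' := by
    intro τ
    obtain ⟨d, hd, hg⟩ := Metric.continuousAt_iff.1 (g.continuous.continuousAt
      (x := P.message t τ)) ε' hε'0
    filter_upwards [hX τ d hd] with n hn i u hiu ω h1 h2 h3
    exact (hg (hn i u hiu ω h1 h2 h3)).le
  -- The sum of the `δ τ n` enters twice through `U` and once through `W`. Since `(1 - P.α) ^ 2`
  -- bounds the probability of `i` and `u` being uncued from below, dividing by it makes the error
  -- relative to that probability.
  have hlim : Tendsto (fun n : ℕ => (2 * B * (R / n) + 3 * B * ∑ τ ∈ A, δ τ n) / (1 - P.α) ^ 2)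
      atTop (𝓝 0) := by
    have h1 : Tendsto (fun n : ℕ => ∑ τ ∈ A, δ τ n) atTop (𝓝 0) := by
      simpa using tendsto_finsetSum A fun τ _ => hδ τ
    simpa using (((tendsto_const_div_nat R).const_mul (2 * B)).add
      (h1.const_mul (3 * B))).div_const ((1 - P.α) ^ 2)
  filter_upwards [(Filter.eventually_all_finset A).2 fun τ _ => hclose τ,
    hlim.eventually_le_const (half_pos hε)] with n hcl hsmall M hM i u hiu hlab
  have hiu' : i ∉ ({u} : Finset (Fin n)) := by simpa using hiu
  set cc : Config n → ℝ := uncued i u with hcc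
  set adj : Config n → ℝ := fun ω => ind (ω.G.Adj i u) with hadj
  set H : Hist t → Config n → ℝ := fun τ ω => ind (ω.hist t {u} i = τ) with hH
  have hHfree : ∀ τ, EdgeFree i u (H τ) := fun τ =>
    ((edgeFree_hist (j := i) t (Finset.mem_singleton_self u) hiu').comp
      fun σ => ind (σ = τ)).symm
  have hccfree : EdgeFree i u cc := edgeFree_uncued i u i u
  have hHcc : ∀ τ, |M.E (fun ω => H τ ω * cc ω) - P.pmf t x τ * M.E cc| ≤ δ τ n := fun τ =>
    hδb τ M hM {u} i (by simp) hiu' hlab cc (uncued_nonneg i u) (uncued_le_one i u)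
      fun k _ _ => edgeFree_uncued i k i u
  set e := M.edge i u with he
  have he0 : 0 ≤ e := M.edge_nonneg i u
  have hE : ∀ {Y : Config n → ℝ}, EdgeFree i u Y → M.E (fun ω => adj ω * Y ω) = e * M.E Y :=
    fun hY => M.E_ind_adj_mul hiu hY
  -- `W` is the truncated limiting message and `U` dominates the error pointwise. Both ignore the
  -- edge `{i, u}`, so the adjacency indicator contributes the same factor `e` everywhere; no such
  -- property of `X` is needed.
  set W : Config n → ℝ := fun ω => ∑ τ ∈ A, g (P.message t τ) * (H τ ω * cc ω) with hW
  set U : Config n → ℝ := fun ω => ε' * cc ω + 2 * B * ind (Bad n i u ω)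
    + 2 * B * (cc ω - ∑ τ ∈ A, H τ ω * cc ω) with hU
  have hWfree : EdgeFree i u W := fun ω ω' hS hC hG => by
    simp only [hW]
    exact Finset.sum_congr rfl fun τ _ => by
      rw [hHfree τ ω ω' hS hC hG, hccfree ω ω' hS hC hG]
  have hUfree : EdgeFree i u U := fun ω ω' hS hC hG => by
    simp only [hU]
    rw [hccfree ω ω' hS hC hG, hfree n i u hiu ω ω' hS hC hG]
    congr 3
    exact Finset.sum_congr rfl fun τ _ => by rw [hHfree τ ω ω' hS hC hG]
  have hpt : ∀ ω, |cc ω * g (X n ω i u) - W ω| ≤ U ω := by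
    intro ω
    have hcc0 : 0 ≤ cc ω := uncued_nonneg i u ω
    have hcc1 : cc ω ≤ 1 := uncued_le_one i u ω
    have hg1 : ∀ y, |g y| ≤ B := fun y => g.norm_coe_le_norm y
    by_cases hmem : ω.hist t {u} i ∈ A
    · have h1 : ∀ F : Hist t → ℝ, ∑ τ ∈ A, F τ * (H τ ω * cc ω)
          = F (ω.hist t {u} i) * cc ω := fun F => by
        rw [Finset.sum_eq_single_of_mem _ hmem]
        · simp only [hH, ind_of, one_mul]
        · intro τ _ hne
          simp only [hH]
          rw [ind_of_not hne.symm]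
          ring
      have h2 := h1 fun _ => 1
      simp only [one_mul] at h2
      simp only [hW, hU]
      rw [h1, h2, sub_self, mul_zero, add_zero, mul_comm, ← sub_mul, abs_mul, abs_of_nonneg hcc0]
      by_cases hb : Bad n i u ω
      · rw [ind_of hb]
        have h3 : |g (X n ω i u) - g (P.message t (ω.hist t {u} i))| ≤ 2 * B :=
          (abs_sub _ _).trans (by linarith [hg1 (X n ω i u), hg1 (P.message t (ω.hist t {u} i))])
        have h4 := mul_le_mul h3 hcc1 hcc0 (by positivity)
        have h5 : 0 ≤ ε' * cc ω := by positivity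
        linarith
      · rw [ind_of_not hb, mul_zero, add_zero]
        by_cases hi : i ∈ ω.C
        · have : cc ω = 0 := by
            simp only [hcc, uncued]
            rw [ind_of_not (by simpa using hi), zero_mul]
          rw [this]; simp
        · exact mul_le_mul_of_nonneg_right (hcl _ hmem i u hiu ω hi hb rfl) hcc0
    · have h1 : ∀ F : Hist t → ℝ, ∑ τ ∈ A, F τ * (H τ ω * cc ω) = 0 := fun F =>
        Finset.sum_eq_zero fun τ hτ => by
          simp only [hH]
          rw [ind_of_not (show ¬ω.hist t {u} i = τ from fun h => hmem (by rwa [h]))]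
          ring
      have h2 := h1 fun _ => 1
      simp only [one_mul] at h2
      simp only [hW, hU]
      rw [h1, h2, sub_zero, sub_zero, abs_mul, abs_of_nonneg hcc0]
      have h3 := mul_le_mul_of_nonneg_left (hg1 (X n ω i u)) hcc0
      have h4 : 0 ≤ ε' * cc ω := by positivity
      have h5 : 0 ≤ 2 * B * ind (Bad n i u ω) := mul_nonneg (by positivity) (ind_nonneg _)
      nlinarith
  set m := M.E cc with hm
  have hm0 : (1 - P.α) ^ 2 ≤ m := le_E_uncued hM hiu
  have hsum : ∀ F : Hist t → ℝ, (∀ τ, |F τ| ≤ B) →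
      |∑ τ ∈ A, F τ * M.E (fun ω => H τ ω * cc ω) - (∑ τ ∈ A, F τ * P.pmf t x τ) * m|
        ≤ B * ∑ τ ∈ A, δ τ n := by
    intro F hF
    rw [Finset.sum_mul, ← Finset.sum_sub_distrib, Finset.mul_sum]
    refine (Finset.abs_sum_le_sum_abs _ _).trans (Finset.sum_le_sum fun τ _ => ?_)
    rw [mul_assoc, ← mul_sub, abs_mul]
    exact mul_le_mul (hF τ) (hHcc τ) (abs_nonneg _) hB0
  have hEW : M.E W = ∑ τ ∈ A, g (P.message t τ) * M.E (fun ω => H τ ω * cc ω) := by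
    rw [hW, M.E_sum]
    exact Finset.sum_congr rfl fun τ _ => M.E_mul_left _ _
  have hEU : M.E U = ε' * m + 2 * B * M.Pr {ω | Bad n i u ω}
      + 2 * B * (m - ∑ τ ∈ A, M.E (fun ω => H τ ω * cc ω)) := by
    rw [hU, M.E_add, M.E_add, M.E_mul_left, M.E_mul_left, M.E_mul_left, M.E_sub, M.E_sum,
      M.Pr_eq_E_ind]
  set s := ∑ τ ∈ A, P.pmf t x τ with hs
  have hs1 : |∑ τ ∈ A, M.E (fun ω => H τ ω * cc ω) - s * m| ≤ ∑ τ ∈ A, δ τ n := by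
    rw [hs, Finset.sum_mul, ← Finset.sum_sub_distrib]
    exact (Finset.abs_sum_le_sum_abs _ _).trans (Finset.sum_le_sum fun τ _ => hHcc τ)
  have hs2 := hsum (fun τ => g (P.message t τ)) fun τ => g.norm_coe_le_norm _
  rw [← hEW] at hs2
  have hs3 := P.abs_integral_messageLaw_sub_le t x g A
  set G := ∑ τ ∈ A, g (P.message t τ) * P.pmf t x τ with hG
  have hs4 : |G - γ| ≤ B * ε' :=
    hs3.trans (mul_le_mul_of_nonneg_left (by linarith) hB0)
  have hmpos : 0 < m := hc0.trans_le hm0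
  have hs5 : |G * m - γ * m| ≤ B * ε' * m := by
    rw [← sub_mul, abs_mul, abs_of_pos hmpos]
    exact mul_le_mul_of_nonneg_right hs4 hmpos.le
  have hUle : M.E U ≤ ε' * m + 2 * B * (R / n) + 2 * B * (ε' * m + ∑ τ ∈ A, δ τ n) := by
    rw [hEU]
    have h1 := hbad n M hM i u hiu
    have h2 : m - ∑ τ ∈ A, M.E (fun ω => H τ ω * cc ω) ≤ ε' * m + ∑ τ ∈ A, δ τ n := by
      have h3 := (abs_le.1 hs1).1
      have h4 : (1 - s) * m ≤ ε' * m := mul_le_mul_of_nonneg_right (by linarith) hmpos.le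
      linarith
    gcongr
  have hfin : M.E U + |M.E W - γ * m| ≤ ε * m := by
    have h1 : |M.E W - γ * m| ≤ B * ∑ τ ∈ A, δ τ n + B * ε' * m :=
      (abs_sub_le _ (G * m) _).trans (add_le_add hs2 hs5)
    have h2 : 2 * B * (R / n) + 3 * B * ∑ τ ∈ A, δ τ n ≤ ε / 2 * m := by
      rw [div_le_iff₀ hc0] at hsmall
      exact hsmall.trans (mul_le_mul_of_nonneg_left hm0 (by positivity))
    have h3 : (ε' + 3 * B * ε') * m = ε / 2 * m := by rw [hε'']
    linarith
  rw [hE hccfree]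
  have hZ : |M.E (fun ω => adj ω * (cc ω * g (X n ω i u))) - e * M.E W| ≤ e * M.E U := by
    rw [← hE hWfree, ← hE hUfree]
    refine (M.abs_E_sub_le _ _).trans (M.E_mono fun ω => ?_)
    rw [← mul_sub, abs_mul, abs_of_nonneg (ind_nonneg _)]
    exact mul_le_mul_of_nonneg_left (hpt ω) (ind_nonneg _)
  calc _ ≤ |M.E (fun ω => adj ω * (cc ω * g (X n ω i u))) - e * M.E W|
        + |e * M.E W - γ * (e * m)| := abs_sub_le _ _ _
    _ ≤ e * M.E U + e * |M.E W - γ * m| := by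
        refine add_le_add hZ (le_of_eq ?_)
        rw [show e * M.E W - γ * (e * m) = e * (M.E W - γ * m) by ring, abs_mul, abs_of_nonneg he0]
    _ = e * (M.E U + |M.E W - γ * m|) := by ring
    _ ≤ e * (ε * m) := mul_le_mul_of_nonneg_left hfin he0
    _ = ε * (e * m) := by ring

end Params

/-! ### From fixed communities to the conditioned law -/

namespace Params

variable {P : Params} {K : ℕ → ℕ}

/-- The conditional expectation is a ratio of sums over communities. For each community the error is
proportional to its own share `pr S` of the conditioning event, so the relative bound survives
summation and division. -/
theorem messagesConvergeInLaw_of_close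
    (hK : Tendsto (fun n : ℕ => (K n : ℝ) / n) atTop (𝓝 P.κ)) {t : ℕ} (x : Fin 2)
    {X : ∀ n, Config n → Fin n → Fin n → ℝ} {Bad : ∀ n, Fin n → Fin n → Config n → Prop}
    (hfree : ∀ n i u, i ≠ u → EdgeFree i u (Bad n i u)) {R : ℝ}
    (hbad : ∀ n (M : Model n), P.Fits K M → ∀ i u, i ≠ u → M.Pr {ω | Bad n i u ω} ≤ R / n)
    (hX : ∀ (τ : Hist t) (δ : ℝ), 0 < δ → ∀ᶠ n in atTop, ∀ i u, i ≠ u → ∀ ω : Config n,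
      i ∉ ω.C → ¬Bad n i u ω → ω.hist t {u} i = τ → |X n ω i u - P.message t τ| < δ) :
    MessagesConvergeInLaw (P.law K) x X (P.messageLaw t x) := by
  classical
  intro g ε hε
  filter_upwards [eventually_abs_E_message_sub_le hK x hfree hbad hX g (half_pos hε),
    eventually_degBound_le P, eventually_lt hK] with n hmain hn hKn i u hiu
  set γ := ∫ y, g y ∂(P.messageLaw t x : Measure ℝ) with hγ
  have hnpos : (0 : ℝ) < n := by exact_mod_cast i.pos
  have hN : (0 : ℝ) < (n.choose (K n) : ℕ) := by exact_mod_cast Nat.choose_pos hKn.2.le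
  set B := messageEvent x i u with hB
  have hBmeas : MeasurableSet B := trivial
  have hBint : ∀ F : Config n → ℝ, ∫ ω in B, F ω ∂(P.law K n) = ((n.choose (K n) : ℕ) : ℝ)⁻¹ *
      ∑ S ∈ communities hn K i x,
        (P.model hn S).E fun ω => ind (ω.G.Adj i u) * (uncued i u ω * F ω) := fun F => by
    rw [← integral_law_label hn, ← integral_indicator hBmeas]
    refine integral_congr_ae (Eventually.of_forall fun ω => ?_)
    have h1 : ind (ω.label i = x) * (ind (ω.G.Adj i u) * (uncued i u ω * F ω))
        = ind (ω ∈ B) * F ω := by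
      have h2 : ω ∈ B ↔ ω.label i = x ∧ ω.G.Adj i u ∧
          decide (i ∈ ω.C) = false ∧ decide (u ∈ ω.C) = false := by
        rw [decide_eq_false_iff_not, decide_eq_false_iff_not]
        change (_ ∧ _ ∧ _ ∧ _) ↔ _
        tauto
      rw [h2, ind_and, ind_and, ind_and, uncued]
      ring
    change _ = ind (ω.label i = x) * (ind (ω.G.Adj i u) * (uncued i u ω * F ω))
    rw [h1]
    by_cases hω : ω ∈ B
    · rw [Set.indicator_of_mem hω, ind_of hω, one_mul]
    · rw [Set.indicator_of_notMem hω, ind_of_not hω, zero_mul]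
  set pr : Finset (Fin n) → ℝ := fun S =>
    (P.model hn S).E fun ω => ind (ω.G.Adj i u) * uncued i u ω with hpr
  have hpos : ∀ S ∈ communities hn K i x, 0 < pr S := by
    intro S hS
    obtain ⟨hM, -⟩ := fits_of_mem_communities hn hS
    have h1 : pr S = (P.model hn S).edge i u * (P.model hn S).E (uncued i u) :=
      Model.E_ind_adj_mul _ hiu (edgeFree_uncued i u i u)
    rw [h1, hM.edge_eq]
    refine mul_pos (div_pos (P.deg_pos _ _) hnpos) (lt_of_lt_of_le ?_ (le_E_uncued hM hiu))
    exact pow_pos (by linarith [P.α_lt_one]) 2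
  have hne : (communities hn K i x).Nonempty := by
    rw [← Finset.card_pos, ← Nat.cast_pos (α := ℝ), card_communities hn hKn.2.le]
    have h1 : (0 : ℝ) < (K n : ℝ) / n := div_pos (by exact_mod_cast hKn.1) hnpos
    have h2 : (K n : ℝ) / n < 1 := (div_lt_one hnpos).2 (by exact_mod_cast hKn.2)
    refine mul_pos ?_ hN
    split_ifs <;> linarith
  have hBreal : (P.law K n).real B
      = ((n.choose (K n) : ℕ) : ℝ)⁻¹ * ∑ S ∈ communities hn K i x, pr S := by
    have := hBint fun _ => 1
    rw [setIntegral_const, smul_eq_mul, mul_one] at this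
    simpa only [mul_one] using this
  have hBpos : 0 < (P.law K n).real B := by
    rw [hBreal]
    exact mul_pos (inv_pos.2 hN) (Finset.sum_pos hpos hne)
  have hcond : ∫ ω, g (X n ω i u) ∂((P.law K n)[|B])
      = ((P.law K n).real B)⁻¹ * ∫ ω in B, g (X n ω i u) ∂(P.law K n) := by
    rw [ProbabilityTheory.cond, integral_smul_measure, ENNReal.toReal_inv, smul_eq_mul]
    rfl
  have hdiff : |∫ ω in B, g (X n ω i u) ∂(P.law K n) - γ * (P.law K n).real B|
      ≤ ε / 2 * (P.law K n).real B := by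
    rw [hBint, hBreal]
    have e1 : ((n.choose (K n) : ℕ) : ℝ)⁻¹ * ∑ S ∈ communities hn K i x, (P.model hn S).E
          (fun ω => ind (ω.G.Adj i u) * (uncued i u ω * g (X n ω i u)))
        - γ * (((n.choose (K n) : ℕ) : ℝ)⁻¹ * ∑ S ∈ communities hn K i x, pr S)
        = ((n.choose (K n) : ℕ) : ℝ)⁻¹ * ∑ S ∈ communities hn K i x, ((P.model hn S).E
          (fun ω => ind (ω.G.Adj i u) * (uncued i u ω * g (X n ω i u))) - γ * pr S) := by
      rw [Finset.sum_sub_distrib, ← Finset.mul_sum]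
      ring
    rw [e1, abs_mul, abs_of_pos (inv_pos.2 hN), mul_left_comm (ε / 2), Finset.mul_sum (a := ε / 2)]
    refine mul_le_mul_of_nonneg_left ?_ (inv_pos.2 hN).le
    refine (Finset.abs_sum_le_sum_abs _ _).trans (Finset.sum_le_sum fun S hS => ?_)
    obtain ⟨hM, hlab⟩ := fits_of_mem_communities hn hS
    exact hmain _ hM i u hiu hlab
  rw [hcond]
  have e2 : ((P.law K n).real B)⁻¹ * ∫ ω in B, g (X n ω i u) ∂(P.law K n) - γ
      = ((P.law K n).real B)⁻¹ *
        (∫ ω in B, g (X n ω i u) ∂(P.law K n) - γ * (P.law K n).real B) := by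
    field_simp
  rw [e2, abs_mul, abs_of_pos (inv_pos.2 hBpos)]
  calc _ ≤ ((P.law K n).real B)⁻¹ * (ε / 2 * (P.law K n).real B) :=
        mul_le_mul_of_nonneg_left hdiff (inv_pos.2 hBpos).le
    _ = ε / 2 := by field_simp
    _ < ε := half_lt_self hε

theorem tendsto_upsilon (hK : Tendsto (fun n : ℕ => (K n : ℝ) / n) atTop (𝓝 P.κ)) :
    Tendsto (fun n => -upsilon n (K n) P.α) atTop (𝓝 P.init) := by
  have hκ := P.κ_pos; have hκ' := P.κ_lt_one; have hα' := P.α_lt_one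
  have h0 : 0 < (1 - P.κ) / (P.κ * (1 - P.α)) :=
    div_pos (by linarith) (mul_pos hκ (by linarith))
  have h1 : Tendsto (fun n : ℕ => (1 - (K n : ℝ) / n) / ((K n : ℝ) / n * (1 - P.α))) atTop
      (𝓝 ((1 - P.κ) / (P.κ * (1 - P.α)))) :=
    (hK.const_sub 1).div (hK.mul_const _) (mul_pos hκ (by linarith)).ne'
  have h2 := (h1.log h0.ne').neg
  rw [init, ← inv_div, Real.log_inv]
  refine h2.congr' ?_
  filter_upwards [eventually_gt_atTop 0] with n hn
  have hn' : (n : ℝ) ≠ 0 := by positivity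
  unfold upsilon
  congr 2
  rw [one_sub_div hn', div_mul_eq_mul_div, div_div_div_cancel_right₀ hn']

/-- The bad event is the closing of a walk. Outside it the message is `histMessage` with the
constants of size `n`, which converges for each fixed history. -/
theorem messagesConvergeInLaw_bp
    (hK : Tendsto (fun n : ℕ => (K n : ℝ) / n) atTop (𝓝 P.κ)) (t : ℕ) (x : Fin 2) :
    MessagesConvergeInLaw (P.law K) x
      (fun n => bpPosteriorMessage (K n) (P.a / n) (P.b / n) P.α t) (P.messageLaw t x) := by
  obtain ⟨R, hR, hRb⟩ := exists_Pr_closes_le P.degBound P.degBound_pos.le t 1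
  have hne : ∀ {n : ℕ} {i u : Fin n}, i ≠ u → i ∉ ({u} : Finset (Fin n)) := fun h => by simpa using h
  refine messagesConvergeInLaw_of_close hK x (R := R)
    (Bad := fun n i u ω => ω.Closes t {u} u i) ?_ ?_ ?_
  · intro n i u hiu
    exact edgeFree_closes t (Finset.mem_singleton_self u) (hne hiu)
  · intro n M hM i u hiu
    exact hRb M hM.edge_le {u} u i (by simp) (hne hiu)
  · intro τ δ hδ
    have hfield : Tendsto (fun n : ℕ => -(K n : ℝ) * (P.a / n - P.b / n) - upsilon n (K n) P.α) atTop
        (𝓝 P.field) := by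
      have h1 := (hK.neg.mul_const (P.a - P.b)).add (tendsto_upsilon hK)
      have h2 : P.field = -P.κ * (P.a - P.b) + P.init := by
        rw [field, init, ← inv_div (1 - P.κ), Real.log_inv, sub_eq_add_neg]
      rw [h2]
      refine h1.congr fun n => ?_
      ring
    have h := Metric.tendsto_nhds.1 (tendsto_histMessage (div_pos P.a_pos P.b_pos)
      (tendsto_upsilon hK) hfield t τ) δ hδ
    filter_upwards [h, eventually_gt_atTop 0] with n hn hn0 i u hiu ω _ hc hτ
    have hn' : (n : ℝ) ≠ 0 := by positivity
    rw [bpPosteriorMessage_eq_histMessage (Finset.mem_singleton_self u) hc, hτ,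
      div_div_div_cancel_right₀ hn']
    exact hn

/-- The bad event is the failure of tree-likeness. Outside it the message is the logarithm of a
ratio of joint probabilities of the history, and the limit of that ratio was identified by
`log_likelihood_eq_message`. -/
theorem messagesConvergeInLaw_exact
    (hK : Tendsto (fun n : ℕ => (K n : ℝ) / n) atTop (𝓝 P.κ)) (t : ℕ) (x : Fin 2) :
    MessagesConvergeInLaw (P.law K) x
      (fun n => exactPosteriorMessage (K n) (P.a / n) (P.b / n) P.α t) (P.messageLaw t x) := by
  obtain ⟨R, hR, hRb⟩ := exists_Pr_not_treeLike_le P.degBound P.degBound_pos.le t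
  have hne : ∀ {n : ℕ} {i u : Fin n}, i ≠ u → i ∉ ({u} : Finset (Fin n)) := fun h => by simpa using h
  refine messagesConvergeInLaw_of_close hK x (R := R)
    (Bad := fun n i u ω => ¬ω.TreeLike t {u} i) ?_ ?_ ?_
  · intro n i u hiu
    exact ((edgeFree_treeLike (j := i) t (Finset.mem_singleton_self u) (hne hiu)).comp
      fun p => ¬p).symm
  · intro n M hM i u hiu
    exact hRb M hM.edge_le {u} i (hne hiu)
  · intro τ δ hδ
    have hκ := P.κ_pos; have hκ' := P.κ_lt_one; have hα' := P.α_lt_one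
    have hL : ∀ y, 0 < P.kap y * (P.cueProb y false * P.pmf t y τ) := fun y =>
      mul_pos (P.kap_pos y) (mul_pos (lt_of_lt_of_le (by linarith) (P.one_sub_α_le_cueProb y))
        (P.pmf_pos t y τ))
    set L := fun y => P.kap y * (P.cueProb y false * P.pmf t y τ) with hLdef
    have hmsg : Real.log (L 1 / L 0) = P.message t τ := by
      rw [← P.log_likelihood_eq_message t τ]
      simp [hLdef, kap, cueProb, mul_assoc]
    -- Both limits are positive, so the log-ratio is continuous there and small errors in the two
    -- joint probabilities are enough.
    have hcont : ContinuousAt (fun z : ℝ × ℝ => Real.log (z.1 / z.2)) (L 1, L 0) :=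
      (continuousAt_fst.div continuousAt_snd (hL 0).ne').log (div_pos (hL 1) (hL 0)).ne'
    obtain ⟨d, hd, hdb⟩ := Metric.continuousAt_iff.1 hcont δ hδ
    filter_upwards [eventually_abs_joint_sub_lt hK t τ 0 hd, eventually_abs_joint_sub_lt hK t τ 1 hd,
      eventually_degBound_le P] with n h0 h1 hn i u hiu ω hi hT hτ
    rw [exactPosteriorMessage_eq_log_joint K hn hiu (not_not.1 hT) hi, hτ, ← hmsg]
    refine hdb (x := (joint (P := P) K n t τ 1 i u, joint (P := P) K n t τ 0 i u)) ?_
    rw [Prod.dist_eq, max_lt_iff]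
    exact ⟨h1 i u hiu, h0 i u hiu⟩

end Params

end HiddenCommunity

/-! ### The main theorem -/

theorem mainTheorem5 (a b κ α : ℝ) (ha : 0 < a) (hb : 0 < b) (hκ : κ ∈ Set.Ioo (0 : ℝ) 1)
    (hα : α ∈ Set.Ioo (0 : ℝ) 1) (K : ℕ → ℕ)
    (hK : Tendsto (fun n : ℕ => (K n : ℝ) / n) atTop (𝓝 κ)) :
    ∃ ξ₀ ξ₁ : ℕ → ProbabilityMeasure ℝ,
      (∀ t : ℕ,
        HiddenCommunity.MessagesConvergeInLaw
          (fun n => HiddenCommunity.law n (K n) (a / n) (b / n) α) 0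
          (fun n => HiddenCommunity.bpPosteriorMessage (K n) (a / n) (b / n) α t) (ξ₀ t) ∧
        HiddenCommunity.MessagesConvergeInLaw
          (fun n => HiddenCommunity.law n (K n) (a / n) (b / n) α) 1
          (fun n => HiddenCommunity.bpPosteriorMessage (K n) (a / n) (b / n) α t) (ξ₁ t) ∧
        HiddenCommunity.MessagesConvergeInLaw
          (fun n => HiddenCommunity.law n (K n) (a / n) (b / n) α) 0
          (fun n => HiddenCommunity.exactPosteriorMessage (K n) (a / n) (b / n) α t) (ξ₀ t) ∧
        HiddenCommunity.MessagesConvergeInLaw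
          (fun n => HiddenCommunity.law n (K n) (a / n) (b / n) α) 1
          (fun n => HiddenCommunity.exactPosteriorMessage (K n) (a / n) (b / n) α t) (ξ₁ t)) ∧
      (ξ₀ 0 : Measure ℝ) = Measure.dirac (Real.log (κ * (1 - α) / (1 - κ))) ∧
      (ξ₁ 0 : Measure ℝ) = Measure.dirac (Real.log (κ * (1 - α) / (1 - κ))) ∧
      (∀ t : ℕ, (ξ₀ (t + 1) : Measure ℝ) =
        HiddenCommunity.poissonSumLaw
          (-κ * (a - b) - Real.log ((1 - κ) / (κ * (1 - α)))) (a / b)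
          (κ * b * α).toNNReal ((1 - κ) * b).toNNReal (κ * b * (1 - α)).toNNReal
          (ξ₀ t) (ξ₁ t)) ∧
      (∀ t : ℕ, (ξ₁ (t + 1) : Measure ℝ) =
        HiddenCommunity.poissonSumLaw
          (-κ * (a - b) - Real.log ((1 - κ) / (κ * (1 - α)))) (a / b)
          (κ * a * α).toNNReal ((1 - κ) * b).toNNReal (κ * a * (1 - α)).toNNReal
          (ξ₀ t) (ξ₁ t)) := by
  obtain ⟨P, rfl, rfl, rfl, rfl⟩ : ∃ P : HiddenCommunity.Params,
      P.a = a ∧ P.b = b ∧ P.κ = κ ∧ P.α = α :=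
    ⟨⟨a, b, κ, α, ha, hb, hκ.1, hκ.2, hα.1, hα.2⟩, rfl, rfl, rfl, rfl⟩
  refine ⟨fun t => P.messageLaw t 0, fun t => P.messageLaw t 1, fun t =>
    ⟨P.messagesConvergeInLaw_bp hK t 0, P.messagesConvergeInLaw_bp hK t 1,
      P.messagesConvergeInLaw_exact hK t 0, P.messagesConvergeInLaw_exact hK t 1⟩,
    P.messageLaw_zero 0, P.messageLaw_zero 1, fun t => ?_, fun t => ?_⟩
  · rw [P.messageLaw_succ t 0]
    simp [HiddenCommunity.Params.deg, HiddenCommunity.Params.field]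
  · rw [P.messageLaw_succ t 1]
    simp [HiddenCommunity.Params.deg, HiddenCommunity.Params.field]
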